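/- Let $\mathbb{T}$ be the category of *time objects*. Its objects are pairs $(\mathcal{E},\delta)$ of a finite subset $\mathcal{E}$ of a fixed countably infinite set of clocks and a function $\delta:\mathcal{E}\to\mathbb{N}$; a morphism $(\mathcal{E},\delta)\to(\mathcal{E}',\delta')$ is a function $\tau:\mathcal{E}\to\mathcal{E}'$ with $\delta'(\tau(c))\le\delta(c)$ for all $c\in\mathcal{E}$. Work in the category $\mathrm{Set}^{\mathbb{T}}$ of covariant presheaves and write $y(\mathcal{E},\delta)=\mathrm{Hom}_{\mathbb{T}}((\mathcal{E},\delta),-)$. A morphism $p:A\to B$ is *orthogonal* to an object $X$ if for all $Y$, $f:Y\times X\to A$ and $g:Y\to B$ with $p\circ f=g\circ\pi_Y$ there is a unique $h:Y\to A$ with $h\circ\pi_Y=f$ and $p\circ h=g$. It is *invariant under clock introduction* if it is orthogonal to every representable presheaf $y(\{\lambda\},n)$, where $\lambda$ is a clock and $n\in\mathbb{N}$. Consider guarded dependent type theory with clocks. Contexts consist of declarations $x:A$ and $\kappa:\mathsf{clock}$. The types are dependent products $\Pi(x:A).B$, dependent sums $\Sigma(x:A).B$, clock quantification $\forall\kappa.A$,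 extensional identity types $\mathrm{Id}_A(t,s)$ (with equality reflection), later types $\triangleright^\kappa\xi.A$ with delayed substitutions $\xi=[x_1\leftarrow t_1,\dots,x_m\leftarrow t_m]$ (the ordinary $\triangleright^\kappa A$ being the case of the empty $\xi$), universes $\mathcal{U}_\Delta$ for finite sets $\Delta$ of clock variables in the context, and $\mathrm{El}_\Delta(t)$ for $t:\mathcal{U}_\Delta$. The terms are variables, $\lambda$-abstraction and application, pairs and projections, clock abstraction $\Lambda\kappa.t$ and clock application $t[\kappa]$, $\mathsf{next}^\kappa\xi.t$, $\mathsf{prev}\,\kappa.t$, $\mathsf{fix}^\kappa x.t$, $\mathsf{refl}$, and the inclusions $\mathrm{in}_{\Delta,\Delta'}:\mathcal{U}_\Delta\to\mathcal{U}_{\Delta'}$ for $\Delta\subseteq\Delta'$. The judgemental equality contains the $\beta$- and $\eta$-rules, the rules for $\mathsf{next}$, $\mathsf{prev}$ and $\mathsf{fix}$, the clock irrelevance axiom ($t[\kappa']=t[\kappa'']:A$ for $t:\forall\kappa.A$ with $\kappa\notin A$), the equations of delayed substitutions, and $\mathrm{El}_{\Delta'}(\mathrm{in}_{\Delta,\Delta'}(t))=\mathrm{El}_\Delta(t)$.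 Contexts are interpreted as presheaves $[\![\Gamma]\!]$ on $\mathbb{T}$. The empty context is the terminal presheaf, $[\![\Gamma,\kappa:\mathsf{clock}]\!]=[\![\Gamma]\!]\times\mathcal{C}$ with $\mathcal{C}(\mathcal{E},\delta)=\mathcal{E}$, and $[\![\Gamma,x:A]\!]_{(\mathcal{E},\delta)}$ is the set of pairs $(\gamma,a)$ with $\gamma\in[\![\Gamma]\!]_{(\mathcal{E},\delta)}$ and $a\in[\![A]\!]_{(\mathcal{E},\delta)}(\gamma)$. Types in context $\Gamma$ are interpreted as families over the elements of $[\![\Gamma]\!]$ (with functorial restriction maps), and terms as natural families of elements. Dependent products, dependent sums and $\forall\kappa$ have their standard presheaf interpretation, $\forall\kappa.A$ being the dependent product over $\mathcal{C}$; $[\![\mathrm{Id}_A(t,s)]\!]_{(\mathcal{E},\delta)}(\gamma)=\{\star\mid[\![t]\!](\gamma)=[\![s]\!](\gamma)\}$. The set $[\![\triangleright^\kappa\xi.A]\!]_{(\mathcal{E},\delta)}(\gamma)$ is $\{\star\}$ if $\delta(\gamma(\kappa))=0$ and $[\![A]\!]_{(\mathcal{E},\delta^-)}([\![\xi]\!](\gamma))$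 otherwise, where $\delta^-$ is $\delta$ decreased by $1$ at $\gamma(\kappa)$ and $[\![\xi]\!](\gamma)$ is the restriction of $\gamma$ to $(\mathcal{E},\delta^-)$ extended by the elements given by $t_1,\dots,t_m$. The set $[\![\mathcal{U}_\Delta]\!]_{(\mathcal{E},\delta)}(\gamma)$ consists of the families of small sets over $y(\gamma[\Delta],\delta|_{\gamma[\Delta]})$ with functorial restriction maps that are bijections along the inclusions $(\mathcal{E}',\delta')\to((\mathcal{E}',\lambda),\delta'[\lambda\mapsto n])$ with $\lambda\notin\mathcal{E}'$; and $[\![\mathrm{El}_\Delta(t)]\!]_{(\mathcal{E},\delta)}(\gamma)=([\![t]\!]_{(\mathcal{E},\delta)}(\gamma))_i$ for the inclusion $i:(\gamma[\Delta],\delta|_{\gamma[\Delta]})\to(\mathcal{E},\delta)$. The term $\mathsf{next}^\kappa\xi.t$ is interpreted by $[\![t]\!]([\![\xi]\!](\gamma))$ (and by $\star$ if $\delta(\gamma(\kappa))=0$), $\mathsf{prev}\,\kappa.t$ by the clock abstraction of the unique $a$ with $\mathsf{next}^\kappa a=[\![t]\!]$, and $\mathsf{fix}^\kappa x.t$ by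 the unique $a$ with $a=[\![t]\!](\mathsf{next}^\kappa a)$. **Claim.** For every derivable judgement $\Gamma\vdash A$ of this theory, the interpretations $[\![\Gamma]\!]$, $[\![\Gamma\vdash A]\!]$ and $[\![\Gamma,x:A]\!]$ are defined, and the context projection $[\![\Gamma,x:A]\!]\to[\![\Gamma]\!]$ is invariant under clock introduction, i.e. orthogonal to $y(\{\lambda\},n)$ for every clock $\lambda$ and every $n\in\mathbb{N}$. -/

import Mathlib

open CategoryTheory MonoidalCategory CartesianMonoidalCategory

universe u

namespace GDTT

/-! ## Syntax

Raw types, terms and delayed substitutions, with de Bruijn indices.  A context is a list of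
declarations `x : A` and `κ : clock` (last declaration first), and an index counts declarations of
both kinds.  Terms carry the type annotations that are needed in order to interpret them. -/

mutual

/-- Raw types. -/
inductive Ty : Type
  /-- `Π (x : A). B` -/
  | pi (A B : Ty)
  /-- `Σ (x : A). B` -/
  | sig (A B : Ty)
  /-- `▷^κ ξ. A`; the plain `▷^κ A` is the case of the empty delayed substitution. -/
  | later (κ : ℕ) (ξ : DSub) (A : Ty)
  /-- `∀ κ. A` -/
  | all (A : Ty)
  /-- `Id_A(t, s)` -/
  | ident (A : Ty) (t s : Tm)
  /-- `U_Δ` for a finite set `Δ` of clock variables -/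
  | univ (Δ : Finset ℕ)
  /-- `El_Δ(t)` -/
  | el (Δ : Finset ℕ) (t : Tm)

/-- Raw terms. -/
inductive Tm : Type
  | var (n : ℕ)
  /-- `λ (x : A). t` -/
  | lam (A : Ty) (t : Tm)
  /-- `t u`, where `t : Π (x : A). B` -/
  | app (A B : Ty) (t u : Tm)
  /-- `⟨t, u⟩ : Σ (x : A). B` -/
  | pair (A B : Ty) (t u : Tm)
  | fst (A B : Ty) (t : Tm)
  | snd (A B : Ty) (t : Tm)
  /-- `next^κ ξ. t` -/
  | next (κ : ℕ) (ξ : DSub) (t : Tm)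
  /-- `prev κ. t`, where `t : ▷^κ A` -/
  | prev (A : Ty) (t : Tm)
  /-- `fix^κ (x : ▷^κ A). t` -/
  | fix (κ : ℕ) (A : Ty) (t : Tm)
  /-- `Λ κ. t` -/
  | clam (t : Tm)
  /-- `t[κ]`, where `t : ∀ κ. A` -/
  | capp (A : Ty) (t : Tm) (κ : ℕ)
  | refl (A : Ty) (t : Tm)
  /-- the inclusion `in_{Δ,Δ'}(t)` of universes -/
  | incl (Δ Δ' : Finset ℕ) (t : Tm)

/-- Raw delayed substitutions `⟨x₁ ← t₁, …, xₙ ← tₙ⟩` with the types `A₁, …, Aₙ` of the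
variables.  They bind `x₁, …, xₙ`; the term `tᵢ` does not depend on them, the type `Aᵢ` depends on
the previous ones. -/
inductive DSub : Type
  | nil
  | snoc (ξ : DSub) (A : Ty) (t : Tm)

end

/-- The number of variables bound by a delayed substitution. -/
def DSub.len : DSub → ℕ
  | .nil => 0
  | .snoc ξ _ _ => ξ.len + 1

/-- Concatenation of delayed substitutions. -/
def DSub.append (ξ : DSub) : DSub → DSub
  | .nil => ξ
  | .snoc ζ A t => .snoc (ξ.append ζ) A t

/-- Extension of a renaming under a binder. -/
def upR (r : ℕ → ℕ) : ℕ → ℕ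
  | 0 => 0
  | n + 1 => r n + 1

/-- Extension of a renaming under `k` binders. -/
def upRN (r : ℕ → ℕ) : ℕ → ℕ → ℕ
  | 0 => r
  | k + 1 => upR (upRN r k)

mutual

/-- Renaming in types. -/
def Ty.ren (r : ℕ → ℕ) : Ty → Ty
  | .pi A B => .pi (A.ren r) (B.ren (upR r))
  | .sig A B => .sig (A.ren r) (B.ren (upR r))
  | .later κ ξ A => .later (r κ) (ξ.ren r) (A.ren (upRN r ξ.len))
  | .all A => .all (A.ren (upR r))
  | .ident A t s => .ident (A.ren r) (t.ren r) (s.ren r)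
  | .univ Δ => .univ (Δ.image r)
  | .el Δ t => .el (Δ.image r) (t.ren r)

/-- Renaming in terms. -/
def Tm.ren (r : ℕ → ℕ) : Tm → Tm
  | .var n => .var (r n)
  | .lam A t => .lam (A.ren r) (t.ren (upR r))
  | .app A B t u => .app (A.ren r) (B.ren (upR r)) (t.ren r) (u.ren r)
  | .pair A B t u => .pair (A.ren r) (B.ren (upR r)) (t.ren r) (u.ren r)
  | .fst A B t => .fst (A.ren r) (B.ren (upR r)) (t.ren r)
  | .snd A B t => .snd (A.ren r) (B.ren (upR r)) (t.ren r)
  | .next κ ξ t => .next (r κ) (ξ.ren r) (t.ren (upRN r ξ.len))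
  | .prev A t => .prev (A.ren (upR r)) (t.ren (upR r))
  | .fix κ A t => .fix (r κ) (A.ren r) (t.ren (upR r))
  | .clam t => .clam (t.ren (upR r))
  | .capp A t κ => .capp (A.ren (upR r)) (t.ren r) (r κ)
  | .refl A t => .refl (A.ren r) (t.ren r)
  | .incl Δ Δ' t => .incl (Δ.image r) (Δ'.image r) (t.ren r)

/-- Renaming in delayed substitutions. -/
def DSub.ren (r : ℕ → ℕ) : DSub → DSub
  | .nil => .nil
  | .snoc ξ A t => .snoc (ξ.ren r) (A.ren (upRN r ξ.len)) (t.ren r)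

end

/-- A raw substitution: a term for every term variable and a clock for every clock variable (both
functions are given on all indices). -/
structure Sb where
  tm : ℕ → Tm
  ck : ℕ → ℕ

/-- Extension of a substitution under a binder. -/
def Sb.up (ρ : Sb) : Sb where
  tm n := match n with
    | 0 => .var 0
    | n + 1 => (ρ.tm n).ren (· + 1)
  ck := upR ρ.ck

/-- Extension of a substitution under `k` binders. -/
def Sb.upN (ρ : Sb) : ℕ → Sb
  | 0 => ρ
  | k + 1 => (ρ.upN k).up

/-- The substitution `[t/x]` for the last variable of the context. -/
def Sb.single (t : Tm) : Sb where
  tm n := match n with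
    | 0 => t
    | n + 1 => .var n
  ck n := n - 1

/-- The substitution `[κ'/κ]` for the last variable of the context. -/
def Sb.singleClk (κ' : ℕ) : Sb where
  tm n := match n with
    | 0 => .var κ'
    | n + 1 => .var n
  ck n := match n with
    | 0 => κ'
    | n + 1 => n

mutual

/-- Substitution in types. -/
def Ty.sub (ρ : Sb) : Ty → Ty
  | .pi A B => .pi (A.sub ρ) (B.sub ρ.up)
  | .sig A B => .sig (A.sub ρ) (B.sub ρ.up)
  | .later κ ξ A => .later (ρ.ck κ) (ξ.sub ρ) (A.sub (ρ.upN ξ.len))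
  | .all A => .all (A.sub ρ.up)
  | .ident A t s => .ident (A.sub ρ) (t.sub ρ) (s.sub ρ)
  | .univ Δ => .univ (Δ.image ρ.ck)
  | .el Δ t => .el (Δ.image ρ.ck) (t.sub ρ)

/-- Substitution in terms. -/
def Tm.sub (ρ : Sb) : Tm → Tm
  | .var n => ρ.tm n
  | .lam A t => .lam (A.sub ρ) (t.sub ρ.up)
  | .app A B t u => .app (A.sub ρ) (B.sub ρ.up) (t.sub ρ) (u.sub ρ)
  | .pair A B t u => .pair (A.sub ρ) (B.sub ρ.up) (t.sub ρ) (u.sub ρ)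
  | .fst A B t => .fst (A.sub ρ) (B.sub ρ.up) (t.sub ρ)
  | .snd A B t => .snd (A.sub ρ) (B.sub ρ.up) (t.sub ρ)
  | .next κ ξ t => .next (ρ.ck κ) (ξ.sub ρ) (t.sub (ρ.upN ξ.len))
  | .prev A t => .prev (A.sub ρ.up) (t.sub ρ.up)
  | .fix κ A t => .fix (ρ.ck κ) (A.sub ρ) (t.sub ρ.up)
  | .clam t => .clam (t.sub ρ.up)
  | .capp A t κ => .capp (A.sub ρ.up) (t.sub ρ) (ρ.ck κ)
  | .refl A t => .refl (A.sub ρ) (t.sub ρ)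
  | .incl Δ Δ' t => .incl (Δ.image ρ.ck) (Δ'.image ρ.ck) (t.sub ρ)

/-- Substitution in delayed substitutions. -/
def DSub.sub (ρ : Sb) : DSub → DSub
  | .nil => .nil
  | .snoc ξ A t => .snoc (ξ.sub ρ) (A.sub (ρ.upN ξ.len)) (t.sub ρ)

end

/-- Weakening by one declaration. -/
def Ty.wk (A : Ty) : Ty := A.ren (· + 1)

/-- Weakening by one declaration. -/
def Tm.wk (t : Tm) : Tm := t.ren (· + 1)

/-- `A[t/x]` -/
def Ty.inst (A : Ty) (t : Tm) : Ty := A.sub (.single t)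

/-- `s[t/x]` -/
def Tm.inst (s : Tm) (t : Tm) : Tm := s.sub (.single t)

/-- `A[κ'/κ]` -/
def Ty.instClk (A : Ty) (κ' : ℕ) : Ty := A.sub (.singleClk κ')

/-- `s[κ'/κ]` -/
def Tm.instClk (s : Tm) (κ' : ℕ) : Tm := s.sub (.singleClk κ')

/-- The renaming that exchanges the last two variables. -/
def swapLast : ℕ → ℕ
  | 0 => 1
  | 1 => 0
  | n + 2 => n + 2

/-- The renaming from `Γ, Γ', Γ''` to `Γ, Γ'', Γ'`, where `Γ'` and `Γ''` have lengths `k` and `l`. -/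
def swapBlocks (k l n : ℕ) : ℕ :=
  if n < l then n + k else if n < l + k then n - l else n

/-- A renaming of the context in which a delayed substitution `ζ` is a tail: it acts on the types
of the variables of `ζ`, but not on its terms, which live in a smaller context. -/
def DSub.renTel (r : ℕ → ℕ) : DSub → DSub
  | .nil => .nil
  | .snoc ζ A t => .snoc (ζ.renTel r) (A.ren (upRN r ζ.len)) t

/-- Declarations `κ : clock` and `x : A`. -/
inductive Decl : Type
  | clk
  | ty (A : Ty)

/-- Raw contexts; the head of the list is the last declaration. -/
abbrev Ctx := List Decl

/-- The context `Γ, Γ'`, where `Γ'` is the telescope of the variables of `ξ`. -/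
def DSub.ext (ξ : DSub) (Γ : Ctx) : Ctx :=
  match ξ with
  | .nil => Γ
  | .snoc ξ A _ => .ty A :: ξ.ext Γ

/-! ## Judgements -/

/-- `Γ ⊢ κ : clock` -/
def IsClk (Γ : Ctx) (κ : ℕ) : Prop := Γ[κ]? = some .clk

mutual

/-- `Γ ⊢`, well-formed contexts. -/
inductive CtxOk : Ctx → Prop
  | nil : CtxOk []
  | ty {Γ A} : TyOk Γ A → CtxOk (.ty A :: Γ)
  | clk {Γ} : CtxOk Γ → CtxOk (.clk :: Γ)

/-- `Γ ⊢ A`, well-formed types. -/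
inductive TyOk : Ctx → Ty → Prop
  | pi {Γ A B} : TyOk (.ty A :: Γ) B → TyOk Γ (.pi A B)
  | sig {Γ A B} : TyOk (.ty A :: Γ) B → TyOk Γ (.sig A B)
  | later {Γ κ ξ A} : DSubOk Γ κ ξ → TyOk (ξ.ext Γ) A → TyOk Γ (.later κ ξ A)
  | all {Γ A} : TyOk (.clk :: Γ) A → TyOk Γ (.all A)
  | ident {Γ A t s} : TmOk Γ t A → TmOk Γ s A → TyOk Γ (.ident A t s)
  | univ {Γ Δ} : CtxOk Γ → (∀ κ ∈ Δ, IsClk Γ κ) → TyOk Γ (.univ Δ)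
  | el {Γ Δ t} : TmOk Γ t (.univ Δ) → TyOk Γ (.el Δ t)

/-- `⊢_κ ξ : Γ ⇀ Γ'`, well-formed delayed substitutions (`Γ'` can be read off from `ξ`). -/
inductive DSubOk : Ctx → ℕ → DSub → Prop
  | nil {Γ κ} : CtxOk Γ → IsClk Γ κ → DSubOk Γ κ .nil
  | snoc {Γ κ ξ A t} : DSubOk Γ κ ξ → TmOk Γ t (.later κ ξ A) → DSubOk Γ κ (.snoc ξ A t)

/-- `Γ ⊢ t : A`, well-typed terms. -/
inductive TmOk : Ctx → Tm → Ty → Prop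
  | var {Γ n A} : CtxOk Γ → Γ[n]? = some (.ty A) → TmOk Γ (.var n) (A.ren (· + (n + 1)))
  | lam {Γ A B t} : TmOk (.ty A :: Γ) t B → TmOk Γ (.lam A t) (.pi A B)
  | app {Γ A B t u} : TmOk Γ t (.pi A B) → TmOk Γ u A → TmOk Γ (.app A B t u) (B.inst u)
  | pair {Γ A B t u} : TyOk (.ty A :: Γ) B → TmOk Γ t A → TmOk Γ u (B.inst t) →
      TmOk Γ (.pair A B t u) (.sig A B)
  | fst {Γ A B t} : TmOk Γ t (.sig A B) → TmOk Γ (.fst A B t) A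
  | snd {Γ A B t} : TmOk Γ t (.sig A B) → TmOk Γ (.snd A B t) (B.inst (.fst A B t))
  | next {Γ κ ξ t A} : DSubOk Γ κ ξ → TmOk (ξ.ext Γ) t A →
      TmOk Γ (.next κ ξ t) (.later κ ξ A)
  | prev {Γ A t} : TmOk (.clk :: Γ) t (.later 0 .nil A) → TmOk Γ (.prev A t) (.all A)
  | fix {Γ κ A t} : TmOk (.ty (.later κ .nil A) :: Γ) t A.wk → TmOk Γ (.fix κ A t) A
  | clam {Γ A t} : TmOk (.clk :: Γ) t A → TmOk Γ (.clam t) (.all A)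
  | capp {Γ A t κ} : TmOk Γ t (.all A) → IsClk Γ κ → TmOk Γ (.capp A t κ) (A.instClk κ)
  | refl {Γ A t} : TmOk Γ t A → TmOk Γ (.refl A t) (.ident A t t)
  | incl {Γ Δ Δ' t} : TmOk Γ t (.univ Δ) → TyOk Γ (.univ Δ') → Δ ⊆ Δ' →
      TmOk Γ (.incl Δ Δ' t) (.univ Δ')
  | conv {Γ t A B} : TmOk Γ t A → TyEq Γ A B → TmOk Γ t B

/-- `Γ ⊢ A ≡ B`, judgemental equality of types. -/
inductive TyEq : Ctx → Ty → Ty → Prop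
  | refl {Γ A} : TyOk Γ A → TyEq Γ A A
  | symm {Γ A B} : TyEq Γ A B → TyEq Γ B A
  | trans {Γ A B C} : TyEq Γ A B → TyEq Γ B C → TyEq Γ A C
  -- congruence rules
  | pi {Γ A A' B B'} : TyEq Γ A A' → TyEq (.ty A :: Γ) B B' → TyEq Γ (.pi A B) (.pi A' B')
  | sig {Γ A A' B B'} : TyEq Γ A A' → TyEq (.ty A :: Γ) B B' → TyEq Γ (.sig A B) (.sig A' B')
  | later {Γ κ ξ ξ' A A'} : DSubEq Γ κ ξ ξ' → TyEq (ξ.ext Γ) A A' →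
      TyEq Γ (.later κ ξ A) (.later κ ξ' A')
  | all {Γ A A'} : TyEq (.clk :: Γ) A A' → TyEq Γ (.all A) (.all A')
  | ident {Γ A A' t t' s s'} : TyEq Γ A A' → TmEq Γ t t' A → TmEq Γ s s' A →
      TyEq Γ (.ident A t s) (.ident A' t' s')
  | el {Γ Δ t t'} : TmEq Γ t t' (.univ Δ) → TyEq Γ (.el Δ t) (.el Δ t')
  -- universes
  | el_incl {Γ Δ Δ' t} : TmOk Γ t (.univ Δ) → TyOk Γ (.univ Δ') → Δ ⊆ Δ' →
      TyEq Γ (.el Δ' (.incl Δ Δ' t)) (.el Δ t)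
  -- delayed substitutions
  | later_wk {Γ κ ξ B t A} : DSubOk Γ κ (.snoc ξ B t) → TyOk (ξ.ext Γ) A →
      TyEq Γ (.later κ (.snoc ξ B t) A.wk) (.later κ ξ A)
  | later_swap {Γ κ ξ B t C u ζ A} :
      DSubOk Γ κ ((DSub.snoc (.snoc ξ B t) C.wk u).append ζ) → TyOk (ξ.ext Γ) C →
      TyOk (((DSub.snoc (.snoc ξ B t) C.wk u).append ζ).ext Γ) A →
      TyEq Γ (.later κ ((DSub.snoc (.snoc ξ B t) C.wk u).append ζ) A)
        (.later κ ((DSub.snoc (.snoc ξ C u) B.wk t).append (ζ.renTel swapLast))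
          (A.ren (upRN swapLast ζ.len)))
  | later_next {Γ κ ξ B t A} : DSubOk Γ κ ξ → TyOk (.ty B :: ξ.ext Γ) A → TmOk (ξ.ext Γ) t B →
      TyEq Γ (.later κ (.snoc ξ B (.next κ ξ t)) A) (.later κ ξ (A.inst t))
  | ident_later {Γ κ ξ A t s} : DSubOk Γ κ ξ → TmOk (ξ.ext Γ) t A → TmOk (ξ.ext Γ) s A →
      TyEq Γ (.ident (.later κ ξ A) (.next κ ξ t) (.next κ ξ s)) (.later κ ξ (.ident A t s))

/-- Judgemental equality of delayed substitutions (congruence only). -/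
inductive DSubEq : Ctx → ℕ → DSub → DSub → Prop
  | nil {Γ κ} : CtxOk Γ → IsClk Γ κ → DSubEq Γ κ .nil .nil
  | snoc {Γ κ ξ ξ' A A' t t'} : DSubEq Γ κ ξ ξ' → TyEq (ξ.ext Γ) A A' →
      TmEq Γ t t' (.later κ ξ A) → DSubEq Γ κ (.snoc ξ A t) (.snoc ξ' A' t')

/-- `Γ ⊢ t ≡ s : A`, judgemental equality of terms. -/
inductive TmEq : Ctx → Tm → Tm → Ty → Prop
  | refl {Γ t A} : TmOk Γ t A → TmEq Γ t t A
  | symm {Γ t s A} : TmEq Γ t s A → TmEq Γ s t A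
  | trans {Γ t s r A} : TmEq Γ t s A → TmEq Γ s r A → TmEq Γ t r A
  | conv {Γ t s A B} : TmEq Γ t s A → TyEq Γ A B → TmEq Γ t s B
  -- congruence rules
  | lam {Γ A A' B t t'} : TyEq Γ A A' → TmEq (.ty A :: Γ) t t' B →
      TmEq Γ (.lam A t) (.lam A' t') (.pi A B)
  | app {Γ A A' B B' t t' u u'} : TyEq Γ A A' → TyEq (.ty A :: Γ) B B' →
      TmEq Γ t t' (.pi A B) → TmEq Γ u u' A →
      TmEq Γ (.app A B t u) (.app A' B' t' u') (B.inst u)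
  | pair {Γ A A' B B' t t' u u'} : TyEq Γ A A' → TyEq (.ty A :: Γ) B B' →
      TmEq Γ t t' A → TmEq Γ u u' (B.inst t) →
      TmEq Γ (.pair A B t u) (.pair A' B' t' u') (.sig A B)
  | fst {Γ A A' B B' t t'} : TyEq Γ A A' → TyEq (.ty A :: Γ) B B' → TmEq Γ t t' (.sig A B) →
      TmEq Γ (.fst A B t) (.fst A' B' t') A
  | snd {Γ A A' B B' t t'} : TyEq Γ A A' → TyEq (.ty A :: Γ) B B' → TmEq Γ t t' (.sig A B) →
      TmEq Γ (.snd A B t) (.snd A' B' t') (B.inst (.fst A B t))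
  | next {Γ κ ξ ξ' t t' A} : DSubEq Γ κ ξ ξ' → TmEq (ξ.ext Γ) t t' A →
      TmEq Γ (.next κ ξ t) (.next κ ξ' t') (.later κ ξ A)
  | prev {Γ A A' t t'} : TyEq (.clk :: Γ) A A' → TmEq (.clk :: Γ) t t' (.later 0 .nil A) →
      TmEq Γ (.prev A t) (.prev A' t') (.all A)
  | fix {Γ κ A A' t t'} : TyEq Γ A A' → TmEq (.ty (.later κ .nil A) :: Γ) t t' A.wk →
      TmEq Γ (.fix κ A t) (.fix κ A' t') A
  | clam {Γ A t t'} : TmEq (.clk :: Γ) t t' A → TmEq Γ (.clam t) (.clam t') (.all A)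
  | capp {Γ A A' t t' κ} : TyEq (.clk :: Γ) A A' → TmEq Γ t t' (.all A) → IsClk Γ κ →
      TmEq Γ (.capp A t κ) (.capp A' t' κ) (A.instClk κ)
  | refl_congr {Γ A A' t t'} : TyEq Γ A A' → TmEq Γ t t' A →
      TmEq Γ (.refl A t) (.refl A' t') (.ident A t t)
  | incl {Γ Δ Δ' t t'} : TmEq Γ t t' (.univ Δ) → TyOk Γ (.univ Δ') → Δ ⊆ Δ' →
      TmEq Γ (.incl Δ Δ' t) (.incl Δ Δ' t') (.univ Δ')
  -- `β` and `η` for dependent products, dependent sums and clock quantification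
  | pi_beta {Γ A B t u} : TmOk (.ty A :: Γ) t B → TmOk Γ u A →
      TmEq Γ (.app A B (.lam A t) u) (t.inst u) (B.inst u)
  | pi_eta {Γ A B t} : TmOk Γ t (.pi A B) →
      TmEq Γ (.lam A (.app A.wk (B.ren (upR (· + 1))) t.wk (.var 0))) t (.pi A B)
  | fst_pair {Γ A B t u} : TyOk (.ty A :: Γ) B → TmOk Γ t A → TmOk Γ u (B.inst t) →
      TmEq Γ (.fst A B (.pair A B t u)) t A
  | snd_pair {Γ A B t u} : TyOk (.ty A :: Γ) B → TmOk Γ t A → TmOk Γ u (B.inst t) →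
      TmEq Γ (.snd A B (.pair A B t u)) u (B.inst t)
  | sig_eta {Γ A B t} : TmOk Γ t (.sig A B) →
      TmEq Γ (.pair A B (.fst A B t) (.snd A B t)) t (.sig A B)
  | all_beta {Γ A t κ} : TmOk (.clk :: Γ) t A → IsClk Γ κ →
      TmEq Γ (.capp A (.clam t) κ) (t.instClk κ) (A.instClk κ)
  | all_eta {Γ A t} : TmOk Γ t (.all A) →
      TmEq Γ (.clam (.capp (A.ren (upR (· + 1))) t.wk 0)) t (.all A)
  -- `prev`, `next` and `fix`
  | prev_next {Γ A t} : TmOk (.clk :: Γ) t A →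
      TmEq Γ (.prev A (.next 0 .nil t)) (.clam t) (.all A)
  | next_prev {Γ A t} : TmOk (.clk :: Γ) t (.later 0 .nil A) →
      TmEq (.clk :: Γ) (.next 0 .nil (.capp (A.ren (upR (· + 1))) (Tm.prev A t).wk 0)) t
        (.later 0 .nil A)
  | fix_unfold {Γ κ A t} : TmOk (.ty (.later κ .nil A) :: Γ) t A.wk →
      TmEq Γ (.fix κ A t) (t.inst (.next κ .nil (.fix κ A t))) A
  -- the clock irrelevance axiom
  | clock_irrel {Γ A t κ κ'} : TyOk Γ A → TmOk Γ t (.all A.wk) → IsClk Γ κ → IsClk Γ κ' →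
      TmEq Γ (.capp A.wk t κ) (.capp A.wk t κ') A
  -- extensional identity types
  | reflection {Γ A t s p} : TmOk Γ t A → TmOk Γ s A → TmOk Γ p (.ident A t s) → TmEq Γ t s A
  | ident_eta {Γ A t p} : TmOk Γ p (.ident A t t) → TmEq Γ p (.refl A t) (.ident A t t)
  -- delayed substitutions
  | next_wk {Γ κ ξ B t A u} : DSubOk Γ κ (.snoc ξ B t) → TmOk (ξ.ext Γ) u A →
      TmEq Γ (.next κ (.snoc ξ B t) u.wk) (.next κ ξ u) (.later κ ξ A)
  | next_swap {Γ κ ξ B t C u ζ A v} :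
      DSubOk Γ κ ((DSub.snoc (.snoc ξ B t) C.wk u).append ζ) → TyOk (ξ.ext Γ) C →
      TmOk (((DSub.snoc (.snoc ξ B t) C.wk u).append ζ).ext Γ) v A →
      TmEq Γ (.next κ ((DSub.snoc (.snoc ξ B t) C.wk u).append ζ) v)
        (.next κ ((DSub.snoc (.snoc ξ C u) B.wk t).append (ζ.renTel swapLast))
          (v.ren (upRN swapLast ζ.len)))
        (.later κ ((DSub.snoc (.snoc ξ B t) C.wk u).append ζ) A)
  | next_next {Γ κ ξ B t A u} : DSubOk Γ κ ξ → TmOk (.ty B :: ξ.ext Γ) u A →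
      TmOk (ξ.ext Γ) t B →
      TmEq Γ (.next κ (.snoc ξ B (.next κ ξ t)) u) (.next κ ξ (u.inst t))
        (.later κ ξ (A.inst t))
  | next_var {Γ κ ξ A t} : DSubOk Γ κ ξ → TmOk Γ t (.later κ ξ A) →
      TmEq Γ (.next κ (.snoc ξ A t) (.var 0)) t (.later κ ξ A)
  | next_comm {Γ κ ξ ξ' A u} : TyOk Γ A → DSubOk Γ κ ξ → DSubOk Γ κ ξ' →
      TmOk ((ξ'.ren (· + ξ.len)).ext (ξ.ext Γ)) u (A.ren (· + (ξ.len + ξ'.len))) →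
      TmEq Γ (.next κ ξ (.next (κ + ξ.len) (ξ'.ren (· + ξ.len)) u))
        (.next κ ξ' (.next (κ + ξ'.len) (ξ.ren (· + ξ'.len))
          (u.ren (swapBlocks ξ.len ξ'.len))))
        (.later κ .nil (.later κ .nil A))

end

/-! ## The presheaf category -/

/-- Time objects `(E, δ)`: a finite set `E` of clocks, taken from a fixed countably infinite set,
and the number `δ(c)` of ticks left on each clock. -/
structure TimeObj where
  clocks : Finset ℕ
  ticks : clocks → ℕ

/-- Morphisms `(E, δ) → (E', δ')` are functions `τ : E → E'` with `δ' ∘ τ ≤ δ`. -/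
instance : Category TimeObj where
  Hom X Y := {τ : X.clocks → Y.clocks // ∀ c, Y.ticks (τ c) ≤ X.ticks c}
  id X := ⟨id, fun _ => le_rfl⟩
  comp f g := ⟨g.1 ∘ f.1, fun c => (g.2 (f.1 c)).trans (f.2 c)⟩

namespace TimeObj

/-- The object `({k}, n)`. -/
def single (k n : ℕ) : TimeObj := ⟨{k}, fun _ => n⟩

/-- The object `((E, k), δ[k ↦ n])`, for `k ∉ E`. -/
def insert (X : TimeObj) (k n : ℕ) : TimeObj :=
  ⟨Insert.insert k X.clocks, fun c => if h : c.1 ∈ X.clocks then X.ticks ⟨c.1, h⟩ else n⟩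

/-- The inclusion `ι : (E, δ) → ((E, k), δ[k ↦ n])`. -/
def ι (X : TimeObj) (k n : ℕ) : X ⟶ X.insert k n :=
  ⟨fun c => ⟨c.1, Finset.mem_insert_of_mem c.2⟩, fun c => by simp [insert]⟩

/-- The object `(E, δ⁻)` where one tick of the clock `c` has passed (used only if `δ(c) > 0`). -/
def tick (X : TimeObj) (c : X.clocks) : TimeObj :=
  ⟨X.clocks, fun d => if d = c then X.ticks c - 1 else X.ticks d⟩

/-- The morphism `(E, δ) → (E, δ⁻)` tracked by the identity. -/
def tickHom (X : TimeObj) (c : X.clocks) : X ⟶ X.tick c :=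
  ⟨id, fun d => by
    simp only [tick, id]
    split_ifs with h
    · subst h; omega
    · exact le_rfl⟩

/-- A morphism `σ : (E, δ) → (E', δ')`, seen as a morphism `(E, δ⁻) → (E', δ'⁻)`. -/
def tickMap {X Y : TimeObj} (σ : X ⟶ Y) {c : X.clocks} {c' : Y.clocks} (h : σ.1 c = c') :
    X.tick c ⟶ Y.tick c' :=
  ⟨σ.1, by
    intro (d : X.clocks)
    subst h
    have h0 := σ.2 d
    have h1 := σ.2 c
    simp only [tick]
    split_ifs with h2 h3 h3
    · omega
    · rw [h2] at h0; omega
    · subst h3; exact absurd rfl h2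
    · exact h0⟩

/-- The object `(S, δ|_S)` for a subset `S` of `E`. -/
def restrict (X : TimeObj) (S : Finset X.clocks) : TimeObj :=
  ⟨S.map (Function.Embedding.subtype _), fun c => X.ticks ⟨c.1, by
    obtain ⟨d, _, h⟩ := Finset.mem_map.1 c.2
    exact h ▸ d.2⟩⟩

/-- The inclusion `(S, δ|_S) → (E, δ)`. -/
def restrictι (X : TimeObj) (S : Finset X.clocks) : X.restrict S ⟶ X :=
  ⟨fun c => ⟨c.1, by
    obtain ⟨d, _, h⟩ := Finset.mem_map.1 c.2
    exact h ▸ d.2⟩, fun _ => le_rfl⟩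

/-- The restriction and corestriction `(S, δ|_S) → (S', δ'|_S')` of `σ : (E, δ) → (E', δ')`, if `σ`
maps `S` into `S'`. -/
def cores {X Y : TimeObj} (σ : X ⟶ Y) {S : Finset X.clocks} {S' : Finset Y.clocks}
    (h : ∀ c ∈ S, σ.1 c ∈ S') : X.restrict S ⟶ Y.restrict S' :=
  ⟨fun c => ⟨(σ.1 ((X.restrictι S).1 c)).1, by
    obtain ⟨d, hd, e⟩ := Finset.mem_map.1 c.2
    have e' : (X.restrictι S).1 c = d := Subtype.ext e.symm
    exact Finset.mem_map.2 ⟨_, h _ (e' ▸ hd), rfl⟩⟩, fun c => σ.2 ((X.restrictι S).1 c)⟩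

theorem cores_comp_restrictι {X Y : TimeObj} (σ : X ⟶ Y) {S : Finset X.clocks}
    {S' : Finset Y.clocks} (h : ∀ c ∈ S, σ.1 c ∈ S') :
    cores σ h ≫ Y.restrictι S' = X.restrictι S ≫ σ := rfl

end TimeObj

/-- Covariant presheaves on the category of time objects. -/
abbrev Psh := TimeObj ⥤ Type (u + 1)

/-- The representable presheaf `y(X) = Hom(X, -)`. -/
def yo (X : TimeObj) : Psh.{u} :=
  coyoneda.obj (Opposite.op X) ⋙ uliftFunctor.{u + 1, 0}

/-- A morphism `p : A ⟶ B` of a cartesian category is orthogonal to an object `X` if every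
commutative square from a projection `Y × X ⟶ Y` to `p` has a unique filler. -/
def OrthogonalTo {C : Type*} [Category C] [CartesianMonoidalCategory C] {A B : C} (p : A ⟶ B)
    (X : C) : Prop :=
  ∀ (Y : C) (f : Y ⊗ X ⟶ A) (g : Y ⟶ B), f ≫ p = fst Y X ≫ g →
    ∃! h : Y ⟶ A, fst Y X ≫ h = f ∧ h ≫ p = g

/-- A morphism of presheaves is invariant under clock introduction if it is orthogonal to all
representable presheaves `y({k}, n)`. -/
def InvariantUnderClockIntro {A B : Psh.{u}} (p : A ⟶ B) : Prop :=
  ∀ k n : ℕ, OrthogonalTo p (yo.{u} (TimeObj.single k n))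

/-! ## Semantic types and terms -/

theorem fun_ext_elt {A B : Type (u + 1)} {f g : A ⟶ B} (h : ∀ x, f x = g x) : f = g :=
  ConcreteCategory.hom_ext _ _ h

/-- The set `{⋆ | p}`. -/
abbrev Truth (p : Prop) : Type (u + 1) := ULift.{u + 1} (PLift p)

/-- A family over the category of elements of `G`: sets `A_X(γ)` and restriction maps
`A_X(γ) → A_Y(σ · γ)`, functorial in `σ`. -/
structure SemTy (G : Psh.{u}) where
  obj : ∀ X : TimeObj, G.obj X → Type (u + 1)
  map : ∀ {X Y : TimeObj} (σ : X ⟶ Y) {γ : G.obj X} {γ' : G.obj Y}, G.map σ γ = γ' →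
    obj X γ → obj Y γ'
  map_id : ∀ {X : TimeObj} {γ : G.obj X} (h : G.map (𝟙 X) γ = γ) (a : obj X γ), map (𝟙 X) h a = a
  map_comp : ∀ {X Y Z : TimeObj} (σ : X ⟶ Y) (τ : Y ⟶ Z) {γ : G.obj X} {γ' : G.obj Y}
    {γ'' : G.obj Z} (h : G.map σ γ = γ') (h' : G.map τ γ' = γ'') (h'' : G.map (σ ≫ τ) γ = γ'')
    (a : obj X γ), map (σ ≫ τ) h'' a = map τ h' (map σ h a)

/-- Natural families of elements of a semantic type. -/
@[ext]
structure SemTm {G : Psh.{u}} (A : SemTy G) where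
  val : ∀ (X : TimeObj) (γ : G.obj X), A.obj X γ
  nat : ∀ {X Y : TimeObj} (σ : X ⟶ Y) {γ : G.obj X} {γ' : G.obj Y} (h : G.map σ γ = γ'),
    A.map σ h (val X γ) = val Y γ'

/-- Morphisms from `G` to the object of clocks `C(E, δ) = E`. -/
@[ext]
structure ClkSec (G : Psh.{u}) where
  val : ∀ X : TimeObj, G.obj X → X.clocks
  nat : ∀ {X Y : TimeObj} (σ : X ⟶ Y) {γ : G.obj X} {γ' : G.obj Y}, G.map σ γ = γ' →
    σ.1 (val X γ) = val Y γ'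

/-- Natural families of finite sets of clocks. -/
@[ext]
structure ClkSet (G : Psh.{u}) where
  val : ∀ X : TimeObj, G.obj X → Finset X.clocks
  nat : ∀ {X Y : TimeObj} (σ : X ⟶ Y) {γ : G.obj X} {γ' : G.obj Y}, G.map σ γ = γ' →
    (val X γ).image σ.1 = val Y γ'

theorem map_id_elt (G : Psh.{u}) {X : TimeObj} (γ : G.obj X) : G.map (𝟙 X) γ = γ := by simp

theorem map_comp_elt (G : Psh.{u}) {X Y Z : TimeObj} (σ : X ⟶ Y) (τ : Y ⟶ Z) (γ : G.obj X) :
    G.map (σ ≫ τ) γ = G.map τ (G.map σ γ) := by simp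

theorem map_comp_elt' (G : Psh.{u}) {X Y Z : TimeObj} (σ : X ⟶ Y) (τ : Y ⟶ Z) {γ : G.obj X}
    {γ' : G.obj Y} (h : G.map σ γ = γ') : G.map (σ ≫ τ) γ = G.map τ γ' := by
  rw [map_comp_elt, h]

theorem app_map_elt {G H : Psh.{u}} (f : G ⟶ H) {X Y : TimeObj} (σ : X ⟶ Y) {γ : G.obj X}
    {γ' : G.obj Y} (h : G.map σ γ = γ') : H.map σ (f.app X γ) = f.app Y γ' := by
  rw [← h]; exact (NatTrans.naturality_apply f σ γ).symm

namespace SemTy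

variable {G H : Psh.{u}}

/-- Reindexing. -/
def subst (A : SemTy G) (f : H ⟶ G) : SemTy H where
  obj X γ := A.obj X (f.app X γ)
  map σ _ _ h := A.map σ (app_map_elt f σ h)
  map_id _ a := A.map_id _ a
  map_comp σ τ _ _ _ _ _ _ a := A.map_comp σ τ _ _ _ a

end SemTy

/-- Reindexing of terms. -/
def SemTm.subst {G H : Psh.{u}} {A : SemTy G} (a : SemTm A) (f : H ⟶ G) : SemTm (A.subst f) where
  val X γ := a.val X (f.app X γ)
  nat σ _ _ h := a.nat σ (app_map_elt f σ h)

/-- Reindexing of clocks. -/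
def ClkSec.subst {G H : Psh.{u}} (c : ClkSec G) (f : H ⟶ G) : ClkSec H where
  val X γ := c.val X (f.app X γ)
  nat σ _ _ h := c.nat σ (app_map_elt f σ h)

/-! ### Context extension -/

/-- The empty context. -/
def emptyCtx : Psh.{u} := (Functor.const TimeObj).obj PUnit

/-- Context comprehension `⟦Γ, x : A⟧`. -/
def comp (G : Psh.{u}) (A : SemTy G) : Psh.{u} where
  obj X := Σ γ : G.obj X, A.obj X γ
  map σ := TypeCat.ofHom fun p => ⟨G.map σ p.1, A.map σ rfl p.2⟩
  map_id X := fun_ext_elt fun ⟨γ, a⟩ => by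
    have key : ∀ (γ' : G.obj X) (h : G.map (𝟙 X) γ = γ'), γ = γ' →
        (⟨γ', A.map (𝟙 X) h a⟩ : Σ γ : G.obj X, A.obj X γ) = ⟨γ, a⟩ := by
      rintro γ' h rfl
      rw [A.map_id]
    exact key _ rfl (map_id_elt G γ).symm
  map_comp {X Y Z} σ τ := fun_ext_elt fun ⟨γ, a⟩ => by
    have key : ∀ (γ' : G.obj Z) (h : G.map (σ ≫ τ) γ = γ'), G.map τ (G.map σ γ) = γ' →
        (⟨γ', A.map (σ ≫ τ) h a⟩ : Σ γ : G.obj Z, A.obj Z γ)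
          = ⟨G.map τ (G.map σ γ), A.map τ rfl (A.map σ rfl a)⟩ := by
      rintro γ' h rfl
      rw [A.map_comp σ τ rfl rfl h]
    exact key _ rfl (map_comp_elt G σ τ γ).symm

/-- The element `(γ, a)` of `⟦Γ, x : A⟧`. -/
def pt {G : Psh.{u}} {A : SemTy G} {X : TimeObj} (γ : G.obj X) (a : A.obj X γ) :
    (comp G A).obj X :=
  (⟨γ, a⟩ : Σ γ : G.obj X, A.obj X γ)

/-- The first component of an element `(γ, a)` of `⟦Γ, x : A⟧`. -/
def base {G : Psh.{u}} {A : SemTy G} {X : TimeObj} (p : (comp G A).obj X) : G.obj X :=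
  Sigma.fst (β := A.obj X) p

/-- The second component of an element `(γ, a)` of `⟦Γ, x : A⟧`. -/
def fib {G : Psh.{u}} {A : SemTy G} {X : TimeObj} (p : (comp G A).obj X) : A.obj X (base p) :=
  Sigma.snd (β := A.obj X) p

/-- The context projection `⟦Γ, x : A⟧ ⟶ ⟦Γ⟧`. -/
def proj {G : Psh.{u}} (A : SemTy G) : comp G A ⟶ G where
  app _ := TypeCat.ofHom fun p => base p
  naturality _ _ _ := rfl

theorem comp_map_elt {G : Psh.{u}} (A : SemTy G) {X Y : TimeObj} (σ : X ⟶ Y) {γ : G.obj X}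
    {γ' : G.obj Y} (h : G.map σ γ = γ') (a : A.obj X γ) {b : A.obj Y γ'} (hb : A.map σ h a = b) :
    (comp G A).map σ (pt γ a) = pt γ' b := by
  subst h hb; rfl

theorem proj_map_elt {G : Psh.{u}} (A : SemTy G) {X Y : TimeObj} (σ : X ⟶ Y)
    {p : (comp G A).obj X} {q : (comp G A).obj Y} (h : (comp G A).map σ p = q) :
    G.map σ (base p) = base q := by
  subst h; rfl

/-- The last variable of `⟦Γ, x : A⟧`. -/
def lastVar {G : Psh.{u}} (A : SemTy G) : SemTm (A.subst (proj A)) where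
  val _ p := fib p
  nat _ _ _ h := by subst h; rfl

/-- The section `⟨id, a⟩ : ⟦Γ⟧ ⟶ ⟦Γ, x : A⟧`. -/
def sect {G : Psh.{u}} {A : SemTy G} (a : SemTm A) : G ⟶ comp G A where
  app X := TypeCat.ofHom fun γ => pt γ (a.val X γ)
  naturality X _ σ := fun_ext_elt fun γ =>
    (comp_map_elt A σ rfl (a.val X γ) (a.nat σ rfl)).symm

/-- Context extension `⟦Γ, κ : clock⟧ = ⟦Γ⟧ × C`, where `C(E, δ) = E` is the object of clocks. -/
def compClk (G : Psh.{u}) : Psh.{u} where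
  obj X := G.obj X × X.clocks
  map σ := TypeCat.ofHom fun p => (G.map σ p.1, σ.1 p.2)
  map_id _ := fun_ext_elt fun ⟨γ, c⟩ => congrArg (fun γ' => (γ', c)) (map_id_elt G γ)
  map_comp σ τ := fun_ext_elt fun ⟨γ, c⟩ =>
    congrArg (fun γ' => (γ', τ.1 (σ.1 c))) (map_comp_elt G σ τ γ)

/-- The element `(γ, c)` of `⟦Γ, κ : clock⟧`. -/
def ptClk {G : Psh.{u}} {X : TimeObj} (γ : G.obj X) (c : X.clocks) : (compClk G).obj X :=
  ((γ, c) : G.obj X × X.clocks)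

/-- The context projection `⟦Γ, κ : clock⟧ ⟶ ⟦Γ⟧`. -/
def projClk (G : Psh.{u}) : compClk G ⟶ G where
  app _ := TypeCat.ofHom fun p => Prod.fst (α := G.obj _) p
  naturality _ _ _ := rfl

theorem compClk_map_elt (G : Psh.{u}) {X Y : TimeObj} (σ : X ⟶ Y) {γ : G.obj X} {γ' : G.obj Y}
    (h : G.map σ γ = γ') {c : X.clocks} {c' : Y.clocks} (hc : σ.1 c = c') :
    (compClk G).map σ (ptClk γ c) = ptClk γ' c' := by
  subst h hc; rfl

/-- The last variable of `⟦Γ, κ : clock⟧`. -/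
def lastClk (G : Psh.{u}) : ClkSec (compClk G) where
  val X p := Prod.snd (α := G.obj X) (β := X.clocks) p
  nat _ _ _ h := by subst h; rfl

/-- The section `⟨id, c⟩ : ⟦Γ⟧ ⟶ ⟦Γ, κ : clock⟧`. -/
def sectClk {G : Psh.{u}} (c : ClkSec G) : G ⟶ compClk G where
  app X := TypeCat.ofHom fun γ => ptClk γ (c.val X γ)
  naturality _ _ σ := fun_ext_elt fun _ =>
    (compClk_map_elt G σ rfl (c.nat σ rfl)).symm

/-! ### Dependent products -/

/-- Elements of `⟦Π (x : A). B⟧_X(γ)`: families `(f_σ)`, indexed by the morphisms `σ : X ⟶ Y`, with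
`f_σ(a) ∈ B_Y(σ · γ, a)` for `a ∈ A_Y(σ · γ)` and `τ · f_σ(a) = f_{τσ}(τ · a)`. -/
def PiElt {G : Psh.{u}} (A : SemTy G) (B : SemTy (comp G A)) (X : TimeObj) (γ : G.obj X) :
    Type (u + 1) :=
  { f : ∀ (Y : TimeObj) (σ : X ⟶ Y) (a : A.obj Y (G.map σ γ)), B.obj Y (pt (G.map σ γ) a) //
    ∀ (Y Z : TimeObj) (σ : X ⟶ Y) (τ : Y ⟶ Z) (a : A.obj Y (G.map σ γ)),
      B.map τ (comp_map_elt A τ (map_comp_elt G σ τ γ).symm a rfl) (f Y σ a)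
        = f Z (σ ≫ τ) (A.map τ (map_comp_elt G σ τ γ).symm a) }

namespace PiElt

variable {G : Psh.{u}} {A : SemTy G} {B : SemTy (comp G A)} {X : TimeObj} {γ : G.obj X}

/-- `f_σ`, on arguments over any `γ'` that is equal to `σ · γ`. -/
def fn' (f : PiElt A B X γ) {Y : TimeObj} (σ : X ⟶ Y) :
    ∀ {γ' : G.obj Y}, G.map σ γ = γ' → ∀ a : A.obj Y γ', B.obj Y (pt γ' a)
  | _, rfl, a => f.1 Y σ a

theorem nat' (f : PiElt A B X γ) {Y Z : TimeObj} (σ : X ⟶ Y) (τ : Y ⟶ Z) {γ' : G.obj Y}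
    {γ'' : G.obj Z} (h : G.map σ γ = γ') (h' : G.map τ γ' = γ'') (h'' : G.map (σ ≫ τ) γ = γ'')
    (a : A.obj Y γ') {b : A.obj Z γ''} (hb : A.map τ h' a = b) :
    B.map τ (comp_map_elt A τ h' a hb) (f.fn' σ h a) = f.fn' (σ ≫ τ) h'' b := by
  subst h h'' hb
  exact f.2 Y Z σ τ a

/-- The restriction maps, by precomposition. -/
def restr (f : PiElt A B X γ) {Y : TimeObj} (σ : X ⟶ Y) {γ' : G.obj Y} (h : G.map σ γ = γ') :
    PiElt A B Y γ' :=
  ⟨fun _ τ a => f.fn' (σ ≫ τ) (map_comp_elt' G σ τ h) a,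
    fun _ _ τ υ a => f.nat' (σ ≫ τ) υ _ (map_comp_elt G τ υ γ').symm
      (map_comp_elt' G σ (τ ≫ υ) h) a rfl⟩

theorem restr_fn' (f : PiElt A B X γ) {Y Z : TimeObj} (σ : X ⟶ Y) {γ' : G.obj Y}
    (h : G.map σ γ = γ') (τ : Y ⟶ Z) {γ'' : G.obj Z} (h' : G.map τ γ' = γ'')
    (h'' : G.map (σ ≫ τ) γ = γ'') (a : A.obj Z γ'') :
    (f.restr σ h).fn' τ h' a = f.fn' (σ ≫ τ) h'' a := by
  subst h'
  rfl

end PiElt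

/-- `⟦Π (x : A). B⟧` -/
def SemTy.pi {G : Psh.{u}} (A : SemTy G) (B : SemTy (comp G A)) : SemTy G where
  obj X γ := PiElt A B X γ
  map σ _ _ h f := f.restr σ h
  map_id _ _ := rfl
  map_comp σ τ _ _ _ h h' h'' f := by
    refine Subtype.ext ?_
    funext Y υ a
    exact (f.restr_fn' σ h (τ ≫ υ) _ _ a).symm

/-- `⟦λ x. t⟧` -/
def semLam {G : Psh.{u}} {A : SemTy G} {B : SemTy (comp G A)} (b : SemTm B) :
    SemTm (A.pi B) where
  val X γ :=
    ⟨fun Y σ a => b.val Y (pt (G.map σ γ) a), fun _ _ _ τ _ => b.nat τ _⟩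
  nat {X Y} σ γ γ' h := by
    subst h
    refine Subtype.ext ?_
    funext Z τ a
    have key : ∀ (γ'' : G.obj Z) (h : G.map (σ ≫ τ) γ = γ'') (a : A.obj Z γ''),
        PiElt.fn' (B := B) ⟨fun Y σ a => b.val Y (pt (G.map σ γ) a),
            fun _ _ _ τ _ => b.nat τ _⟩ (σ ≫ τ) h a
          = b.val Z (pt γ'' a) := by
      rintro γ'' rfl a
      rfl
    exact key _ _ a

/-- `⟦t u⟧ = (⟦t⟧)_id(⟦u⟧)` -/
def semApp {G : Psh.{u}} {A : SemTy G} {B : SemTy (comp G A)} (f : SemTm (A.pi B))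
    (a : SemTm A) : SemTm (B.subst (sect a)) where
  val X γ := (f.val X γ).fn' (𝟙 X) (map_id_elt G γ) (a.val X γ)
  nat {X Y} σ γ γ' h := by
    refine ((f.val X γ).nat' (𝟙 X) σ (map_id_elt G γ) h h (a.val X γ) (a.nat σ h)).trans ?_
    rw [← f.nat σ h]
    exact ((f.val X γ).restr_fn' σ h (𝟙 Y) (map_id_elt G γ') h (a.val Y γ')).symm

/-! ### Clock quantification -/

/-- Elements of `⟦∀ κ. A⟧_X(γ)`: families `(f_σ)`, indexed by the morphisms `σ : X ⟶ Y`, with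
`f_σ(c) ∈ A_Y(σ · γ, c)` for every clock `c` of `Y` and `τ · f_σ(c) = f_{τσ}(τ(c))`. -/
def AllElt {G : Psh.{u}} (A : SemTy (compClk G)) (X : TimeObj) (γ : G.obj X) : Type (u + 1) :=
  { f : ∀ (Y : TimeObj) (σ : X ⟶ Y) (c : Y.clocks), A.obj Y (ptClk (G.map σ γ) c) //
    ∀ (Y Z : TimeObj) (σ : X ⟶ Y) (τ : Y ⟶ Z) (c : Y.clocks),
      A.map τ (compClk_map_elt G τ (map_comp_elt G σ τ γ).symm rfl) (f Y σ c)
        = f Z (σ ≫ τ) (τ.1 c) }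

namespace AllElt

variable {G : Psh.{u}} {A : SemTy (compClk G)} {X : TimeObj} {γ : G.obj X}

/-- `f_σ(c)`, as an element over any `γ'` that is equal to `σ · γ`. -/
def fn' (f : AllElt A X γ) {Y : TimeObj} (σ : X ⟶ Y) :
    ∀ {γ' : G.obj Y}, G.map σ γ = γ' → ∀ c : Y.clocks, A.obj Y (ptClk γ' c)
  | _, rfl, c => f.1 Y σ c

theorem nat' (f : AllElt A X γ) {Y Z : TimeObj} (σ : X ⟶ Y) (τ : Y ⟶ Z) {γ' : G.obj Y}
    {γ'' : G.obj Z} (h : G.map σ γ = γ') (h' : G.map τ γ' = γ'') (h'' : G.map (σ ≫ τ) γ = γ'')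
    (c : Y.clocks) {d : Z.clocks} (hd : τ.1 c = d) :
    A.map τ (compClk_map_elt G τ h' hd) (f.fn' σ h c) = f.fn' (σ ≫ τ) h'' d := by
  subst h h'' hd
  exact f.2 Y Z σ τ c

/-- The restriction maps, by precomposition. -/
def restr (f : AllElt A X γ) {Y : TimeObj} (σ : X ⟶ Y) {γ' : G.obj Y} (h : G.map σ γ = γ') :
    AllElt A Y γ' :=
  ⟨fun _ τ c => f.fn' (σ ≫ τ) (map_comp_elt' G σ τ h) c,
    fun _ _ τ υ c => f.nat' (σ ≫ τ) υ _ (map_comp_elt G τ υ γ').symm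
      (map_comp_elt' G σ (τ ≫ υ) h) c rfl⟩

theorem restr_fn' (f : AllElt A X γ) {Y Z : TimeObj} (σ : X ⟶ Y) {γ' : G.obj Y}
    (h : G.map σ γ = γ') (τ : Y ⟶ Z) {γ'' : G.obj Z} (h' : G.map τ γ' = γ'')
    (h'' : G.map (σ ≫ τ) γ = γ'') (c : Z.clocks) :
    (f.restr σ h).fn' τ h' c = f.fn' (σ ≫ τ) h'' c := by
  subst h'
  rfl

end AllElt

/-- `⟦∀ κ. A⟧` -/
def SemTy.all {G : Psh.{u}} (A : SemTy (compClk G)) : SemTy G where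
  obj X γ := AllElt A X γ
  map σ _ _ h f := f.restr σ h
  map_id _ _ := rfl
  map_comp σ τ _ _ _ h h' h'' f := by
    refine Subtype.ext ?_
    funext Y υ c
    exact (f.restr_fn' σ h (τ ≫ υ) _ _ c).symm

/-- `⟦Λ κ. t⟧` -/
def semClam {G : Psh.{u}} {A : SemTy (compClk G)} (b : SemTm A) : SemTm A.all where
  val X γ :=
    ⟨fun Y σ c => b.val Y (ptClk (G.map σ γ) c), fun _ _ _ τ _ => b.nat τ _⟩
  nat {X Y} σ γ γ' h := by
    subst h
    refine Subtype.ext ?_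
    funext Z τ c
    have key : ∀ (γ'' : G.obj Z) (h : G.map (σ ≫ τ) γ = γ''),
        AllElt.fn' (A := A) ⟨fun Y σ c => b.val Y (ptClk (G.map σ γ) c),
            fun _ _ _ τ _ => b.nat τ _⟩ (σ ≫ τ) h c
          = b.val Z (ptClk γ'' c) := by
      rintro γ'' rfl
      rfl
    exact key _ _

/-- `⟦t[κ]⟧ = (⟦t⟧)_id(κ)` -/
def semCapp {G : Psh.{u}} {A : SemTy (compClk G)} (f : SemTm A.all) (c : ClkSec G) :
    SemTm (A.subst (sectClk c)) where
  val X γ := (f.val X γ).fn' (𝟙 X) (map_id_elt G γ) (c.val X γ)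
  nat {X Y} σ γ γ' h := by
    refine ((f.val X γ).nat' (𝟙 X) σ (map_id_elt G γ) h h (c.val X γ) (c.nat σ h)).trans ?_
    rw [← f.nat σ h]
    exact ((f.val X γ).restr_fn' σ h (𝟙 Y) (map_id_elt G γ') h (c.val Y γ')).symm

/-! ### Dependent sums -/

/-- `⟦Σ (x : A). B⟧` -/
def SemTy.sig {G : Psh.{u}} (A : SemTy G) (B : SemTy (comp G A)) : SemTy G where
  obj X γ := Σ a : A.obj X γ, B.obj X (pt γ a)
  map σ _ _ h p := ⟨A.map σ h p.1, B.map σ (comp_map_elt A σ h p.1 rfl) p.2⟩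
  map_id {X γ} h p := by
    obtain ⟨a, b⟩ := p
    have key : ∀ (a' : A.obj X γ) (e : A.map (𝟙 X) h a = a'), a = a' →
        (⟨a', B.map (𝟙 X) (comp_map_elt A (𝟙 X) h a e) b⟩ : Σ a : A.obj X γ, B.obj X (pt γ a))
          = ⟨a, b⟩ := by
      rintro a' e rfl
      rw [B.map_id]
    exact key _ rfl (A.map_id h a).symm
  map_comp {X Y Z} σ τ γ γ' γ'' h h' h'' p := by
    obtain ⟨a, b⟩ := p
    have key : ∀ (a' : A.obj Z γ'') (e : A.map (σ ≫ τ) h'' a = a')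
        (e' : A.map τ h' (A.map σ h a) = a'),
        (⟨a', B.map (σ ≫ τ) (comp_map_elt A (σ ≫ τ) h'' a e) b⟩ :
            Σ a : A.obj Z γ'', B.obj Z (pt γ'' a))
          = ⟨A.map τ h' (A.map σ h a), B.map τ (comp_map_elt A τ h' _ rfl)
              (B.map σ (comp_map_elt A σ h a rfl) b)⟩ := by
      rintro a' e rfl
      rw [B.map_comp σ τ (comp_map_elt A σ h a rfl) (comp_map_elt A τ h' _ rfl)]
    exact key _ rfl (A.map_comp σ τ h h' h'' a).symm

/-- `⟦⟨t, u⟩⟧` -/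
def semPair {G : Psh.{u}} {A : SemTy G} {B : SemTy (comp G A)} (a : SemTm A)
    (b : SemTm (B.subst (sect a))) : SemTm (A.sig B) where
  val X γ := ⟨a.val X γ, b.val X γ⟩
  nat {X Y} σ γ γ' h := by
    have key : ∀ (a' : A.obj Y γ') (e : A.map σ h (a.val X γ) = a')
        (b' : B.obj Y (pt γ' a')), B.map σ (comp_map_elt A σ h _ e) (b.val X γ) = b' →
        (⟨A.map σ h (a.val X γ), B.map σ (comp_map_elt A σ h _ rfl) (b.val X γ)⟩ :
          Σ a : A.obj Y γ', B.obj Y (pt γ' a)) = ⟨a', b'⟩ := by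
      rintro a' rfl b' rfl
      rfl
    exact key _ (a.nat σ h) _ (b.nat σ h)

/-- `⟦π₁ t⟧` -/
def semFst {G : Psh.{u}} {A : SemTy G} {B : SemTy (comp G A)} (p : SemTm (A.sig B)) :
    SemTm A where
  val X γ := (p.val X γ).1
  nat σ _ _ h := congrArg Sigma.fst (p.nat σ h)

/-- `⟦π₂ t⟧` -/
def semSnd {G : Psh.{u}} {A : SemTy G} {B : SemTy (comp G A)} (p : SemTm (A.sig B)) :
    SemTm (B.subst (sect (semFst p))) where
  val X γ := (p.val X γ).2
  nat {X Y} σ γ γ' h := by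
    have key : ∀ (q : (A.sig B).obj Y γ') (e : (A.sig B).map σ h (p.val X γ) = q),
        B.map σ (comp_map_elt A σ h _ (congrArg Sigma.fst e)) (p.val X γ).2 = q.2 := by
      rintro q rfl
      rfl
    exact key _ (p.nat σ h)

/-! ### Identity types -/

/-- `⟦Id_A(t, s)⟧ = {⋆ | ⟦t⟧ = ⟦s⟧}` -/
def SemTy.ident {G : Psh.{u}} {A : SemTy G} (t s : SemTm A) : SemTy G where
  obj X γ := Truth (t.val X γ = s.val X γ)
  map σ _ _ h e := ⟨⟨by rw [← t.nat σ h, ← s.nat σ h, e.down.down]⟩⟩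
  map_id _ _ := rfl
  map_comp _ _ _ _ _ _ _ _ _ := rfl

/-- `⟦refl t⟧ = ⋆` -/
def semRefl {G : Psh.{u}} {A : SemTy G} (t : SemTm A) : SemTm (SemTy.ident t t) where
  val _ _ := ⟨⟨rfl⟩⟩
  nat _ _ _ _ := rfl

/-! ### Later types -/

/-- The set `B` if `p` holds, and `{⋆}` otherwise. -/
def IfSet (p : Prop) [Decidable p] (B : p → Type (u + 1)) : Type (u + 1) :=
  if h : p then B h else Truth True

namespace IfSet

variable {p : Prop} [Decidable p] {B : p → Type (u + 1)}

/-- The element `f` of `B` if `p` holds, and `⋆` otherwise. -/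
def mk (f : ∀ h : p, B h) : IfSet p B :=
  if h : p then cast (dif_pos h).symm (f h) else cast (dif_neg h).symm ⟨⟨trivial⟩⟩

/-- An element of the set above, as an element of `B`. -/
def get (x : IfSet p B) (h : p) : B h := cast (dif_pos h) x

theorem get_mk (f : ∀ h : p, B h) (h : p) : (mk f).get h = f h := by
  cases ‹Decidable p› with
  | isTrue _ => rfl
  | isFalse h' => exact absurd h h'

theorem ext {x y : IfSet p B} (e : ∀ h : p, x.get h = y.get h) : x = y := by
  cases ‹Decidable p› with
  | isTrue h => exact e h
  | isFalse _ => exact (inferInstance : Subsingleton (Truth.{u} True)).elim x y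

end IfSet

theorem pos_of_pos {G : Psh.{u}} (κ : ClkSec G) {X Y : TimeObj} (σ : X ⟶ Y) {γ : G.obj X}
    {γ' : G.obj Y} (h : G.map σ γ = γ') (hY : 0 < Y.ticks (κ.val Y γ')) :
    0 < X.ticks (κ.val X γ) := by
  rw [← κ.nat σ h] at hY
  exact hY.trans_le (σ.2 _)

/-- Semantic delayed substitutions `⟦ξ : Γ ⇀ Γ'⟧`, where `H` stands for `⟦Γ, Γ'⟧`: families of
elements `ξ_(E,δ)(γ) ∈ ⟦Γ, Γ'⟧_(E,δ⁻)` over the `γ` with `δ(γ(κ)) > 0`, natural in the time object,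
that lie over the restriction of `γ` to `(E, δ⁻)`. -/
structure Delayed {G : Psh.{u}} (κ : ClkSec G) (H : Psh.{u}) where
  proj : H ⟶ G
  fam : ∀ (X : TimeObj) (γ : G.obj X), 0 < X.ticks (κ.val X γ) → H.obj (X.tick (κ.val X γ))
  fam_proj : ∀ (X : TimeObj) (γ : G.obj X) (h : 0 < X.ticks (κ.val X γ)),
    proj.app _ (fam X γ h) = G.map (X.tickHom (κ.val X γ)) γ
  fam_nat : ∀ {X Y : TimeObj} (σ : X ⟶ Y) {γ : G.obj X} {γ' : G.obj Y} (e : G.map σ γ = γ')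
    (h : 0 < X.ticks (κ.val X γ)) (h' : 0 < Y.ticks (κ.val Y γ')),
    H.map (TimeObj.tickMap σ (κ.nat σ e)) (fam X γ h) = fam Y γ' h'

/-- `⟦▷^κ ξ. A⟧_(E,δ)(γ)` is `{⋆}` if `δ(γ(κ)) = 0` and `⟦A⟧_(E,δ⁻)(⟦ξ⟧(γ))` otherwise. -/
def SemTy.later {G H : Psh.{u}} (κ : ClkSec G) (D : Delayed κ H) (A : SemTy H) : SemTy G where
  obj X γ := IfSet (0 < X.ticks (κ.val X γ)) fun h => A.obj (X.tick (κ.val X γ)) (D.fam X γ h)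
  map σ _ _ e a := IfSet.mk fun h' =>
    A.map (TimeObj.tickMap σ (κ.nat σ e)) (D.fam_nat σ e (pos_of_pos κ σ e h') h')
      (a.get (pos_of_pos κ σ e h'))
  map_id h a := IfSet.ext fun h' => by
    rw [IfSet.get_mk]
    exact A.map_id _ _
  map_comp σ τ _ _ _ h h' h'' a := IfSet.ext fun hp => by
    rw [IfSet.get_mk, IfSet.get_mk, IfSet.get_mk]
    exact A.map_comp (TimeObj.tickMap σ (κ.nat σ h)) (TimeObj.tickMap τ (κ.nat τ h')) _ _ _ _

theorem SemTy.later_map_get {G H : Psh.{u}} (κ : ClkSec G) (D : Delayed κ H) (A : SemTy H)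
    {X Y : TimeObj} (σ : X ⟶ Y) {γ : G.obj X} {γ' : G.obj Y} (e : G.map σ γ = γ')
    (a : (A.later κ D).obj X γ) (h : 0 < X.ticks (κ.val X γ)) (h' : 0 < Y.ticks (κ.val Y γ')) :
    IfSet.get ((A.later κ D).map σ e a) h'
      = A.map (TimeObj.tickMap σ (κ.nat σ e)) (D.fam_nat σ e h h') (IfSet.get a h) :=
  IfSet.get_mk _ h'

/-- `⟦next^κ ξ. t⟧_(E,δ)(γ)` is `⋆` if `δ(γ(κ)) = 0` and `⟦t⟧_(E,δ⁻)(⟦ξ⟧(γ))` otherwise. -/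
def semNext {G H : Psh.{u}} (κ : ClkSec G) (D : Delayed κ H) {A : SemTy H} (a : SemTm A) :
    SemTm (A.later κ D) where
  val X γ := IfSet.mk fun h => a.val _ (D.fam X γ h)
  nat σ _ _ e := IfSet.ext fun h' => by
    refine (IfSet.get_mk _ h').trans ?_
    rw [IfSet.get_mk, IfSet.get_mk]
    exact a.nat _ _

/-- The empty delayed substitution. -/
def Delayed.nil {G : Psh.{u}} (κ : ClkSec G) : Delayed κ G where
  proj := 𝟙 G
  fam X γ _ := G.map (X.tickHom (κ.val X γ)) γ
  fam_proj _ _ _ := rfl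
  fam_nat {X Y} σ γ γ' e _ _ := by
    subst e
    have hc := κ.nat σ (γ := γ) rfl
    have key : ∀ (c : Y.clocks) (hc : σ.1 (κ.val X γ) = c),
        G.map (TimeObj.tickMap σ hc) (G.map (X.tickHom (κ.val X γ)) γ)
          = G.map (Y.tickHom c) (G.map σ γ) := by
      intro c hc
      rw [← map_comp_elt, ← map_comp_elt]
      rfl
    exact key _ hc

/-- The delayed substitution `ξ⟨x ← t⟩`. -/
def Delayed.snoc {G H : Psh.{u}} {κ : ClkSec G} (D : Delayed κ H) {A : SemTy H}
    (t : SemTm (A.later κ D)) : Delayed κ (comp H A) where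
  proj := GDTT.proj A ≫ D.proj
  fam X γ h := pt (D.fam X γ h) (IfSet.get (t.val X γ) h)
  fam_proj X γ h := D.fam_proj X γ h
  fam_nat {X Y} σ γ γ' e h h' := by
    refine comp_map_elt A _ (D.fam_nat σ e h h') _ ?_
    rw [← t.nat σ e]
    exact (SemTy.later_map_get κ D A σ e _ h h').symm

/-! ### Universes -/

/-- Small dependent types over `y(Z)` that are invariant under clock introduction: families of
small sets `F_σ`, indexed by the morphisms `σ` with domain `Z`, with functorial maps
`τ · (-) : F_σ → F_{τσ}` that are bijections if `τ` is an inclusion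
`(E, δ) → ((E, k), δ[k ↦ n])`. -/
structure SmallFam (Z : TimeObj) : Type (u + 1) where
  obj : ∀ {X : TimeObj}, (Z ⟶ X) → Type u
  map : ∀ {X Y : TimeObj} (σ : Z ⟶ X) (τ : X ⟶ Y), obj σ → obj (σ ≫ τ)
  map_id : ∀ {X : TimeObj} (σ : Z ⟶ X) (a : obj σ), map σ (𝟙 X) a = a
  map_comp : ∀ {W X Y : TimeObj} (σ : Z ⟶ W) (τ : W ⟶ X) (υ : X ⟶ Y) (a : obj σ),
    map σ (τ ≫ υ) a = map (σ ≫ τ) υ (map σ τ a)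
  inv : ∀ {X : TimeObj} (σ : Z ⟶ X) (k n : ℕ), k ∉ X.clocks →
    Function.Bijective (map σ (X.ι k n))

/-- The action `(f · F)_σ = F_{σ f}`. -/
def SmallFam.precomp {Z Z' : TimeObj} (F : SmallFam.{u} Z) (f : Z ⟶ Z') : SmallFam.{u} Z' where
  obj σ := F.obj (f ≫ σ)
  map σ τ := F.map (f ≫ σ) τ
  map_id σ a := F.map_id (f ≫ σ) a
  map_comp σ τ υ a := F.map_comp (f ≫ σ) τ υ a
  inv σ k n h := F.inv (f ≫ σ) k n h

theorem ClkSet.mem {G : Psh.{u}} (K : ClkSet G) {X Y : TimeObj} (σ : X ⟶ Y) {γ : G.obj X}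
    {γ' : G.obj Y} (h : G.map σ γ = γ') : ∀ c ∈ K.val X γ, σ.1 c ∈ K.val Y γ' := fun _ hc =>
  K.nat σ h ▸ Finset.mem_image_of_mem _ hc

/-- `⟦U_Δ⟧_(E,δ)(γ)` is the set of small dependent types over `y(γ[Δ], δ|_γ[Δ])` that are invariant
under clock introduction; here `K` is the family of the sets `γ[Δ]`. -/
def SemTy.univ {G : Psh.{u}} (K : ClkSet G) : SemTy G where
  obj X γ := SmallFam.{u} (X.restrict (K.val X γ))
  map σ _ _ h F := F.precomp (TimeObj.cores σ (K.mem σ h))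
  map_id _ _ := rfl
  map_comp _ _ _ _ _ _ _ _ _ := rfl

/-- The family `El_Δ` over `U_Δ`: its value at `(γ, F)` is `F_i`, where `i` is the inclusion of
`(γ[Δ], δ|_γ[Δ])` in `(E, δ)`. -/
def SemTy.elts {G : Psh.{u}} (K : ClkSet G) : SemTy (comp G (SemTy.univ K)) where
  obj X p := ULift.{u + 1, u} ((fib p).obj (X.restrictι (K.val X (base p))))
  map {X Y} σ p p' h a :=
    ⟨cast (by subst h; rfl) ((fib p).map (X.restrictι (K.val X (base p))) σ a.down)⟩
  map_id {X p} h a :=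
    congrArg ULift.up (eq_of_heq ((cast_heq _ _).trans (heq_of_eq ((fib p).map_id _ a.down))))
  map_comp {X Y Z} σ τ p p' p'' h h' h'' a := by
    subst h h'
    refine congrArg ULift.up (eq_of_heq ?_)
    refine (cast_heq _ _).trans (HEq.trans ?_ (cast_heq _ _).symm)
    exact heq_of_eq ((fib p).map_comp _ σ τ a.down)

/-- `⟦El_Δ(t)⟧` -/
def SemTy.el {G : Psh.{u}} (K : ClkSet G) (a : SemTm (SemTy.univ K)) : SemTy G :=
  (SemTy.elts K).subst (sect a)

/-- `⟦in_{Δ,Δ'}(t)⟧_σ = ⟦t⟧_{σ i}`, where `i` is the inclusion of `γ[Δ]` in `γ[Δ']`. -/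
def semIncl {G : Psh.{u}} {K K' : ClkSet G} (hK : ∀ X γ, K.val X γ ⊆ K'.val X γ)
    (a : SemTm (SemTy.univ K)) : SemTm (SemTy.univ K') where
  val X γ := (a.val X γ).precomp (TimeObj.cores (𝟙 X) (hK X γ))
  nat {X Y} σ γ γ' h := by
    rw [← a.nat σ h]
    rfl

/-! ## The interpretation

The interpretation is a partial function on raw syntax, defined by structural recursion.  It is
relative to a presheaf `G` (the interpretation of the context) and an environment, which assigns a
semantic clock or term over `G` to every variable.  Annotations are interpreted and compared with
the semantic types of the subterms; the interpretation is undefined if they differ. -/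

/-- Meanings of variables. -/
inductive Entry (G : Psh.{u}) : Type (u + 2)
  | clk (c : ClkSec G)
  | tm (A : SemTy G) (a : SemTm A)

/-- Reindexing. -/
def Entry.subst {G H : Psh.{u}} (f : H ⟶ G) : Entry G → Entry H
  | .clk c => .clk (c.subst f)
  | .tm A a => .tm (A.subst f) (a.subst f)

/-- Environments. -/
def Env (G : Psh.{u}) : Type (u + 2) := ℕ → Option (Entry G)

namespace Env

variable {G H : Psh.{u}}

/-- Reindexing. -/
def subst (ρ : Env G) (f : H ⟶ G) : Env H := fun n => (ρ n).map (Entry.subst f)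

/-- The environment with a new last variable. -/
def cons (ρ : Env G) (e : Entry G) : Env G
  | 0 => some e
  | n + 1 => ρ n

/-- The environment of `Γ, x : A`. -/
def ext (ρ : Env G) (A : SemTy G) : Env (comp G A) :=
  (ρ.subst (proj A)).cons (.tm _ (lastVar A))

/-- The environment of `Γ, κ : clock`. -/
def extClk (ρ : Env G) : Env (compClk G) :=
  (ρ.subst (projClk G)).cons (.clk (lastClk G))

/-- The meaning of a clock variable. -/
def clk (ρ : Env G) (κ : ℕ) : Option (ClkSec G) :=
  match ρ κ with
  | some (.clk c) => some c
  | _ => none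

open Classical in
/-- The family of the sets `γ[Δ] = {γ(κ) | κ ∈ Δ}`, for a set `Δ` of clock variables. -/
noncomputable def clks (ρ : Env G) (Δ : Finset ℕ) : Option (ClkSet G) :=
  if ∀ κ ∈ Δ, (ρ.clk κ).isSome then
    some
      { val := fun X γ =>
          Finset.univ.filter fun c => ∃ κ ∈ Δ, ∃ k : ClkSec G, ρ.clk κ = some k ∧ k.val X γ = c
        nat := by
          intro X Y σ γ γ' h
          ext c
          simp only [Finset.mem_image, Finset.mem_filter, Finset.mem_univ, true_and]
          constructor
          · rintro ⟨d, ⟨κ, hκ, k, hk, rfl⟩, rfl⟩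
            exact ⟨κ, hκ, k, hk, (k.nat σ h).symm⟩
          · rintro ⟨κ, hκ, k, hk, rfl⟩
            exact ⟨_, ⟨κ, hκ, k, hk, rfl⟩, k.nat σ h⟩ }
  else none

end Env

/-- A semantic type together with a semantic term of this type. -/
structure Elem (G : Psh.{u}) : Type (u + 2) where
  ty : SemTy G
  tm : SemTm ty

open Classical in
/-- The term, if it is of type `A`. -/
noncomputable def Elem.check {G : Psh.{u}} (e : Elem G) (A : SemTy G) : Option (SemTm A) :=
  if h : e.ty = A then some (h ▸ e.tm) else none

open Classical in
/-- `⟦prev κ. t⟧`: the clock abstraction of the unique `a` with `next^κ a = ⟦t⟧`. -/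
noncomputable def semPrev {G : Psh.{u}} {A : SemTy (compClk G)}
    (t : SemTm (A.later (lastClk G) (.nil _))) : Option (SemTm A.all) :=
  if h : ∃! a : SemTm A, semNext (lastClk G) (.nil _) a = t then some (semClam h.choose) else none

open Classical in
/-- `⟦fix^κ x. t⟧`: the unique `a` with `a = ⟦t⟧[next^κ a]`. -/
noncomputable def semFix {G : Psh.{u}} (κ : ClkSec G) {A : SemTy G}
    (t : SemTm (A.subst (proj (A.later κ (.nil κ))))) : Option (SemTm A) :=
  if h : ∃! a : SemTm A, a = t.subst (sect (semNext κ (.nil κ) a)) then some h.choose else none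

/-- Interpretation of a delayed substitution `ξ : Γ ⇀ Γ'`: the presheaf `⟦Γ, Γ'⟧`, its environment
and the family of elements. -/
structure DInterp {G : Psh.{u}} (κ : ClkSec G) : Type (u + 2) where
  tot : Psh.{u}
  env : Env tot
  fam : Delayed κ tot

open Classical in
mutual

/-- Interpretation of types. -/
noncomputable def Ty.den : Ty → (G : Psh.{u}) → Env G → Option (SemTy G)
  | .pi A B, G, ρ =>
    (A.den G ρ).bind fun A' =>
    (B.den _ (ρ.ext A')).bind fun B' =>
    some (A'.pi B')
  | .sig A B, G, ρ =>
    (A.den G ρ).bind fun A' =>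
    (B.den _ (ρ.ext A')).bind fun B' =>
    some (A'.sig B')
  | .later κ ξ A, G, ρ =>
    (ρ.clk κ).bind fun c =>
    (ξ.den G ρ c).bind fun D =>
    (A.den D.tot D.env).bind fun A' =>
    some (A'.later c D.fam)
  | .all A, _, ρ =>
    (A.den _ ρ.extClk).bind fun A' =>
    some A'.all
  | .ident A t s, G, ρ =>
    (A.den G ρ).bind fun A' =>
    (t.den G ρ).bind fun e => (e.check A').bind fun t' =>
    (s.den G ρ).bind fun e => (e.check A').bind fun s' =>
    some (SemTy.ident t' s')
  | .univ Δ, _, ρ =>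
    (ρ.clks Δ).bind fun K =>
    some (SemTy.univ K)
  | .el Δ t, G, ρ =>
    (ρ.clks Δ).bind fun K =>
    (t.den G ρ).bind fun e => (e.check (SemTy.univ K)).bind fun t' =>
    some (SemTy.el K t')

/-- Interpretation of terms. -/
noncomputable def Tm.den : Tm → (G : Psh.{u}) → Env G → Option (Elem G)
  | .var n, _, ρ =>
    match ρ n with
    | some (.tm A a) => some ⟨A, a⟩
    | _ => none
  | .lam A t, G, ρ =>
    (A.den G ρ).bind fun A' =>
    (t.den _ (ρ.ext A')).bind fun t' =>
    some ⟨A'.pi t'.ty, semLam t'.tm⟩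
  | .app A B t u, G, ρ =>
    (A.den G ρ).bind fun A' =>
    (B.den _ (ρ.ext A')).bind fun B' =>
    (t.den G ρ).bind fun e => (e.check (A'.pi B')).bind fun t' =>
    (u.den G ρ).bind fun e => (e.check A').bind fun u' =>
    some ⟨B'.subst (sect u'), semApp t' u'⟩
  | .pair A B t u, G, ρ =>
    (A.den G ρ).bind fun A' =>
    (B.den _ (ρ.ext A')).bind fun B' =>
    (t.den G ρ).bind fun e => (e.check A').bind fun t' =>
    (u.den G ρ).bind fun e => (e.check (B'.subst (sect t'))).bind fun u' =>
    some ⟨A'.sig B', semPair t' u'⟩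
  | .fst A B t, G, ρ =>
    (A.den G ρ).bind fun A' =>
    (B.den _ (ρ.ext A')).bind fun B' =>
    (t.den G ρ).bind fun e => (e.check (A'.sig B')).bind fun t' =>
    some ⟨A', semFst t'⟩
  | .snd A B t, G, ρ =>
    (A.den G ρ).bind fun A' =>
    (B.den _ (ρ.ext A')).bind fun B' =>
    (t.den G ρ).bind fun e => (e.check (A'.sig B')).bind fun t' =>
    some ⟨B'.subst (sect (semFst t')), semSnd t'⟩
  | .next κ ξ t, G, ρ =>
    (ρ.clk κ).bind fun c =>
    (ξ.den G ρ c).bind fun D =>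
    (t.den D.tot D.env).bind fun t' =>
    some ⟨t'.ty.later c D.fam, semNext c D.fam t'.tm⟩
  | .prev A t, G, ρ =>
    (A.den _ ρ.extClk).bind fun A' =>
    (t.den _ ρ.extClk).bind fun e => (e.check (A'.later (lastClk G) (.nil _))).bind fun t' =>
    (semPrev t').bind fun a =>
    some ⟨A'.all, a⟩
  | .fix κ A t, G, ρ =>
    (ρ.clk κ).bind fun c =>
    (A.den G ρ).bind fun A' =>
    let L := A'.later c (.nil c)
    (t.den _ (ρ.ext L)).bind fun e => (e.check (A'.subst (proj L))).bind fun t' =>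
    (semFix c t').bind fun a =>
    some ⟨A', a⟩
  | .clam t, _, ρ =>
    (t.den _ ρ.extClk).bind fun t' =>
    some ⟨t'.ty.all, semClam t'.tm⟩
  | .capp A t κ, G, ρ =>
    (A.den _ ρ.extClk).bind fun A' =>
    (t.den G ρ).bind fun e => (e.check A'.all).bind fun t' =>
    (ρ.clk κ).bind fun c =>
    some ⟨A'.subst (sectClk c), semCapp t' c⟩
  | .refl A t, G, ρ =>
    (A.den G ρ).bind fun A' =>
    (t.den G ρ).bind fun e => (e.check A').bind fun t' =>
    some ⟨SemTy.ident t' t', semRefl t'⟩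
  | .incl Δ Δ' t, G, ρ =>
    (ρ.clks Δ).bind fun K =>
    (ρ.clks Δ').bind fun K' =>
    (t.den G ρ).bind fun e => (e.check (SemTy.univ K)).bind fun t' =>
    if h : ∀ X γ, K.val X γ ⊆ K'.val X γ then some ⟨SemTy.univ K', semIncl h t'⟩ else none

/-- Interpretation of delayed substitutions. -/
noncomputable def DSub.den : DSub → (G : Psh.{u}) → Env G → (κ : ClkSec G) → Option (DInterp κ)
  | .nil, G, ρ, κ => some ⟨G, ρ, .nil κ⟩
  | .snoc ξ A t, G, ρ, κ =>
    (ξ.den G ρ κ).bind fun D =>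
    (A.den D.tot D.env).bind fun A' =>
    (t.den G ρ).bind fun e => (e.check (A'.later κ D.fam)).bind fun t' =>
    some ⟨comp D.tot A', D.env.ext A', D.fam.snoc t'⟩

end

/-- A presheaf with an environment. -/
structure CtxInterp : Type (u + 2) where
  psh : Psh.{u}
  env : Env psh

/-- Interpretation of contexts. -/
noncomputable def Ctx.den : Ctx → Option CtxInterp.{u}
  | [] => some ⟨emptyCtx, fun _ => none⟩
  | .ty A :: Γ =>
    (Ctx.den Γ).bind fun I =>
    (A.den I.psh I.env).bind fun A' =>
    some ⟨comp I.psh A', I.env.ext A'⟩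
  | .clk :: Γ =>
    (Ctx.den Γ).bind fun I =>
    some ⟨compClk I.psh, I.env.extClk⟩

end GDTT

/-!
The interpretation is a partial function on raw syntax, and the proof has two parts.

*Invariance.*  For a semantic type `A` over `G`, the projection `comp G A ⟶ G` is orthogonal to all
`y({k}, n)` as soon as the restriction maps of `A` along all inclusions `ι : X ⟶ X.insert k n` with
`k` fresh are bijective (`SemTy.Inv`, `SemTy.Inv.invariantUnderClockIntro`).  The reason is that
`X.insert k n` is the coproduct of `X` and `({k}, n)`.  The property `SemTy.Inv` is preserved by all
type formers, and it holds for the universes and for `El` by construction.  So it holds for the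
interpretation of every raw type that has one (`Ty.inv_of_den`), by recursion on the type and
without any reference to typing.  For `Π` and `∀`, the component at `σ : X ⟶ Y` of the extension of
an element is found by adding a fresh clock to `Y` as well.

*Definedness.*  It has to be shown that derivable judgements are interpreted and that judgemental
equality is sound (`TyOk.sound` and its companions, by simultaneous induction on derivations).
Annotations are compared by equality of semantic types, so that reindexing has to commute with all
constructors up to equality and not just up to isomorphism.  The ingredients are the following.

* The substitution lemma `Ty.den_sub_of_class`, which is proved for a class of substitutions that is
  closed under binders, and is then applied first to renamings and after that to substitutions.  The
  clause for delayed substitutions `ξ : Γ ⇀ Γ'` also provides a pullback square between the two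
  interpretations of `Γ, Γ'`.
* `existsUnique_prev`: over a fresh clock variable `κ`, the map `next^κ` is a bijection on terms,
  because every point of `G × C` is the image of one whose clock `κ` has just ticked.
* `existsUnique_fix`: guarded fixed points exist uniquely, by induction on the number of ticks left.
* `AllElt.irrel`: clock irrelevance, which follows from invariance, since an element of `∀ κ. A` is
  determined by its value at a fresh clock.
* The equations of delayed substitutions.  If `g` maps the total presheaf of one delayed
  substitution to that of another one and is compatible with their values (`Delayed.Over`),
  then the later types and the `next` terms formed with them agree (`SemTy.later_subst`,
  `semNext_subst`).  Weakening, exchange and substitution are instances of this.  For the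
  commutation of `next` with itself
  (`semNext_comm`) the two iterated delayed substitutions have the same total presheaf, namely a
  pullback over `G`.
-/

namespace GDTT

/-! ### Equality of semantic types and terms -/

/-- Semantic types are compared literally; the elements of their fibres are compared up to `HEq`, as
the fibres are only propositionally equal. -/
theorem SemTy.ext_heq {G : Psh.{u}} {A B : SemTy G} (ho : ∀ X γ, A.obj X γ = B.obj X γ)
    (hm : ∀ {X Y : TimeObj} (σ : X ⟶ Y) {γ : G.obj X} {γ' : G.obj Y} (h : G.map σ γ = γ')
      (a : A.obj X γ) (b : B.obj X γ), HEq a b → HEq (A.map σ h a) (B.map σ h b)) : A = B := by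
  obtain ⟨o, m, i, c⟩ := A
  obtain ⟨o', m', i', c'⟩ := B
  obtain rfl : o = o' := funext fun X => funext (ho X)
  have : @m = @m' := by
    funext X Y σ γ γ' h a
    exact eq_of_heq (hm σ h a a HEq.rfl)
  subst this
  rfl

theorem Elem.ext_heq {G : Psh.{u}} {A B : SemTy G} {a : SemTm A} {b : SemTm B} (h : A = B)
    (hv : ∀ X γ, HEq (a.val X γ) (b.val X γ)) : (⟨A, a⟩ : Elem G) = ⟨B, b⟩ := by
  subst h
  have : a = b := SemTm.ext (funext fun X => funext fun γ => eq_of_heq (hv X γ))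
  rw [this]

/-- A semantic term, as a term of an equal type. -/
def SemTm.cast {G : Psh.{u}} {A B : SemTy G} (h : A = B) (a : SemTm A) : SemTm B := h ▸ a

theorem SemTm.cast_val {G : Psh.{u}} {A B : SemTy G} (h : A = B) (a : SemTm A) (X : TimeObj)
    (γ : G.obj X) : HEq ((a.cast h).val X γ) (a.val X γ) := by
  subst h; rfl

theorem Elem.mk_cast {G : Psh.{u}} {A B : SemTy G} (h : A = B) (a : SemTm A) :
    (⟨B, a.cast h⟩ : Elem G) = ⟨A, a⟩ := by
  subst h; rfl

theorem Elem.mk_inj {G : Psh.{u}} {A : SemTy G} {a b : SemTm A}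
    (h : (⟨A, a⟩ : Elem G) = ⟨A, b⟩) : a = b := by
  cases h; rfl

theorem Elem.val_heq {G : Psh.{u}} {A B : SemTy G} {a : SemTm A} {b : SemTm B}
    (h : (⟨A, a⟩ : Elem G) = ⟨B, b⟩) (X : TimeObj) (γ : G.obj X) :
    HEq (a.val X γ) (b.val X γ) := by
  cases h; rfl

theorem Elem.check_eq_some {G : Psh.{u}} {e : Elem G} {A : SemTy G} {a : SemTm A} :
    e.check A = some a ↔ e = ⟨A, a⟩ := by
  obtain ⟨B, b⟩ := e
  unfold Elem.check
  constructor
  · intro h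
    split_ifs at h with h'
    change B = A at h'
    subst h'
    simp only [Option.some.injEq] at h
    rw [← h]
  · intro h
    cases h
    simp

theorem SemTy.map_heq {G : Psh.{u}} (A : SemTy G) {X Y : TimeObj} (σ : X ⟶ Y)
    {γ₁ γ₂ : G.obj X} {δ₁ δ₂ : G.obj Y} (h₁ : G.map σ γ₁ = δ₁) (h₂ : G.map σ γ₂ = δ₂)
    (e : γ₁ = γ₂) {a : A.obj X γ₁} {b : A.obj X γ₂} (hab : HEq a b) :
    HEq (A.map σ h₁ a) (A.map σ h₂ b) := by
  subst e h₁ h₂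
  rw [eq_of_heq hab]

theorem SemTm.val_heq {G : Psh.{u}} {A : SemTy G} (a : SemTm A) {X : TimeObj}
    {γ₁ γ₂ : G.obj X} (e : γ₁ = γ₂) : HEq (a.val X γ₁) (a.val X γ₂) := by
  subst e; rfl

/-! ### Reindexing along context morphisms -/

theorem pt_ext {G : Psh.{u}} {A : SemTy G} {X : TimeObj} {γ γ' : G.obj X} {a : A.obj X γ}
    {a' : A.obj X γ'} (h : γ = γ') (h' : HEq a a') : pt γ a = pt γ' a' := by
  subst h
  rw [eq_of_heq h']

/-- The morphism `⟦Δ, x : A[f]⟧ ⟶ ⟦Γ, x : A⟧` over `f : ⟦Δ⟧ ⟶ ⟦Γ⟧`. -/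
def lift {G H : Psh.{u}} (f : H ⟶ G) (A : SemTy G) : comp H (A.subst f) ⟶ comp G A where
  app X := TypeCat.ofHom fun p => pt (f.app X (base p)) (fib p)
  naturality _ _ σ := fun_ext_elt fun p =>
    (comp_map_elt A σ (app_map_elt f σ rfl) (fib p) rfl).symm

/-- The morphism `⟦Δ, κ : clock⟧ ⟶ ⟦Γ, κ : clock⟧` over `f : ⟦Δ⟧ ⟶ ⟦Γ⟧`. -/
def liftClk {G H : Psh.{u}} (f : H ⟶ G) : compClk H ⟶ compClk G where
  app X := TypeCat.ofHom fun p =>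
    ptClk (f.app X ((projClk H).app X p)) ((lastClk H).val X p)
  naturality _ _ σ := fun_ext_elt fun _ =>
    (compClk_map_elt G σ (app_map_elt f σ rfl) rfl).symm

/-- Reindexing of families of sets of clocks. -/
def ClkSet.subst {G H : Psh.{u}} (K : ClkSet G) (f : H ⟶ G) : ClkSet H where
  val X γ := K.val X (f.app X γ)
  nat σ _ _ h := K.nat σ (app_map_elt f σ h)

/-- Reindexing of a term together with its type. -/
def Elem.subst {G H : Psh.{u}} (e : Elem G) (f : H ⟶ G) : Elem H := ⟨e.ty.subst f, e.tm.subst f⟩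

section

variable {G H : Psh.{u}} (f : H ⟶ G)

theorem SemTy.subst_sect {A : SemTy G} (B : SemTy (comp G A)) (a : SemTm A) :
    (B.subst (sect a)).subst f = (B.subst (lift f A)).subst (sect (a.subst f)) := rfl

theorem SemTy.sig_subst (A : SemTy G) (B : SemTy (comp G A)) :
    (A.sig B).subst f = (A.subst f).sig (B.subst (lift f A)) := rfl

theorem SemTy.univ_subst (K : ClkSet G) : (SemTy.univ K).subst f = SemTy.univ (K.subst f) := rfl

end

/-! ### Dependent products and clock quantification under reindexing -/

/-- Elements of a dependent product along a compatible family `g` of points of `G`.  The family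
`g σ = σ · γ` gives `PiElt`; having `g` as a parameter makes it possible to replace `σ · f(γ)` by
the equal point `f(σ · γ)`. -/
def PiAlong {G : Psh.{u}} (A : SemTy G) (B : SemTy (comp G A)) (X : TimeObj)
    (g : ∀ Y : TimeObj, (X ⟶ Y) → G.obj Y)
    (hg : ∀ {Y Z : TimeObj} (σ : X ⟶ Y) (τ : Y ⟶ Z), G.map τ (g Y σ) = g Z (σ ≫ τ)) :
    Type (u + 1) :=
  { f : ∀ (Y : TimeObj) (σ : X ⟶ Y) (a : A.obj Y (g Y σ)), B.obj Y (pt (g Y σ) a) //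
    ∀ (Y Z : TimeObj) (σ : X ⟶ Y) (τ : Y ⟶ Z) (a : A.obj Y (g Y σ)),
      B.map τ (comp_map_elt A τ (hg σ τ) a rfl) (f Y σ a) = f Z (σ ≫ τ) (A.map τ (hg σ τ) a) }

theorem PiAlong.heq_iff {G : Psh.{u}} {A : SemTy G} {B : SemTy (comp G A)} {X : TimeObj}
    {g g' : ∀ Y : TimeObj, (X ⟶ Y) → G.obj Y}
    {hg : ∀ {Y Z : TimeObj} (σ : X ⟶ Y) (τ : Y ⟶ Z), G.map τ (g Y σ) = g Z (σ ≫ τ)}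
    {hg' : ∀ {Y Z : TimeObj} (σ : X ⟶ Y) (τ : Y ⟶ Z), G.map τ (g' Y σ) = g' Z (σ ≫ τ)}
    (e : g = g') (F : PiAlong A B X g hg) (F' : PiAlong A B X g' hg') :
    HEq F F' ↔ ∀ Y σ a a', HEq a a' → HEq (F.1 Y σ a) (F'.1 Y σ a') := by
  subst e
  constructor
  · rintro h Y σ a a' h'
    rw [eq_of_heq h, eq_of_heq h']
  · intro h
    refine heq_of_eq (Subtype.ext ?_)
    funext Y σ a
    exact eq_of_heq (h Y σ a a HEq.rfl)

section

variable {G H : Psh.{u}} (f : H ⟶ G)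

theorem map_app_eq {X Y : TimeObj} (σ : X ⟶ Y) (γ : H.obj X) :
    G.map σ (f.app X γ) = f.app Y (H.map σ γ) := app_map_elt f σ rfl

theorem PiElt.obj_subst (A : SemTy G) (B : SemTy (comp G A)) (X : TimeObj) (γ : H.obj X) :
    PiElt A B X (f.app X γ) = PiElt (A.subst f) (B.subst (lift f A)) X γ := by
  have key : ∀ (g : ∀ Y : TimeObj, (X ⟶ Y) → G.obj Y)
      (_ : g = fun Y σ => f.app Y (H.map σ γ))
      (hg : ∀ {Y Z : TimeObj} (σ : X ⟶ Y) (τ : Y ⟶ Z), G.map τ (g Y σ) = g Z (σ ≫ τ)),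
      PiAlong A B X g hg = PiElt (A.subst f) (B.subst (lift f A)) X γ := by
    rintro g rfl hg
    rfl
  exact key (fun Y σ => G.map σ (f.app X γ)) (funext fun Y => funext fun σ => map_app_eq f σ γ)
    fun σ τ => (map_comp_elt G σ τ _).symm

/-- Equality of elements of `⟦(Π (x : A). B)[f]⟧` and of `⟦Π (x : A[f]). B[f]⟧`, two types that are
equal but not definitionally so. -/
theorem PiElt.heq_iff {A : SemTy G} {B : SemTy (comp G A)} {X : TimeObj} {γ : H.obj X}
    (F : PiElt A B X (f.app X γ)) (F' : PiElt (A.subst f) (B.subst (lift f A)) X γ) :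
    HEq F F' ↔ ∀ (Y : TimeObj) (σ : X ⟶ Y) (γ' : H.obj Y) (h : H.map σ γ = γ')
      (a : A.obj Y (f.app Y γ')), F.fn' σ (app_map_elt f σ h) a = F'.fn' σ h a := by
  have fn_heq : ∀ (Y : TimeObj) (σ : X ⟶ Y) (γ' : G.obj Y) (h : G.map σ (f.app X γ) = γ')
      (a : A.obj Y γ') (a' : A.obj Y (G.map σ (f.app X γ))), HEq a a' →
      HEq (F.fn' σ h a) (F.1 Y σ a') := by
    rintro Y σ γ' rfl a a' h
    rw [eq_of_heq h]; rfl
  refine (PiAlong.heq_iff (g := fun Y σ => G.map σ (f.app X γ))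
    (g' := fun Y σ => f.app Y (H.map σ γ)) (hg := fun σ τ => (map_comp_elt G σ τ _).symm)
    (hg' := fun σ τ => app_map_elt f τ (map_comp_elt H σ τ _).symm)
    (funext fun Y => funext fun σ => map_app_eq f σ γ) F F').trans ?_
  constructor
  · rintro h Y σ γ' rfl a
    obtain ⟨a', ha⟩ : ∃ a' : A.obj Y (G.map σ (f.app X γ)), HEq a a' :=
      ⟨cast (by rw [map_app_eq]) a, (cast_heq _ _).symm⟩
    exact eq_of_heq ((fn_heq Y σ _ _ a a' ha).trans (h Y σ a' a ha.symm))
  · rintro h Y σ a a' ha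
    have := h Y σ _ rfl a'
    exact (fn_heq Y σ _ (map_app_eq f σ γ) a' a ha.symm).symm.trans (heq_of_eq this)

theorem SemTy.pi_subst (A : SemTy G) (B : SemTy (comp G A)) :
    (A.pi B).subst f = (A.subst f).pi (B.subst (lift f A)) := by
  refine SemTy.ext_heq (fun X γ => PiElt.obj_subst f A B X γ) ?_
  intro X Y σ γ γ' h F F' hF
  refine (PiElt.heq_iff f _ _).2 ?_
  intro Z τ γ'' h' a
  refine (PiElt.restr_fn' F σ (app_map_elt f σ h) τ (app_map_elt f τ h')
    (app_map_elt f (σ ≫ τ) ((map_comp_elt' H σ τ h).trans h')) a).trans ?_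
  refine ((PiElt.heq_iff f F F').1 hF Z (σ ≫ τ) γ'' ((map_comp_elt' H σ τ h).trans h') a).trans ?_
  exact (PiElt.restr_fn' F' σ h τ h' _ a).symm

theorem semLam_fn' {A : SemTy G} {B : SemTy (comp G A)} (b : SemTm B) {X Y : TimeObj}
    (γ : G.obj X) (σ : X ⟶ Y) {γ' : G.obj Y} (h : G.map σ γ = γ') (a : A.obj Y γ') :
    PiElt.fn' ((semLam b).val X γ) σ h a = b.val Y (pt γ' a) := by
  subst h; rfl

theorem semLam_subst {A : SemTy G} {B : SemTy (comp G A)} (b : SemTm B) :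
    (⟨_, (semLam b).subst f⟩ : Elem H) = ⟨_, semLam (b.subst (lift f A))⟩ := by
  refine Elem.ext_heq (SemTy.pi_subst f A B) fun X γ => (PiElt.heq_iff f _ _).2 ?_
  intro Y σ γ' h a
  exact (semLam_fn' b _ σ (app_map_elt f σ h) a).trans
    (semLam_fn' (b.subst (lift f A)) γ σ h a).symm

theorem semApp_subst {A : SemTy G} {B : SemTy (comp G A)} (t : SemTm (A.pi B)) (a : SemTm A) :
    (semApp t a).subst f
      = semApp (B := B.subst (lift f A)) ((t.subst f).cast (SemTy.pi_subst f A B))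
          (a.subst f) := by
  refine SemTm.ext (funext fun X => funext fun γ => ?_)
  exact (PiElt.heq_iff f _ _).1 (SemTm.cast_val (SemTy.pi_subst f A B) (t.subst f) X γ).symm X
    (𝟙 X) γ (map_id_elt H γ) (a.val X (f.app X γ))

/-- Elements of a clock quantification along a compatible family `g` of points of `G`. -/
def AllAlong {G : Psh.{u}} (A : SemTy (compClk G)) (X : TimeObj)
    (g : ∀ Y : TimeObj, (X ⟶ Y) → G.obj Y)
    (hg : ∀ {Y Z : TimeObj} (σ : X ⟶ Y) (τ : Y ⟶ Z), G.map τ (g Y σ) = g Z (σ ≫ τ)) :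
    Type (u + 1) :=
  { f : ∀ (Y : TimeObj) (σ : X ⟶ Y) (c : Y.clocks), A.obj Y (ptClk (g Y σ) c) //
    ∀ (Y Z : TimeObj) (σ : X ⟶ Y) (τ : Y ⟶ Z) (c : Y.clocks),
      A.map τ (compClk_map_elt G τ (hg σ τ) rfl) (f Y σ c) = f Z (σ ≫ τ) (τ.1 c) }

theorem AllAlong.heq_iff {A : SemTy (compClk G)} {X : TimeObj}
    {g g' : ∀ Y : TimeObj, (X ⟶ Y) → G.obj Y}
    {hg : ∀ {Y Z : TimeObj} (σ : X ⟶ Y) (τ : Y ⟶ Z), G.map τ (g Y σ) = g Z (σ ≫ τ)}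
    {hg' : ∀ {Y Z : TimeObj} (σ : X ⟶ Y) (τ : Y ⟶ Z), G.map τ (g' Y σ) = g' Z (σ ≫ τ)}
    (e : g = g') (F : AllAlong A X g hg) (F' : AllAlong A X g' hg') :
    HEq F F' ↔ ∀ Y σ c, HEq (F.1 Y σ c) (F'.1 Y σ c) := by
  subst e
  constructor
  · rintro h Y σ c
    rw [eq_of_heq h]
  · intro h
    refine heq_of_eq (Subtype.ext ?_)
    funext Y σ c
    exact eq_of_heq (h Y σ c)

theorem AllElt.obj_subst (A : SemTy (compClk G)) (X : TimeObj) (γ : H.obj X) :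
    AllElt A X (f.app X γ) = AllElt (A.subst (liftClk f)) X γ := by
  have key : ∀ (g : ∀ Y : TimeObj, (X ⟶ Y) → G.obj Y)
      (_ : g = fun Y σ => f.app Y (H.map σ γ))
      (hg : ∀ {Y Z : TimeObj} (σ : X ⟶ Y) (τ : Y ⟶ Z), G.map τ (g Y σ) = g Z (σ ≫ τ)),
      AllAlong A X g hg = AllElt (A.subst (liftClk f)) X γ := by
    rintro g rfl hg
    rfl
  exact key (fun Y σ => G.map σ (f.app X γ)) (funext fun Y => funext fun σ => map_app_eq f σ γ)
    fun σ τ => (map_comp_elt G σ τ _).symm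

/-- Equality of elements of `⟦(∀ κ. A)[f]⟧` and of `⟦∀ κ. A[f]⟧`. -/
theorem AllElt.heq_iff {A : SemTy (compClk G)} {X : TimeObj} {γ : H.obj X}
    (F : AllElt A X (f.app X γ)) (F' : AllElt (A.subst (liftClk f)) X γ) :
    HEq F F' ↔ ∀ (Y : TimeObj) (σ : X ⟶ Y) (γ' : H.obj Y) (h : H.map σ γ = γ')
      (c : Y.clocks), F.fn' σ (app_map_elt f σ h) c = F'.fn' σ h c := by
  have fn_heq : ∀ (Y : TimeObj) (σ : X ⟶ Y) (γ' : G.obj Y) (h : G.map σ (f.app X γ) = γ')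
      (c : Y.clocks), HEq (F.fn' σ h c) (F.1 Y σ c) := by
    rintro Y σ γ' rfl c
    rfl
  refine (AllAlong.heq_iff (g := fun Y σ => G.map σ (f.app X γ))
    (g' := fun Y σ => f.app Y (H.map σ γ)) (hg := fun σ τ => (map_comp_elt G σ τ _).symm)
    (hg' := fun σ τ => app_map_elt f τ (map_comp_elt H σ τ _).symm)
    (funext fun Y => funext fun σ => map_app_eq f σ γ) F F').trans ?_
  constructor
  · rintro h Y σ γ' rfl c
    exact eq_of_heq ((fn_heq Y σ _ _ c).trans (h Y σ c))
  · rintro h Y σ c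
    exact (fn_heq Y σ _ (map_app_eq f σ γ) c).symm.trans (heq_of_eq (h Y σ _ rfl c))

theorem SemTy.all_subst (A : SemTy (compClk G)) :
    A.all.subst f = (A.subst (liftClk f)).all := by
  refine SemTy.ext_heq (fun X γ => AllElt.obj_subst f A X γ) ?_
  intro X Y σ γ γ' h F F' hF
  refine (AllElt.heq_iff f _ _).2 ?_
  intro Z τ γ'' h' c
  refine (AllElt.restr_fn' F σ (app_map_elt f σ h) τ (app_map_elt f τ h')
    (app_map_elt f (σ ≫ τ) ((map_comp_elt' H σ τ h).trans h')) c).trans ?_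
  refine ((AllElt.heq_iff f F F').1 hF Z (σ ≫ τ) γ'' ((map_comp_elt' H σ τ h).trans h') c).trans ?_
  exact (AllElt.restr_fn' F' σ h τ h' _ c).symm

theorem semClam_fn' {A : SemTy (compClk G)} (b : SemTm A) {X Y : TimeObj}
    (γ : G.obj X) (σ : X ⟶ Y) {γ' : G.obj Y} (h : G.map σ γ = γ') (c : Y.clocks) :
    AllElt.fn' ((semClam b).val X γ) σ h c = b.val Y (ptClk γ' c) := by
  subst h; rfl

theorem semClam_subst {A : SemTy (compClk G)} (b : SemTm A) :
    (⟨_, (semClam b).subst f⟩ : Elem H) = ⟨_, semClam (b.subst (liftClk f))⟩ := by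
  refine Elem.ext_heq (SemTy.all_subst f A) fun X γ => (AllElt.heq_iff f _ _).2 ?_
  intro Y σ γ' h c
  exact (semClam_fn' b _ σ (app_map_elt f σ h) c).trans
    (semClam_fn' (b.subst (liftClk f)) γ σ h c).symm

theorem semCapp_subst {A : SemTy (compClk G)} (t : SemTm A.all) (c : ClkSec G) :
    (semCapp t c).subst f
      = semCapp ((t.subst f).cast (SemTy.all_subst f A)) (c.subst f) := by
  refine SemTm.ext (funext fun X => funext fun γ => ?_)
  exact (AllElt.heq_iff f _ _).1 (SemTm.cast_val (SemTy.all_subst f A) (t.subst f) X γ).symm X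
    (𝟙 X) γ (map_id_elt H γ) (c.val X (f.app X γ))

end

/-! ### Later types under reindexing -/

theorem IfSet.heq_iff {p : Prop} [Decidable p] {B B' : p → Type (u + 1)} (e : ∀ h, B h = B' h)
    (x : IfSet p B) (y : IfSet p B') : HEq x y ↔ ∀ h : p, HEq (x.get h) (y.get h) := by
  obtain rfl : B = B' := funext e
  constructor
  · intro h
    simp [eq_of_heq h]
  · intro h
    exact heq_of_eq (IfSet.ext fun h' => eq_of_heq (h h'))

theorem semNext_get {G H : Psh.{u}} (κ : ClkSec G) (D : Delayed κ H) {A : SemTy H} (a : SemTm A)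
    (X : TimeObj) (γ : G.obj X) (h : 0 < X.ticks (κ.val X γ)) :
    IfSet.get ((semNext κ D a).val X γ) h = a.val _ (D.fam X γ h) :=
  IfSet.get_mk _ h

/-- The delayed substitution `D'` is the reindexing of `D` along `f`, as witnessed by the morphism
`g` between the extended contexts. -/
def Delayed.Over {G H K L : Psh.{u}} (f : H ⟶ G) {κ : ClkSec G} (D : Delayed κ K)
    (D' : Delayed (κ.subst f) L) (g : L ⟶ K) : Prop :=
  ∀ (X : TimeObj) (γ : H.obj X) (h : 0 < X.ticks (κ.val X (f.app X γ))),
    g.app _ (D'.fam X γ h) = D.fam X (f.app X γ) h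

section

variable {G H K L : Psh.{u}} {f : H ⟶ G} {κ : ClkSec G} {D : Delayed κ K}
  {D' : Delayed (κ.subst f) L} {g : L ⟶ K}

theorem SemTy.later_heq_iff (hg : D.Over f D' g) {A : SemTy K} {X : TimeObj} {γ : H.obj X}
    (x : (A.later κ D).obj X (f.app X γ)) (y : ((A.subst g).later (κ.subst f) D').obj X γ) :
    HEq x y ↔ ∀ h : 0 < X.ticks (κ.val X (f.app X γ)), HEq (IfSet.get x h) (IfSet.get y h) :=
  IfSet.heq_iff (fun h => congrArg (A.obj _) (hg X γ h).symm) x y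

theorem SemTy.later_subst (hg : D.Over f D' g) (A : SemTy K) :
    (A.later κ D).subst f = (A.subst g).later (κ.subst f) D' := by
  refine SemTy.ext_heq (fun X γ => ?_) ?_
  · exact congrArg (IfSet _) (funext fun h => congrArg (A.obj _) (hg X γ h).symm)
  · intro X Y σ γ γ' e x y hxy
    refine (SemTy.later_heq_iff hg _ _).2 fun h => ?_
    have h0 := pos_of_pos κ σ (app_map_elt f σ e) h
    rw [SemTy.later_map_get (κ.subst f) D' (A.subst g) σ e y h0 h]
    refine (heq_of_eq (SemTy.later_map_get κ D A σ (app_map_elt f σ e) x h0 h)).trans ?_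
    exact A.map_heq _ _ _ (hg X γ h0).symm ((SemTy.later_heq_iff hg x y).1 hxy h0)

theorem semNext_subst (hg : D.Over f D' g) {A : SemTy K} (a : SemTm A) :
    (⟨_, (semNext κ D a).subst f⟩ : Elem H) = ⟨_, semNext (κ.subst f) D' (a.subst g)⟩ := by
  refine Elem.ext_heq (SemTy.later_subst hg A) fun X γ => (SemTy.later_heq_iff hg _ _).2 ?_
  intro h
  refine (heq_of_eq (semNext_get κ D a _ _ h)).trans (HEq.trans ?_
    (heq_of_eq (semNext_get (κ.subst f) D' (a.subst g) X γ h).symm))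
  exact a.val_heq (hg X γ h).symm

theorem Delayed.nil_over (f : H ⟶ G) (κ : ClkSec G) :
    (Delayed.nil κ).Over f (Delayed.nil (κ.subst f)) f :=
  fun _ γ _ => (app_map_elt f _ rfl : G.map _ (f.app _ γ) = _).symm

theorem Delayed.Over.snoc (hg : D.Over f D' g) {A : SemTy K} (t : SemTm (A.later κ D)) :
    (D.snoc t).Over f (D'.snoc ((t.subst f).cast (SemTy.later_subst hg A))) (lift g A) := by
  intro X γ h
  refine pt_ext (hg X γ h) ?_
  exact ((SemTy.later_heq_iff hg _ _).1
    (SemTm.cast_val (SemTy.later_subst hg A) (t.subst f) X γ).symm h).symm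

/-- A delayed substitution restricts, over the base context, to the empty one. -/
theorem Delayed.nil_over_proj (D : Delayed κ K) : (Delayed.nil κ).Over (𝟙 G) D D.proj :=
  D.fam_proj

end

/-! ### Time objects with a fresh clock -/

namespace TimeObj

theorem insert_ticks_self (X : TimeObj) {k : ℕ} (n : ℕ) (hk : k ∉ X.clocks)
    (h : k ∈ (X.insert k n).clocks) : (X.insert k n).ticks ⟨k, h⟩ = n := by
  simp [insert, hk]

theorem insert_ticks_mem (X : TimeObj) (k n : ℕ) {c : ℕ} (hc : c ∈ X.clocks)
    (h : c ∈ (X.insert k n).clocks) : (X.insert k n).ticks ⟨c, h⟩ = X.ticks ⟨c, hc⟩ := by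
  simp [insert, hc]

/-- The new clock of `X.insert k n`. -/
def new (X : TimeObj) (k n : ℕ) : (X.insert k n).clocks := ⟨k, Finset.mem_insert_self _ _⟩

/-- The function on `E ∪ {k}` that is `g` on `E` and has the value `c` at the fresh clock `k`. -/
def descFun {X Y : TimeObj} (k n : ℕ) (g : X.clocks → Y.clocks) (c : Y.clocks)
    (d : (X.insert k n).clocks) : Y.clocks :=
  if h : d.1 ∈ X.clocks then g ⟨d.1, h⟩ else c

theorem descFun_ι {X Y : TimeObj} (k n : ℕ) (g : X.clocks → Y.clocks) (c : Y.clocks)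
    (d : X.clocks) : descFun k n g c ((X.ι k n).1 d) = g d :=
  dif_pos d.2

theorem descFun_new {X Y : TimeObj} {k : ℕ} (hk : k ∉ X.clocks) (n : ℕ) (g : X.clocks → Y.clocks)
    (c : Y.clocks) : descFun k n g c (X.new k n) = c :=
  dif_neg hk

theorem insert_cases {X : TimeObj} {k n : ℕ} {P : (X.insert k n).clocks → Prop}
    (h : ∀ d, P ((X.ι k n).1 d)) (h' : P (X.new k n)) (d) : P d := by
  obtain ⟨d, hd⟩ := d
  rcases Finset.mem_insert.1 hd with rfl | h0
  · exact h'
  · exact h ⟨d, h0⟩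

theorem ticks_ι {X : TimeObj} (k n : ℕ) (d : X.clocks) :
    (X.insert k n).ticks ((X.ι k n).1 d) = X.ticks d :=
  X.insert_ticks_mem k n d.2 _

theorem ticks_new {X : TimeObj} {k : ℕ} (hk : k ∉ X.clocks) (n : ℕ) :
    (X.insert k n).ticks (X.new k n) = n :=
  X.insert_ticks_self n hk _

/-- The universal property of `X.insert k n` as the coproduct of `X` and `({k}, n)`. -/
def desc {X Y : TimeObj} {k n : ℕ} (hk : k ∉ X.clocks) (σ : X ⟶ Y) (c : Y.clocks)
    (hc : Y.ticks c ≤ n) : X.insert k n ⟶ Y :=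
  ⟨descFun k n σ.1 c, insert_cases
    (fun d => by rw [descFun_ι, ticks_ι]; exact σ.2 d)
    (by rw [descFun_new hk, ticks_new hk]; exact hc)⟩

theorem hom_ext {X Y : TimeObj} {σ τ : X ⟶ Y} (h : ∀ d, σ.1 d = τ.1 d) : σ = τ :=
  Subtype.ext (funext h)

theorem ι_desc {X Y : TimeObj} {k n : ℕ} (hk : k ∉ X.clocks) (σ : X ⟶ Y) (c : Y.clocks)
    (hc : Y.ticks c ≤ n) : X.ι k n ≫ desc hk σ c hc = σ :=
  hom_ext fun d => descFun_ι k n σ.1 c d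

theorem desc_new {X Y : TimeObj} {k n : ℕ} (hk : k ∉ X.clocks) (σ : X ⟶ Y) (c : Y.clocks)
    (hc : Y.ticks c ≤ n) : (desc hk σ c hc).1 (X.new k n) = c :=
  descFun_new hk n σ.1 c

theorem insert_hom_ext {X Y : TimeObj} {k n : ℕ} {σ τ : X.insert k n ⟶ Y}
    (h : X.ι k n ≫ σ = X.ι k n ≫ τ) (h' : σ.1 (X.new k n) = τ.1 (X.new k n)) : σ = τ :=
  hom_ext (insert_cases (fun d => congrFun (congrArg Subtype.val h) d) h')

theorem exists_fresh (X : TimeObj) : ∃ k, k ∉ X.clocks := Infinite.exists_notMem_finset _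

theorem tick_ticks_self (X : TimeObj) (c : X.clocks) : (X.tick c).ticks c = X.ticks c - 1 :=
  if_pos rfl

theorem tick_ticks_ne (X : TimeObj) {c d : X.clocks} (h : d ≠ c) :
    (X.tick c).ticks d = X.ticks d :=
  if_neg h

end TimeObj

/-! ### Uniqueness of inverses of `next` over a fresh clock -/

section

open TimeObj

variable {G : Psh.{u}} {A : SemTy (compClk G)}

theorem compClk_ext {X : TimeObj} {p q : (compClk G).obj X}
    (h : (projClk G).app X p = (projClk G).app X q)
    (h' : (lastClk G).val X p = (lastClk G).val X q) :
    p = q :=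
  Prod.ext (α := G.obj X) (β := X.clocks) h h'

/-- The delayed elements `t` determine an element over every point `p`, because `p` is the image of
a point one of whose clocks has just ticked: the clock variable is instantiated by a fresh clock
with one more tick left, which afterwards is identified with the clock of `p`. -/
theorem exists_prev_val (t : SemTm (A.later (lastClk G) (.nil _))) (X : TimeObj)
    (p : (compClk G).obj X) :
    ∃ (X' : TimeObj) (q' : (compClk G).obj X') (h' : 0 < X'.ticks ((lastClk G).val X' q'))
      (s : X'.tick ((lastClk G).val X' q') ⟶ X)
      (e' : (compClk G).map s ((Delayed.nil (lastClk G)).fam X' q' h') = p),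
      ∀ (Y : TimeObj) (q : (compClk G).obj Y) (h : 0 < Y.ticks ((lastClk G).val Y q))
        (σ : Y.tick ((lastClk G).val Y q) ⟶ X)
        (e : (compClk G).map σ ((Delayed.nil (lastClk G)).fam Y q h) = p),
        A.map σ e (IfSet.get (t.val Y q) h) = A.map s e' (IfSet.get (t.val X' q') h') := by
  obtain ⟨k, hk⟩ := X.exists_fresh
  set γ : G.obj X := (projClk G).app X p with hγ
  set c : X.clocks := (lastClk G).val X p with hc
  set X' := X.insert k (X.ticks c + 1) with hX'
  set q' : (compClk G).obj X' := ptClk (G.map (X.ι k _) γ) (X.new k _) with hq'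
  have hq0 : (lastClk G).val X' q' = X.new k _ := rfl
  have hpos : 0 < X'.ticks ((lastClk G).val X' q') := by
    rw [hq0, ticks_new hk]; omega
  -- the identification of the fresh clock with `c`
  let s : X'.tick ((lastClk G).val X' q') ⟶ X := ⟨descFun k (X.ticks c + 1) id c, by
    refine insert_cases (X := X) (n := X.ticks c + 1) (fun d => ?_) ?_
    · rw [descFun_ι, tick_ticks_ne, ticks_ι]
      · rfl
      · intro e
        exact hk (Eq.subst (motive := (· ∈ X.clocks)) (congrArg Subtype.val e) d.2)
    · rw [descFun_new hk, hq0, tick_ticks_self, ticks_new hk]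
      exact le_rfl⟩
  have hs : (compClk G).map s ((Delayed.nil (lastClk G)).fam X' q' hpos) = p := by
    refine compClk_ext ?_ (descFun_new hk _ id c)
    change G.map s (G.map (X'.tickHom _) (G.map (X.ι k _) γ)) = γ
    rw [← map_comp_elt, ← map_comp_elt]
    have : X.ι k _ ≫ X'.tickHom _ ≫ s = 𝟙 X := hom_ext fun d => descFun_ι k _ id c d
    rw [this, map_id_elt]
  have key : ∀ (Y : TimeObj) (q : (compClk G).obj Y)
      (h : 0 < Y.ticks ((lastClk G).val Y q)) (σ : Y.tick ((lastClk G).val Y q) ⟶ X)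
      (e : (compClk G).map σ ((Delayed.nil (lastClk G)).fam Y q h) = p),
      A.map σ e (IfSet.get (t.val Y q) h) = A.map s hs (IfSet.get (t.val X' q') hpos) := by
    intro Y q h σ e
    obtain ⟨m, hm⟩ := Y.exists_fresh
    -- both sides are restrictions of the value of `t` at a point over `Y` with a fresh clock
    let d : Y.clocks := (lastClk G).val Y q
    have e1 : G.map σ (G.map (Y.tickHom d) ((projClk G).app Y q)) = γ :=
      congrArg ((projClk G).app X) e
    have e2 : σ.1 d = c := congrArg ((lastClk G).val X) e
    set Y' := Y.insert m (Y.ticks d) with hY'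
    set r : (compClk G).obj Y' := ptClk (G.map (Y.ι m _) ((projClk G).app Y q)) (Y.new m _)
      with hr
    have hr0 : (lastClk G).val Y' r = Y.new m _ := rfl
    have rpos : 0 < Y'.ticks ((lastClk G).val Y' r) := by
      rw [hr0, ticks_new hm]; exact h
    have hdc : X.ticks c + 1 ≤ Y.ticks d := by
      have : X.ticks (σ.1 d) ≤ (Y.tick d).ticks d := σ.2 d
      have h' : 0 < Y.ticks d := h
      rw [e2, tick_ticks_self] at this
      omega
    let a : Y' ⟶ Y := desc hm (𝟙 Y) d le_rfl
    have hkd : X'.ticks (X.new k _) ≤ Y.ticks d := by rw [ticks_new hk]; exact hdc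
    let b : Y' ⟶ X' := desc hm (Y.tickHom d ≫ σ ≫ X.ι k _) (X.new k _) hkd
    have ha : (compClk G).map a r = q := by
      refine compClk_ext ?_ (desc_new hm (𝟙 Y) d le_rfl)
      change G.map a (G.map (Y.ι m _) _) = _
      rw [← map_comp_elt, ι_desc, map_id_elt]
    have hb : (compClk G).map b r = q' := by
      refine compClk_ext ?_ (desc_new hm _ _ hkd)
      change G.map b (G.map (Y.ι m _) _) = G.map (X.ι k _) γ
      rw [← map_comp_elt, ι_desc, ← e1, map_comp_elt, map_comp_elt]
    have ta := (congrArg (fun x => IfSet.get x h) (t.nat a ha).symm).trans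
      (SemTy.later_map_get (lastClk G) (.nil _) A a ha (t.val Y' r) rpos h)
    have tb := (congrArg (fun x => IfSet.get x hpos) (t.nat b hb).symm).trans
      (SemTy.later_map_get (lastClk G) (.nil _) A b hb (t.val Y' r) rpos hpos)
    have hcomp : tickMap a ((lastClk G).nat a ha) ≫ σ = tickMap b ((lastClk G).nat b hb) ≫ s := by
      refine hom_ext (insert_cases (X := Y) (n := Y.ticks d) (fun y => ?_) ?_)
      · have h1 : a.1 ((Y.ι m (Y.ticks d)).1 y) = y := descFun_ι _ _ _ _ _
        have h2 : b.1 ((Y.ι m (Y.ticks d)).1 y) = (X.ι k (X.ticks c + 1)).1 (σ.1 y) :=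
          descFun_ι _ _ _ _ _
        exact (congrArg σ.1 h1).trans
          ((descFun_ι k (X.ticks c + 1) id c (σ.1 y)).symm.trans (congrArg s.1 h2.symm))
      · have h1 : a.1 (Y.new m (Y.ticks d)) = d := desc_new _ _ _ _
        have h2 : b.1 (Y.new m (Y.ticks d)) = X.new k (X.ticks c + 1) := desc_new hm _ _ hkd
        exact (congrArg σ.1 h1).trans (e2.trans
          ((descFun_new hk (X.ticks c + 1) id c).symm.trans (congrArg s.1 h2.symm)))
    have hpt : (compClk G).map (tickMap a ((lastClk G).nat a ha) ≫ σ)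
        ((Delayed.nil (lastClk G)).fam Y' r rpos) = p :=
      (map_comp_elt' _ _ _ ((Delayed.nil (lastClk G)).fam_nat a ha rpos h)).trans e
    refine (congrArg (A.map σ e) ta).trans (Eq.trans ?_ (congrArg (A.map s hs) tb).symm)
    refine (A.map_comp _ _ _ _ hpt _).symm.trans
      (Eq.trans ?_ (A.map_comp _ _ ((Delayed.nil (lastClk G)).fam_nat b hb rpos hpos) hs
        (hcomp ▸ hpt) _))
    congr 1
  exact ⟨X', q', hpos, s, hs, key⟩

/-- Over a fresh clock `κ`, the operation `next^κ` is a bijection. -/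
theorem existsUnique_prev (t : SemTm (A.later (lastClk G) (.nil _))) :
    ∃! a : SemTm A, semNext (lastClk G) (.nil _) a = t := by
  choose X' q' h' s e' key using exists_prev_val t
  refine ⟨⟨fun X p => A.map (s X p) (e' X p) (IfSet.get (t.val _ (q' X p)) (h' X p)), ?_⟩, ?_, ?_⟩
  · intro X Y τ p p' hp
    rw [← A.map_comp (s X p) τ (e' X p) hp (map_comp_elt' _ _ _ (e' X p) |>.trans hp)]
    exact key Y p' _ _ _ _ _
  · refine SemTm.ext (funext fun X => funext fun p => IfSet.ext fun h => ?_)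
    rw [semNext_get]
    exact (key _ _ X p h (𝟙 _) (map_id_elt _ _)).symm.trans (A.map_id _ _)
  · intro a ha
    refine SemTm.ext (funext fun X => funext fun p => ?_)
    subst ha
    refine (a.nat (s X p) (e' X p)).symm.trans ?_
    exact congrArg (A.map (s X p) (e' X p)) (semNext_get (lastClk G) (.nil _) a _ _ (h' X p)).symm

theorem semPrev_eq_some {t : SemTm (A.later (lastClk G) (.nil _))} {b : SemTm A.all} :
    semPrev t = some b ↔ ∃ a : SemTm A, semNext (lastClk G) (.nil _) a = t ∧ semClam a = b := by
  have h := existsUnique_prev t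
  rw [semPrev, dif_pos h, Option.some_inj]
  constructor
  · intro e
    exact ⟨_, h.choose_spec.1, e⟩
  · rintro ⟨a, ha, rfl⟩
    rw [h.choose_spec.2 a ha]

end

/-! ### Guarded fixed points -/

section

variable {G : Psh.{u}} {κ : ClkSec G} {A : SemTy G}

theorem nil_fam_ticks_lt (κ : ClkSec G) {X : TimeObj} {γ : G.obj X}
    (h : 0 < X.ticks (κ.val X γ)) :
    (X.tick (κ.val X γ)).ticks (κ.val _ ((Delayed.nil κ).fam X γ h)) < X.ticks (κ.val X γ) := by
  have : κ.val _ ((Delayed.nil κ).fam X γ h) = κ.val X γ := (κ.nat (X.tickHom _) rfl).symm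
  rw [this, TimeObj.tick_ticks_self]
  omega

/-- The element of `▷^κ A` given by an element `v` of `A` at the next tick, if there is one. -/
def laterMk {X : TimeObj} {γ : G.obj X} (v : ∀ h : 0 < X.ticks (κ.val X γ),
    A.obj (X.tick (κ.val X γ)) ((Delayed.nil κ).fam X γ h)) : (A.later κ (.nil κ)).obj X γ :=
  IfSet.mk v

/-- The guarded fixed point, by recursion on the number of ticks left. -/
noncomputable def fixVal (t : SemTm (A.subst (proj (A.later κ (.nil κ))))) :
    ∀ p : Σ X : TimeObj, G.obj X, A.obj p.1 p.2 :=
  (measure fun p : Σ X : TimeObj, G.obj X => p.1.ticks (κ.val p.1 p.2)).wf.fix fun p ih =>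
    t.val p.1 (pt p.2 (laterMk fun h =>
      ih ⟨p.1.tick (κ.val p.1 p.2), (Delayed.nil κ).fam p.1 p.2 h⟩ (nil_fam_ticks_lt κ h)))

theorem fixVal_eq (t : SemTm (A.subst (proj (A.later κ (.nil κ))))) (X : TimeObj) (γ : G.obj X) :
    fixVal t ⟨X, γ⟩ = t.val X (pt γ (laterMk fun h =>
      fixVal t ⟨X.tick (κ.val X γ), (Delayed.nil κ).fam X γ h⟩)) :=
  WellFounded.fix_eq _ _ _

/-- A term over `▷^κ A` has a unique guarded fixed point: both existence and uniqueness are by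
induction on the number of ticks left on `κ`. -/
theorem existsUnique_fix (t : SemTm (A.subst (proj (A.later κ (.nil κ))))) :
    ∃! a : SemTm A, a = t.subst (sect (semNext κ (.nil κ) a)) := by
  have hnat : ∀ (n : ℕ) {X Y : TimeObj} (σ : X ⟶ Y) {γ : G.obj X} {γ' : G.obj Y}
      (e : G.map σ γ = γ'), X.ticks (κ.val X γ) < n →
      A.map σ e (fixVal t ⟨X, γ⟩) = fixVal t ⟨Y, γ'⟩ := by
    intro n
    induction n with
    | zero => intro X Y σ γ γ' e h; omega
    | succ n ih =>
      intro X Y σ γ γ' e hn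
      refine (congrArg (A.map σ e) (fixVal_eq t X γ)).trans (Eq.trans ?_ (fixVal_eq t Y γ').symm)
      refine t.nat σ (comp_map_elt _ σ e _ ?_)
      refine IfSet.ext fun h => ?_
      have h0 := pos_of_pos κ σ e h
      refine (SemTy.later_map_get κ (.nil κ) A σ e _ h0 h).trans ?_
      rw [laterMk, laterMk, IfSet.get_mk, IfSet.get_mk]
      exact ih _ ((Delayed.nil κ).fam_nat σ e h0 h) (by have := nil_fam_ticks_lt κ h0; omega)
  refine ⟨⟨fun X γ => fixVal t ⟨X, γ⟩, fun σ _ _ e => hnat _ σ e (Nat.lt_succ_self _)⟩, ?_, ?_⟩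
  · refine SemTm.ext (funext fun X => funext fun γ => ?_)
    exact fixVal_eq t X γ
  · intro a ha
    have : ∀ (n : ℕ) (X : TimeObj) (γ : G.obj X), X.ticks (κ.val X γ) < n →
        a.val X γ = fixVal t ⟨X, γ⟩ := by
      intro n
      induction n with
      | zero => intro X γ h; omega
      | succ n ih =>
        intro X γ hn
        refine (congrArg (fun b : SemTm A => b.val X γ) ha).trans
          (Eq.trans ?_ (fixVal_eq t X γ).symm)
        have hl : (semNext κ (.nil κ) a).val X γ = laterMk fun h =>
            fixVal t ⟨X.tick (κ.val X γ), (Delayed.nil κ).fam X γ h⟩ := by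
          refine IfSet.ext fun h => ?_
          rw [semNext_get, laterMk, IfSet.get_mk]
          exact ih _ _ (by have := nil_fam_ticks_lt κ h; omega)
        rw [← hl]
        rfl
    exact SemTm.ext (funext fun X => funext fun γ => this _ X γ (Nat.lt_succ_self _))

theorem semFix_eq_some {t : SemTm (A.subst (proj (A.later κ (.nil κ))))} {a : SemTm A} :
    semFix κ t = some a ↔ a = t.subst (sect (semNext κ (.nil κ) a)) := by
  have h := existsUnique_fix t
  rw [semFix, dif_pos h, Option.some_inj]
  constructor
  · rintro rfl
    exact h.choose_spec.1
  · intro e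
    exact (h.choose_spec.2 a e).symm

end

/-! ### Environments under reindexing -/

@[simp]
theorem Elem.check_mk {G : Psh.{u}} {A : SemTy G} (a : SemTm A) :
    (⟨A, a⟩ : Elem G).check A = some a :=
  Elem.check_eq_some.2 rfl

theorem Env.clk_eq_some {G : Psh.{u}} {ρ : Env G} {n : ℕ} {c : ClkSec G} :
    ρ.clk n = some c ↔ ρ n = some (.clk c) := by
  unfold Env.clk
  constructor
  · intro h
    split at h
    · rename_i c' h'
      cases h
      exact h'
    · cases h
  · intro h
    rw [h]

theorem Tm.den_var {G : Psh.{u}} {ρ : Env G} {n : ℕ} {e : Elem G} :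
    (Tm.var n).den G ρ = some e ↔ ρ n = some (.tm e.ty e.tm) := by
  unfold Tm.den
  constructor
  · intro h
    split at h
    · rename_i A a h'
      cases h
      exact h'
    · cases h
  · intro h
    rw [h]

theorem Env.clks_subst {G H : Psh.{u}} {η : Env G} {η' : Env H} {f : H ⟶ G} {r : ℕ → ℕ}
    (hr : ∀ n c, η.clk n = some c → η'.clk (r n) = some (c.subst f)) {Δ : Finset ℕ} {K : ClkSet G}
    (h : η.clks Δ = some K) : η'.clks (Δ.image r) = some (K.subst f) := by
  unfold Env.clks at h ⊢
  split_ifs at h with h1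
  have h2 : ∀ κ ∈ Δ.image r, (η'.clk κ).isSome := by
    intro κ hκ
    obtain ⟨n, hn, rfl⟩ := Finset.mem_image.1 hκ
    obtain ⟨c, hc⟩ := Option.isSome_iff_exists.1 (h1 n hn)
    rw [hr n c hc]
    rfl
  rw [if_pos h2]
  simp only [Option.some.injEq] at h ⊢
  subst h
  refine ClkSet.ext ?_
  funext X γ
  ext c
  simp only [ClkSet.subst, Finset.mem_filter, Finset.mem_univ, true_and]
  constructor
  · rintro ⟨κ, hκ, k, hk, rfl⟩
    obtain ⟨n, hn, rfl⟩ := Finset.mem_image.1 hκ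
    obtain ⟨c, hc⟩ := Option.isSome_iff_exists.1 (h1 n hn)
    obtain rfl : c.subst f = k := Option.some_inj.1 ((hr n c hc).symm.trans hk)
    exact ⟨n, hn, c, hc, rfl⟩
  · rintro ⟨n, hn, k, hk, rfl⟩
    exact ⟨r n, Finset.mem_image_of_mem r hn, k.subst f, hr n k hk, rfl⟩

theorem Env.clks_mono {G : Psh.{u}} {η : Env G} {Δ Δ' : Finset ℕ} {K K' : ClkSet G}
    (h : η.clks Δ = some K) (h' : η.clks Δ' = some K') (hΔ : Δ ⊆ Δ') (X : TimeObj)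
    (γ : G.obj X) : K.val X γ ⊆ K'.val X γ := by
  unfold Env.clks at h h'
  split_ifs at h h'
  simp only [Option.some.injEq] at h h'
  subst h h'
  intro c
  simp only [Finset.mem_filter, Finset.mem_univ, true_and]
  rintro ⟨κ, hκ, k, hk, rfl⟩
  exact ⟨κ, hΔ hκ, k, hk, rfl⟩

/-! ### Renamings as substitutions -/

/-- A renaming, as a substitution. -/
def Sb.ofRen (r : ℕ → ℕ) : Sb := ⟨fun n => .var (r n), r⟩

theorem Sb.up_ofRen (r : ℕ → ℕ) : (Sb.ofRen r).up = Sb.ofRen (upR r) := by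
  unfold Sb.up Sb.ofRen
  congr 1
  funext n
  cases n <;> simp [upR, Tm.ren]

theorem Sb.upN_ofRen (r : ℕ → ℕ) (k : ℕ) : (Sb.ofRen r).upN k = Sb.ofRen (upRN r k) := by
  induction k with
  | zero => rfl
  | succ k ih => rw [Sb.upN, ih, Sb.up_ofRen, upRN]

theorem DSub.len_sub (ρ : Sb) : ∀ ξ : DSub, (ξ.sub ρ).len = ξ.len
  | .nil => by simp only [DSub.sub]
  | .snoc ξ A t => by simp only [DSub.sub, DSub.len, DSub.len_sub ρ ξ]

mutual

theorem Ty.ren_eq_sub (r : ℕ → ℕ) : ∀ A : Ty, A.ren r = A.sub (.ofRen r)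
  | .pi A B => by
    simp only [Ty.ren, Ty.sub, Sb.up_ofRen, A.ren_eq_sub r, B.ren_eq_sub (upR r)]
  | .sig A B => by
    simp only [Ty.ren, Ty.sub, Sb.up_ofRen, A.ren_eq_sub r, B.ren_eq_sub (upR r)]
  | .later κ ξ A => by
    simp only [Ty.ren, Ty.sub, Sb.upN_ofRen, ξ.ren_eq_sub r, A.ren_eq_sub (upRN r ξ.len)]
    rfl
  | .all A => by simp only [Ty.ren, Ty.sub, Sb.up_ofRen, A.ren_eq_sub (upR r)]
  | .ident A t s => by
    simp only [Ty.ren, Ty.sub, A.ren_eq_sub r, t.ren_eq_sub r, s.ren_eq_sub r]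
  | .univ Δ => by simp only [Ty.ren, Ty.sub]; rfl
  | .el Δ t => by simp only [Ty.ren, Ty.sub, t.ren_eq_sub r]; rfl

theorem Tm.ren_eq_sub (r : ℕ → ℕ) : ∀ t : Tm, t.ren r = t.sub (.ofRen r)
  | .var n => by simp only [Tm.ren, Tm.sub]; rfl
  | .lam A t => by
    simp only [Tm.ren, Tm.sub, Sb.up_ofRen, A.ren_eq_sub r, t.ren_eq_sub (upR r)]
  | .app A B t u => by
    simp only [Tm.ren, Tm.sub, Sb.up_ofRen, A.ren_eq_sub r, B.ren_eq_sub (upR r),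
      t.ren_eq_sub r, u.ren_eq_sub r]
  | .pair A B t u => by
    simp only [Tm.ren, Tm.sub, Sb.up_ofRen, A.ren_eq_sub r, B.ren_eq_sub (upR r),
      t.ren_eq_sub r, u.ren_eq_sub r]
  | .fst A B t => by
    simp only [Tm.ren, Tm.sub, Sb.up_ofRen, A.ren_eq_sub r, B.ren_eq_sub (upR r), t.ren_eq_sub r]
  | .snd A B t => by
    simp only [Tm.ren, Tm.sub, Sb.up_ofRen, A.ren_eq_sub r, B.ren_eq_sub (upR r), t.ren_eq_sub r]
  | .next κ ξ t => by
    simp only [Tm.ren, Tm.sub, Sb.upN_ofRen, ξ.ren_eq_sub r, t.ren_eq_sub (upRN r ξ.len)]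
    rfl
  | .prev A t => by
    simp only [Tm.ren, Tm.sub, Sb.up_ofRen, A.ren_eq_sub (upR r), t.ren_eq_sub (upR r)]
  | .fix κ A t => by
    simp only [Tm.ren, Tm.sub, Sb.up_ofRen, A.ren_eq_sub r, t.ren_eq_sub (upR r)]
    rfl
  | .clam t => by simp only [Tm.ren, Tm.sub, Sb.up_ofRen, t.ren_eq_sub (upR r)]
  | .capp A t κ => by
    simp only [Tm.ren, Tm.sub, Sb.up_ofRen, A.ren_eq_sub (upR r), t.ren_eq_sub r]
    rfl
  | .refl A t => by simp only [Tm.ren, Tm.sub, A.ren_eq_sub r, t.ren_eq_sub r]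
  | .incl Δ Δ' t => by simp only [Tm.ren, Tm.sub, t.ren_eq_sub r]; rfl

theorem DSub.ren_eq_sub (r : ℕ → ℕ) : ∀ ξ : DSub, ξ.ren r = ξ.sub (.ofRen r)
  | .nil => by simp only [DSub.ren, DSub.sub]
  | .snoc ξ A t => by
    simp only [DSub.ren, DSub.sub, Sb.upN_ofRen, ξ.ren_eq_sub r, A.ren_eq_sub (upRN r ξ.len),
      t.ren_eq_sub r]

end

/-! ### The substitution lemma -/

/-- The square of `g : L ⟶ K` over `f : H ⟶ G` along `p' : L ⟶ H` and `p : K ⟶ G` is a pullback,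
stated on elements. -/
structure IsPbSq {G H K L : Psh.{u}} (g : L ⟶ K) (p' : L ⟶ H) (p : K ⟶ G) (f : H ⟶ G) :
    Prop where
  comm : ∀ (X : TimeObj) (l : L.obj X), p.app X (g.app X l) = f.app X (p'.app X l)
  lift : ∀ (X : TimeObj) (k : K.obj X) (h : H.obj X), p.app X k = f.app X h →
    ∃! l : L.obj X, g.app X l = k ∧ p'.app X l = h

theorem IsPbSq.id {G H : Psh.{u}} (f : H ⟶ G) : IsPbSq f (𝟙 H) (𝟙 G) f where
  comm _ _ := rfl
  lift _ _ h e := ⟨h, ⟨e.symm, rfl⟩, fun _ e' => e'.2⟩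

theorem pt_eta {G : Psh.{u}} {A : SemTy G} {X : TimeObj} (p : (comp G A).obj X) :
    pt (base p) (fib p) = p := rfl

theorem IsPbSq.comp {G H K L : Psh.{u}} {g : L ⟶ K} {p' : L ⟶ H} {p : K ⟶ G} {f : H ⟶ G}
    (h : IsPbSq g p' p f) (A : SemTy K) :
    IsPbSq (GDTT.lift g A) (proj (A.subst g) ≫ p') (proj A ≫ p) f where
  comm X l := h.comm X (base l)
  lift X k y e := by
    obtain ⟨l, ⟨hl, hl'⟩, hu⟩ := h.lift X (base k) y e
    obtain ⟨a, ha⟩ : ∃ a : A.obj X (g.app X l), HEq a (fib k) :=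
      ⟨cast (by rw [hl]) (fib k), cast_heq _ _⟩
    refine ⟨pt (A := A.subst g) l a, ⟨(pt_ext hl ha).trans (pt_eta k), hl'⟩, ?_⟩
    rintro m ⟨hm, hm'⟩
    have hb : base m = l := hu (base m) ⟨congrArg base hm, hm'⟩
    refine (pt_eta m).symm.trans (pt_ext hb ?_)
    refine HEq.trans ?_ ha.symm
    have : ∀ q : (GDTT.comp K A).obj X, q = k → HEq (fib q) (fib k) := by
      rintro q rfl; rfl
    exact this _ hm

/-- A class of substitutions between environments that is closed under extension by variables and
for which the substitution lemma holds at variables. -/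
structure IsSubstClass
    (P : ∀ {G H : Psh.{u}}, Env G → Env H → (H ⟶ G) → Sb → Prop) : Prop where
  clk : ∀ {G H : Psh.{u}} {η : Env G} {η' : Env H} {f : H ⟶ G} {ρ : Sb}, P η η' f ρ →
    ∀ n c, η.clk n = some c → η'.clk (ρ.ck n) = some (c.subst f)
  tm : ∀ {G H : Psh.{u}} {η : Env G} {η' : Env H} {f : H ⟶ G} {ρ : Sb}, P η η' f ρ →
    ∀ n e, (Tm.var n).den G η = some e → (ρ.tm n).den H η' = some (e.subst f)
  up : ∀ {G H : Psh.{u}} {η : Env G} {η' : Env H} {f : H ⟶ G} {ρ : Sb}, P η η' f ρ →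
    ∀ A, P (η.ext A) (η'.ext (A.subst f)) (lift f A) ρ.up
  upClk : ∀ {G H : Psh.{u}} {η : Env G} {η' : Env H} {f : H ⟶ G} {ρ : Sb}, P η η' f ρ →
    P η.extClk η'.extClk (liftClk f) ρ.up

section

variable {P : ∀ {G H : Psh.{u}}, Env G → Env H → (H ⟶ G) → Sb → Prop}

/-- The guarded fixed point commutes with reindexing. -/
theorem semFix_subst {G H : Psh.{u}} (f : H ⟶ G) {κ : ClkSec G} {A : SemTy G}
    {t : SemTm (A.subst (proj (A.later κ (.nil κ))))} {a : SemTm A} (ha : semFix κ t = some a)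
    {L : SemTy H} (hL : (A.later κ (.nil κ)).subst f = L)
    (hL' : L = (A.subst f).later (κ.subst f) (.nil _)) {η : Env H} {s : Tm}
    (hs : s.den _ (η.ext ((A.later κ (.nil κ)).subst f)) = some (Elem.subst ⟨_, t⟩ (lift f _))) :
    ∃ t' : SemTm ((A.subst f).subst (proj ((A.subst f).later (κ.subst f) (.nil _)))),
      s.den _ (η.ext ((A.subst f).later (κ.subst f) (.nil _))) = some ⟨_, t'⟩ ∧
      semFix (κ.subst f) t' = some (a.subst f) := by
  have key : ∀ (L' : SemTy H), (A.later κ (.nil κ)).subst f = L' →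
      ∃ t' : SemTm ((A.subst f).subst (proj L')), s.den _ (η.ext L') = some ⟨_, t'⟩ ∧
      ∀ X γ (l : ((A.later κ (.nil κ)).subst f).obj X γ) (l' : L'.obj X γ), HEq l l' →
        t'.val X (pt γ l') = t.val X (pt (f.app X γ) l) := by
    rintro L' rfl
    refine ⟨_, hs, ?_⟩
    rintro X γ l l' h
    obtain rfl := eq_of_heq h
    rfl
  subst hL
  obtain ⟨t', h1, h2⟩ := key _ hL'
  refine ⟨t', h1, semFix_eq_some.2 ?_⟩
  refine SemTm.ext (funext fun X => funext fun γ => ?_)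
  have e := semFix_eq_some.1 ha
  refine (congrArg (fun b : SemTm A => b.val X (f.app X γ)) e).trans ?_
  exact (h2 X γ _ _ (Elem.val_heq (semNext_subst (Delayed.nil_over f κ) a) X γ)).symm

/-- The term `prev κ. t` commutes with reindexing. -/
theorem semPrev_subst {G H : Psh.{u}} (f : H ⟶ G) {A : SemTy (compClk G)}
    {t : SemTm (A.later (lastClk G) (.nil _))} {b : SemTm A.all} (hb : semPrev t = some b)
    {t' : SemTm ((A.subst (liftClk f)).later (lastClk H) (.nil _))}
    (ht : (⟨_, t'⟩ : Elem (compClk H)) = ⟨_, t.subst (liftClk f)⟩) :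
    ∃ b' : SemTm (A.subst (liftClk f)).all, semPrev t' = some b' ∧
      (⟨_, b'⟩ : Elem H) = ⟨_, b.subst f⟩ := by
  obtain ⟨a, rfl, rfl⟩ := semPrev_eq_some.1 hb
  refine ⟨_, semPrev_eq_some.2 ⟨a.subst (liftClk f), ?_, rfl⟩, (semClam_subst f a).symm⟩
  exact Elem.mk_inj ((semNext_subst (Delayed.nil_over (liftClk f) (lastClk G)) a).symm.trans
    ht.symm)

mutual

/-- The substitution lemma for types. -/
theorem Ty.den_sub_of_class (hP : IsSubstClass.{u} P) {G H : Psh.{u}} {η : Env G} {η' : Env H}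
    {f : H ⟶ G} {ρ : Sb} (hρ : P η η' f ρ) :
    ∀ (A : Ty) {A' : SemTy G}, A.den G η = some A' → (A.sub ρ).den H η' = some (A'.subst f)
  | .pi A B, T, h => by
    simp only [Ty.den, Option.bind_eq_some_iff, Option.some.injEq] at h
    obtain ⟨A', hA, B', hB, rfl⟩ := h
    have h1 := A.den_sub_of_class hP hρ hA
    have h2 := B.den_sub_of_class hP (hP.up hρ A') hB
    simp only [Ty.sub, Ty.den, h1, h2, Option.bind_some, SemTy.pi_subst]
  | .sig A B, T, h => by
    simp only [Ty.den, Option.bind_eq_some_iff, Option.some.injEq] at h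
    obtain ⟨A', hA, B', hB, rfl⟩ := h
    have h1 := A.den_sub_of_class hP hρ hA
    have h2 := B.den_sub_of_class hP (hP.up hρ A') hB
    simp only [Ty.sub, Ty.den, h1, h2, Option.bind_some]
    rfl
  | .later κ ξ A, T, h => by
    simp only [Ty.den, Option.bind_eq_some_iff, Option.some.injEq] at h
    obtain ⟨c, hc, D, hD, A', hA, rfl⟩ := h
    obtain ⟨D', g, h1, h2, h3, -⟩ := ξ.den_sub_of_class hP hρ hD
    have h4 := A.den_sub_of_class hP h2 hA
    simp only [Ty.sub, Ty.den, hP.clk hρ _ _ hc, h1, h4, Option.bind_some, SemTy.later_subst h3]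
  | .all A, T, h => by
    simp only [Ty.den, Option.bind_eq_some_iff, Option.some.injEq] at h
    obtain ⟨A', hA, rfl⟩ := h
    have h1 := A.den_sub_of_class hP (hP.upClk hρ) hA
    simp only [Ty.sub, Ty.den, h1, Option.bind_some, SemTy.all_subst]
  | .ident A t s, T, h => by
    simp only [Ty.den, Option.bind_eq_some_iff, Option.some.injEq, Elem.check_eq_some] at h
    obtain ⟨A', hA, _, ht, t', rfl, _, hs, s', rfl, rfl⟩ := h
    have h1 := A.den_sub_of_class hP hρ hA
    have h2 := t.den_sub_of_class hP hρ ht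
    have h3 := s.den_sub_of_class hP hρ hs
    simp only [Ty.sub, Ty.den, h1, h2, h3, Option.bind_some, Elem.subst, Elem.check_mk]
    rfl
  | .univ Δ, T, h => by
    simp only [Ty.den, Option.bind_eq_some_iff, Option.some.injEq] at h
    obtain ⟨K, hK, rfl⟩ := h
    simp only [Ty.sub, Ty.den, Env.clks_subst (hP.clk hρ) hK, Option.bind_some]
    rfl
  | .el Δ t, T, h => by
    simp only [Ty.den, Option.bind_eq_some_iff, Option.some.injEq, Elem.check_eq_some] at h
    obtain ⟨K, hK, _, ht, t', rfl, rfl⟩ := h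
    have h2 := t.den_sub_of_class hP hρ ht
    rw [Elem.subst, ← Elem.mk_cast (SemTy.univ_subst f K)] at h2
    simp only [Ty.sub, Ty.den, Env.clks_subst (hP.clk hρ) hK, h2, Option.bind_some,
      Elem.check_mk]
    rfl

/-- The substitution lemma for terms. -/
theorem Tm.den_sub_of_class (hP : IsSubstClass.{u} P) {G H : Psh.{u}} {η : Env G} {η' : Env H}
    {f : H ⟶ G} {ρ : Sb} (hρ : P η η' f ρ) :
    ∀ (t : Tm) {e : Elem G}, t.den G η = some e → (t.sub ρ).den H η' = some (e.subst f)
  | .var n, e, h => by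
    simp only [Tm.sub]
    exact hP.tm hρ n e h
  | .lam A t, e, h => by
    simp only [Tm.den, Option.bind_eq_some_iff, Option.some.injEq] at h
    obtain ⟨A', hA, t', ht, rfl⟩ := h
    have h1 := A.den_sub_of_class hP hρ hA
    have h2 := t.den_sub_of_class hP (hP.up hρ A') ht
    simp only [Tm.sub, Tm.den, h1, h2, Option.bind_some]
    exact congrArg some (semLam_subst f t'.tm).symm
  | .app A B t u, e, h => by
    simp only [Tm.den, Option.bind_eq_some_iff, Option.some.injEq, Elem.check_eq_some] at h
    obtain ⟨A', hA, B', hB, _, ht, t', rfl, _, hu, u', rfl, rfl⟩ := h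
    have h1 := A.den_sub_of_class hP hρ hA
    have h2 := B.den_sub_of_class hP (hP.up hρ A') hB
    have h3 := t.den_sub_of_class hP hρ ht
    have h4 := u.den_sub_of_class hP hρ hu
    rw [Elem.subst, ← Elem.mk_cast (SemTy.pi_subst f A' B')] at h3
    simp only [Tm.sub, Tm.den, h1, h2, h3, h4, Option.bind_some, Elem.check_mk, Elem.subst,
      semApp_subst]
    rfl
  | .pair A B t u, e, h => by
    simp only [Tm.den, Option.bind_eq_some_iff, Option.some.injEq, Elem.check_eq_some] at h
    obtain ⟨A', hA, B', hB, _, ht, t', rfl, _, hu, u', rfl, rfl⟩ := h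
    have h1 := A.den_sub_of_class hP hρ hA
    have h2 := B.den_sub_of_class hP (hP.up hρ A') hB
    have h3 := t.den_sub_of_class hP hρ ht
    have h4 := u.den_sub_of_class hP hρ hu
    rw [Elem.subst, ← Elem.mk_cast (SemTy.subst_sect f B' t')] at h4
    simp only [Tm.sub, Tm.den, h1, h2, h3, h4, Option.bind_some, Elem.check_mk, Elem.subst]
    rfl
  | .fst A B t, e, h => by
    simp only [Tm.den, Option.bind_eq_some_iff, Option.some.injEq, Elem.check_eq_some] at h
    obtain ⟨A', hA, B', hB, _, ht, t', rfl, rfl⟩ := h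
    have h1 := A.den_sub_of_class hP hρ hA
    have h2 := B.den_sub_of_class hP (hP.up hρ A') hB
    have h3 := t.den_sub_of_class hP hρ ht
    rw [Elem.subst, ← Elem.mk_cast (SemTy.sig_subst f A' B')] at h3
    simp only [Tm.sub, Tm.den, h1, h2, h3, Option.bind_some, Elem.check_mk]
    rfl
  | .snd A B t, e, h => by
    simp only [Tm.den, Option.bind_eq_some_iff, Option.some.injEq, Elem.check_eq_some] at h
    obtain ⟨A', hA, B', hB, _, ht, t', rfl, rfl⟩ := h
    have h1 := A.den_sub_of_class hP hρ hA
    have h2 := B.den_sub_of_class hP (hP.up hρ A') hB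
    have h3 := t.den_sub_of_class hP hρ ht
    rw [Elem.subst, ← Elem.mk_cast (SemTy.sig_subst f A' B')] at h3
    simp only [Tm.sub, Tm.den, h1, h2, h3, Option.bind_some, Elem.check_mk]
    rfl
  | .next κ ξ t, e, h => by
    simp only [Tm.den, Option.bind_eq_some_iff, Option.some.injEq] at h
    obtain ⟨c, hc, D, hD, t', ht, rfl⟩ := h
    obtain ⟨D', g, h1, h2, h3, -⟩ := ξ.den_sub_of_class hP hρ hD
    have h4 := t.den_sub_of_class hP h2 ht
    simp only [Tm.sub, Tm.den, hP.clk hρ _ _ hc, h1, h4, Option.bind_some]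
    exact congrArg some (semNext_subst h3 t'.tm).symm
  | .prev A t, e, h => by
    simp only [Tm.den, Option.bind_eq_some_iff, Option.some.injEq, Elem.check_eq_some] at h
    obtain ⟨A', hA, _, ht, t', rfl, a, ha, rfl⟩ := h
    have h1 := A.den_sub_of_class hP (hP.upClk hρ) hA
    have h2 := t.den_sub_of_class hP (hP.upClk hρ) ht
    have e0 : (A'.later (lastClk G) (.nil _)).subst (liftClk f)
        = (A'.subst (liftClk f)).later (lastClk H) (.nil _) :=
      SemTy.later_subst (Delayed.nil_over (liftClk f) (lastClk G)) A'
    have e1 := Elem.mk_cast e0 (t'.subst (liftClk f))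
    rw [Elem.subst, ← e1] at h2
    obtain ⟨b, hb, hb'⟩ := semPrev_subst f ha e1
    simp only [Tm.sub, Tm.den, h1, h2, Option.bind_some, Elem.subst, Elem.check_mk, hb, hb']
  | .fix κ A t, e, h => by
    simp only [Tm.den, Option.bind_eq_some_iff, Option.some.injEq, Elem.check_eq_some] at h
    obtain ⟨c, hc, A', hA, _, ht, t', rfl, a, ha, rfl⟩ := h
    have h1 := A.den_sub_of_class hP hρ hA
    have h2 := t.den_sub_of_class hP (hP.up hρ _) ht
    obtain ⟨t'', ht'', h3⟩ := semFix_subst f ha rfl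
      (SemTy.later_subst (Delayed.nil_over f c) A') h2
    simp only [Tm.sub, Tm.den, hP.clk hρ _ _ hc, h1, ht'', Option.bind_some, Elem.check_mk, h3,
      Elem.subst]
  | .clam t, e, h => by
    simp only [Tm.den, Option.bind_eq_some_iff, Option.some.injEq] at h
    obtain ⟨t', ht, rfl⟩ := h
    have h1 := t.den_sub_of_class hP (hP.upClk hρ) ht
    simp only [Tm.sub, Tm.den, h1, Option.bind_some]
    exact congrArg some (semClam_subst f t'.tm).symm
  | .capp A t κ, e, h => by
    simp only [Tm.den, Option.bind_eq_some_iff, Option.some.injEq, Elem.check_eq_some] at h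
    obtain ⟨A', hA, _, ht, t', rfl, c, hc, rfl⟩ := h
    have h1 := A.den_sub_of_class hP (hP.upClk hρ) hA
    have h2 := t.den_sub_of_class hP hρ ht
    rw [Elem.subst, ← Elem.mk_cast (SemTy.all_subst f A')] at h2
    simp only [Tm.sub, Tm.den, h1, h2, hP.clk hρ _ _ hc, Option.bind_some, Elem.check_mk,
      Elem.subst, semCapp_subst]
    rfl
  | .refl A t, e, h => by
    simp only [Tm.den, Option.bind_eq_some_iff, Option.some.injEq, Elem.check_eq_some] at h
    obtain ⟨A', hA, _, ht, t', rfl, rfl⟩ := h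
    have h1 := A.den_sub_of_class hP hρ hA
    have h2 := t.den_sub_of_class hP hρ ht
    simp only [Tm.sub, Tm.den, h1, h2, Option.bind_some, Elem.check_mk, Elem.subst]
    rfl
  | .incl Δ Δ' t, e, h => by
    simp only [Tm.den, Option.bind_eq_some_iff, Elem.check_eq_some] at h
    obtain ⟨K, hK, K', hK', _, ht, t', rfl, h⟩ := h
    split_ifs at h with hKK
    obtain rfl := Option.some_inj.1 h
    have h2 := t.den_sub_of_class hP hρ ht
    rw [Elem.subst, ← Elem.mk_cast (SemTy.univ_subst f K)] at h2
    simp only [Tm.sub, Tm.den, Env.clks_subst (hP.clk hρ) hK, Env.clks_subst (hP.clk hρ) hK', h2,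
      Option.bind_some, Elem.check_mk]
    exact dif_pos fun X γ => hKK X (f.app X γ)

/-- The substitution lemma for delayed substitutions. -/
theorem DSub.den_sub_of_class (hP : IsSubstClass.{u} P) {G H : Psh.{u}} {η : Env G} {η' : Env H}
    {f : H ⟶ G} {ρ : Sb} (hρ : P η η' f ρ) :
    ∀ (ξ : DSub) {κ : ClkSec G} {D : DInterp κ}, ξ.den G η κ = some D →
      ∃ (D' : DInterp (κ.subst f)) (g : D'.tot ⟶ D.tot),
        (ξ.sub ρ).den H η' (κ.subst f) = some D' ∧ P D.env D'.env g (ρ.upN ξ.len) ∧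
        D.fam.Over f D'.fam g ∧ IsPbSq g D'.fam.proj D.fam.proj f
  | .nil, κ, D, h => by
    simp only [DSub.den, Option.some.injEq] at h
    subst h
    exact ⟨⟨H, η', .nil _⟩, f, by simp only [DSub.sub, DSub.den], hρ, Delayed.nil_over f κ,
      IsPbSq.id f⟩
  | .snoc ξ A t, κ, D, h => by
    simp only [DSub.den, Option.bind_eq_some_iff, Option.some.injEq, Elem.check_eq_some] at h
    obtain ⟨D, hD, A', hA, _, ht, t', rfl, rfl⟩ := h
    obtain ⟨D', g, h1, h2, h3, h4⟩ := ξ.den_sub_of_class hP hρ hD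
    have h5 := A.den_sub_of_class hP h2 hA
    have h6 := t.den_sub_of_class hP hρ ht
    rw [Elem.subst, ← Elem.mk_cast (SemTy.later_subst h3 A')] at h6
    refine ⟨⟨comp D'.tot (A'.subst g), D'.env.ext (A'.subst g),
      D'.fam.snoc ((t'.subst f).cast (SemTy.later_subst h3 A'))⟩, lift g A', ?_, hP.up h2 A',
      h3.snoc t', h4.comp A'⟩
    simp only [DSub.sub, DSub.den, h1, h5, h6, Option.bind_some, Elem.check_mk]

end

end

/-! ### Renaming and substitution -/

theorem Entry.subst_id {G : Psh.{u}} (e : Entry G) : e.subst (𝟙 G) = e := by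
  cases e <;> rfl

theorem Entry.subst_comp {G H K : Psh.{u}} (e : Entry G) (f : H ⟶ G) (g : K ⟶ H) :
    e.subst (g ≫ f) = (e.subst f).subst g := by
  cases e <;> rfl

theorem Env.subst_eq_clk {G H : Psh.{u}} {η : Env G} {f : H ⟶ G} {n : ℕ} {c : ClkSec H}
    (h : η.subst f n = some (.clk c)) : ∃ c', η.clk n = some c' ∧ c = c'.subst f := by
  obtain ⟨e, he, he'⟩ := Option.map_eq_some_iff.1 h
  cases e with
  | clk c' =>
    cases he'
    exact ⟨c', Env.clk_eq_some.2 he, rfl⟩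
  | tm A a => cases he'

theorem Env.subst_eq_tm {G H : Psh.{u}} {η : Env G} {f : H ⟶ G} {n : ℕ} {e : Elem H}
    (h : η.subst f n = some (.tm e.ty e.tm)) :
    ∃ e', (Tm.var n).den G η = some e' ∧ e = e'.subst f := by
  obtain ⟨e', he, he'⟩ := Option.map_eq_some_iff.1 h
  cases e' with
  | clk c' => cases he'
  | tm A a =>
    obtain ⟨B, b⟩ := e
    cases he'
    exact ⟨⟨A, a⟩, Tm.den_var.2 he, rfl⟩

/-- The environment `η'` over `f` contains the entries of `η` at the places given by the
renaming `r`. -/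
def RenRel {G H : Psh.{u}} (η : Env G) (η' : Env H) (f : H ⟶ G) (r : ℕ → ℕ) : Prop :=
  ∀ n e, η n = some e → η' (r n) = some (e.subst f)

section

variable {G H : Psh.{u}} {η : Env G} {η' : Env H} {f : H ⟶ G} {r : ℕ → ℕ}

theorem RenRel.comp {K : Psh.{u}} {η'' : Env K} {g : K ⟶ H} {r' : ℕ → ℕ}
    (h : RenRel η η' f r) (h' : RenRel η' η'' g r') :
    RenRel η η'' (g ≫ f) (fun n => r' (r n)) := fun n e he => by
  rw [Entry.subst_comp]
  exact h' _ _ (h n e he)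

theorem RenRel.ext (h : RenRel η η' f r) (A : SemTy G) :
    RenRel (η.ext A) (η'.ext (A.subst f)) (lift f A) (upR r)
  | 0, e, he => by
    cases he
    rfl
  | n + 1, e, he => by
    obtain ⟨e', he', rfl⟩ := Option.map_eq_some_iff.1 he
    refine (congrArg (Option.map (Entry.subst (proj (A.subst f)))) (h n e' he')).trans ?_
    cases e' <;> rfl

theorem RenRel.extClk (h : RenRel η η' f r) :
    RenRel η.extClk η'.extClk (liftClk f) (upR r)
  | 0, e, he => by
    cases he
    rfl
  | n + 1, e, he => by
    obtain ⟨e', he', rfl⟩ := Option.map_eq_some_iff.1 he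
    refine (congrArg (Option.map (Entry.subst (projClk H))) (h n e' he')).trans ?_
    cases e' <;> rfl

theorem RenRel.proj (η : Env G) (A : SemTy G) : RenRel η (η.ext A) (GDTT.proj A) (· + 1) :=
  fun n _ he => congrArg (Option.map (Entry.subst (GDTT.proj A))) (show η n = _ from he)

theorem RenRel.projClk (η : Env G) : RenRel η η.extClk (GDTT.projClk G) (· + 1) :=
  fun n _ he => congrArg (Option.map (Entry.subst (GDTT.projClk G))) (show η n = _ from he)

theorem RenRel.clk (h : RenRel η η' f r) (n : ℕ) (c : ClkSec G) (hc : η.clk n = some c) :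
    η'.clk (r n) = some (c.subst f) :=
  Env.clk_eq_some.2 (h n _ (Env.clk_eq_some.1 hc))

end

/-- Renamings, seen as substitutions, satisfy the assumptions of the substitution lemma.  The
case of substitutions depends on this one, as they are weakened when they pass under a binder. -/
theorem isSubstClass_ren : IsSubstClass.{u}
    (fun η η' f ρ => ∃ r, ρ = Sb.ofRen r ∧ RenRel η η' f r) where
  clk := by
    rintro G H η η' f _ ⟨r, rfl, h⟩ n c hc
    exact h.clk n c hc
  tm := by
    rintro G H η η' f _ ⟨r, rfl, h⟩ n e he
    exact Tm.den_var.2 (h n _ (Tm.den_var.1 he))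
  up := by
    rintro G H η η' f _ ⟨r, rfl, h⟩ A
    exact ⟨_, Sb.up_ofRen r, h.ext A⟩
  upClk := by
    rintro G H η η' f _ ⟨r, rfl, h⟩
    exact ⟨_, Sb.up_ofRen r, h.extClk⟩

section

variable {G H : Psh.{u}} {η : Env G} {η' : Env H} {f : H ⟶ G} {r : ℕ → ℕ}

theorem Ty.den_ren (h : RenRel η η' f r) {A : Ty} {T : SemTy G} (hA : A.den G η = some T) :
    (A.ren r).den H η' = some (T.subst f) := by
  rw [Ty.ren_eq_sub]
  exact A.den_sub_of_class isSubstClass_ren ⟨r, rfl, h⟩ hA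

theorem Tm.den_ren (h : RenRel η η' f r) {t : Tm} {e : Elem G} (ht : t.den G η = some e) :
    (t.ren r).den H η' = some (e.subst f) := by
  rw [Tm.ren_eq_sub]
  exact t.den_sub_of_class isSubstClass_ren ⟨r, rfl, h⟩ ht

theorem DSub.den_ren (h : RenRel η η' f r) {ξ : DSub} {κ : ClkSec G} {D : DInterp κ}
    (hξ : ξ.den G η κ = some D) :
    ∃ (D' : DInterp (κ.subst f)) (g : D'.tot ⟶ D.tot),
      (ξ.ren r).den H η' (κ.subst f) = some D' ∧ RenRel D.env D'.env g (upRN r ξ.len) ∧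
      D.fam.Over f D'.fam g ∧ IsPbSq g D'.fam.proj D.fam.proj f := by
  rw [DSub.ren_eq_sub]
  obtain ⟨D', g, h1, ⟨r', h2, h3⟩, h4⟩ := ξ.den_sub_of_class isSubstClass_ren ⟨r, rfl, h⟩ hξ
  rw [Sb.upN_ofRen] at h2
  obtain rfl : upRN r ξ.len = r' := congrArg Sb.ck h2
  exact ⟨D', g, h1, h3, h4⟩

end

/-- The environment `η'` over `f` interprets the terms and clocks of the substitution `ρ` by the
entries of `η`. -/
structure SubRel {G H : Psh.{u}} (η : Env G) (η' : Env H) (f : H ⟶ G) (ρ : Sb) : Prop where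
  clk : ∀ n c, η.clk n = some c → η'.clk (ρ.ck n) = some (c.subst f)
  tm : ∀ n e, (Tm.var n).den G η = some e → (ρ.tm n).den H η' = some (e.subst f)

theorem isSubstClass_subRel : IsSubstClass.{u} SubRel where
  clk h := h.clk
  tm h := h.tm
  up {G H η η' f ρ} h A :=
    { clk := by
        rintro (_ | n) c hc
        · cases hc
        · obtain ⟨c, hc', rfl⟩ := Env.subst_eq_clk (η := η) (n := n) (Env.clk_eq_some.1 hc)
          exact (RenRel.proj η' (A.subst f)).clk _ _ (h.clk n _ hc')
      tm := by
        rintro (_ | n) ⟨B, b⟩ he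
        · cases Tm.den_var.1 he
          rfl
        · obtain ⟨e, he', he''⟩ := Env.subst_eq_tm (η := η) (n := n) (Tm.den_var.1 he)
          rw [he'']
          exact Tm.den_ren (RenRel.proj η' (A.subst f)) (h.tm n e he') }
  upClk {G H η η' f ρ} h :=
    { clk := by
        rintro (_ | n) c hc
        · cases hc
          rfl
        · obtain ⟨c, hc', rfl⟩ := Env.subst_eq_clk (η := η) (n := n) (Env.clk_eq_some.1 hc)
          exact (RenRel.projClk η').clk _ _ (h.clk n _ hc')
      tm := by
        rintro (_ | n) ⟨B, b⟩ he
        · cases Tm.den_var.1 he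
        · obtain ⟨e, he', he''⟩ := Env.subst_eq_tm (η := η) (n := n) (Tm.den_var.1 he)
          rw [he'']
          exact Tm.den_ren (RenRel.projClk η') (h.tm n e he') }

section

variable {G : Psh.{u}} {η : Env G}

theorem SubRel.single {A : SemTy G} {a : SemTm A} {u : Tm} (hu : u.den G η = some ⟨A, a⟩) :
    SubRel (η.ext A) η (sect a) (.single u) where
  clk := by
    rintro (_ | n) c hc
    · cases hc
    · obtain ⟨c, hc', rfl⟩ := Env.subst_eq_clk (η := η) (n := n) (Env.clk_eq_some.1 hc)
      exact hc'
  tm := by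
    rintro (_ | n) ⟨B, b⟩ he
    · cases Tm.den_var.1 he
      exact hu
    · obtain ⟨e, he', he''⟩ := Env.subst_eq_tm (η := η) (n := n) (Tm.den_var.1 he)
      rw [he'']
      exact he'

theorem SubRel.singleClk {c : ClkSec G} {κ : ℕ} (hc : η.clk κ = some c) :
    SubRel η.extClk η (sectClk c) (.singleClk κ) where
  clk := by
    rintro (_ | n) c' h
    · cases h
      exact hc
    · obtain ⟨c', h', rfl⟩ := Env.subst_eq_clk (η := η) (n := n) (Env.clk_eq_some.1 h)
      exact h'
  tm := by
    rintro (_ | n) ⟨B, b⟩ he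
    · cases Tm.den_var.1 he
    · obtain ⟨e, he', he''⟩ := Env.subst_eq_tm (η := η) (n := n) (Tm.den_var.1 he)
      rw [he'']
      exact he'

theorem Ty.den_inst {A : SemTy G} {a : SemTm A} {u : Tm} (hu : u.den G η = some ⟨A, a⟩)
    {B : Ty} {B' : SemTy (comp G A)} (hB : B.den _ (η.ext A) = some B') :
    (B.inst u).den G η = some (B'.subst (sect a)) :=
  B.den_sub_of_class isSubstClass_subRel (SubRel.single hu) hB

theorem Tm.den_inst {A : SemTy G} {a : SemTm A} {u : Tm} (hu : u.den G η = some ⟨A, a⟩)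
    {t : Tm} {e : Elem (comp G A)} (ht : t.den _ (η.ext A) = some e) :
    (t.inst u).den G η = some (e.subst (sect a)) :=
  t.den_sub_of_class isSubstClass_subRel (SubRel.single hu) ht

theorem Ty.den_instClk {c : ClkSec G} {κ : ℕ} (hc : η.clk κ = some c)
    {A : Ty} {A' : SemTy (compClk G)} (hA : A.den _ η.extClk = some A') :
    (A.instClk κ).den G η = some (A'.subst (sectClk c)) :=
  A.den_sub_of_class isSubstClass_subRel (SubRel.singleClk hc) hA

theorem Tm.den_instClk {c : ClkSec G} {κ : ℕ} (hc : η.clk κ = some c)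
    {t : Tm} {e : Elem (compClk G)} (ht : t.den _ η.extClk = some e) :
    (t.instClk κ).den G η = some (e.subst (sectClk c)) :=
  t.den_sub_of_class isSubstClass_subRel (SubRel.singleClk hc) ht

theorem Ty.den_wk {A : Ty} {T : SemTy G} (hA : A.den G η = some T) (B : SemTy G) :
    A.wk.den _ (η.ext B) = some (T.subst (proj B)) :=
  Ty.den_ren (RenRel.proj η B) hA

theorem Tm.den_wk {t : Tm} {e : Elem G} (ht : t.den G η = some e) (B : SemTy G) :
    t.wk.den _ (η.ext B) = some (e.subst (proj B)) :=
  Tm.den_ren (RenRel.proj η B) ht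

theorem Ty.den_wkClk {A : Ty} {T : SemTy G} (hA : A.den G η = some T) :
    A.wk.den _ η.extClk = some (T.subst (projClk G)) :=
  Ty.den_ren (RenRel.projClk η) hA

theorem Tm.den_wkClk {t : Tm} {e : Elem G} (ht : t.den G η = some e) :
    t.wk.den _ η.extClk = some (e.subst (projClk G)) :=
  Tm.den_ren (RenRel.projClk η) ht

end

/-! ### Invariance under clock introduction, fibrewise -/

open TimeObj in
/-- A bijection that preserves the number of ticks is an isomorphism of time objects. -/
theorem TimeObj.exists_inverse {X Y : TimeObj} (σ : X ⟶ Y) (hσ : Function.Bijective σ.1)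
    (ht : ∀ c, Y.ticks (σ.1 c) = X.ticks c) : ∃ τ : Y ⟶ X, σ ≫ τ = 𝟙 X ∧ τ ≫ σ = 𝟙 Y := by
  obtain ⟨g, hg, hg'⟩ := Function.bijective_iff_has_inverse.1 hσ
  refine ⟨⟨g, fun c => ?_⟩, hom_ext hg, hom_ext hg'⟩
  rw [← ht, hg' c]

/-- A morphism that introduces a clock: up to isomorphism, an inclusion `X.ι k n`. -/
structure IsIntro {X Y : TimeObj} (σ : X ⟶ Y) : Prop where
  inj : Function.Injective σ.1
  ticks : ∀ c, Y.ticks (σ.1 c) = X.ticks c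
  new : ∃ d : Y.clocks, (∀ c, σ.1 c ≠ d) ∧ ∀ e, e ≠ d → ∃ c, σ.1 c = e

theorem ι_isIntro (X : TimeObj) {k : ℕ} (n : ℕ) (hk : k ∉ X.clocks) : IsIntro (X.ι k n) where
  inj _ _ h := Subtype.ext (congrArg (fun e : (X.insert k n).clocks => e.1) h)
  ticks := TimeObj.ticks_ι k n
  new := by
    refine ⟨X.new k n, fun c h => hk ?_, TimeObj.insert_cases (fun d _ => ⟨d, rfl⟩)
      fun h => absurd rfl h⟩
    exact Eq.subst (motive := (· ∈ X.clocks)) (congrArg Subtype.val h) c.2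

theorem IsIntro.tickMap {X Y : TimeObj} {σ : X ⟶ Y} (h : IsIntro σ) {c : X.clocks}
    {c' : Y.clocks} (hc : σ.1 c = c') : IsIntro (TimeObj.tickMap σ hc) where
  inj := h.inj
  ticks := by
    subst hc
    intro (d : X.clocks)
    change (if σ.1 d = σ.1 c then _ else _) = if d = c then _ else _
    by_cases hd : d = c
    · rw [if_pos (congrArg σ.1 hd), if_pos hd, h.ticks]
    · rw [if_neg fun e => hd (h.inj e), if_neg hd]
      exact h.ticks d
  new := h.new

/-- The restriction maps of `A` along clock introductions are bijective. -/
def SemTy.Inv {G : Psh.{u}} (A : SemTy G) : Prop :=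
  ∀ (X : TimeObj) (k n : ℕ), k ∉ X.clocks → ∀ {γ : G.obj X} {γ' : G.obj (X.insert k n)}
    (h : G.map (X.ι k n) γ = γ'), Function.Bijective (A.map (X.ι k n) h)

theorem SemTy.map_bijective_of_inverse {G : Psh.{u}} (A : SemTy G) {X Y : TimeObj} {σ : X ⟶ Y}
    {τ : Y ⟶ X} (h₁ : σ ≫ τ = 𝟙 X) (h₂ : τ ≫ σ = 𝟙 Y) {γ : G.obj X} {γ' : G.obj Y}
    (h : G.map σ γ = γ') : Function.Bijective (A.map σ h) := by
  have h' : G.map τ γ' = γ := by rw [← h, ← map_comp_elt, h₁, map_id_elt]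
  have aux : ∀ {X : TimeObj} (f : X ⟶ X) (γ : G.obj X) (hf : G.map f γ = γ) (_ : f = 𝟙 X)
      (a : A.obj X γ), A.map f hf a = a := by
    rintro X f γ hf rfl a
    exact A.map_id _ a
  refine Function.bijective_iff_has_inverse.2 ⟨A.map τ h', fun a => ?_, fun a => ?_⟩
  · rw [← A.map_comp σ τ h h' (by rw [h₁, map_id_elt])]
    exact aux _ _ _ h₁ a
  · rw [← A.map_comp τ σ h' h (by rw [h₂, map_id_elt])]
    exact aux _ _ _ h₂ a

open TimeObj in
/-- For an invariant type, restriction along any clock introduction is bijective, not only along the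
inclusions `X.ι k n`. -/
theorem SemTy.Inv.bijective {G : Psh.{u}} {A : SemTy G} (hA : A.Inv) {X Y : TimeObj} {σ : X ⟶ Y}
    (hσ : IsIntro σ) {γ : G.obj X} {γ' : G.obj Y} (h : G.map σ γ = γ') :
    Function.Bijective (A.map σ h) := by
  obtain ⟨k, hk⟩ := X.exists_fresh
  obtain ⟨d, hd, hd'⟩ := hσ.new
  set e : X.insert k (Y.ticks d) ⟶ Y := desc hk σ d le_rfl with he
  have e1 : ∀ c, e.1 ((X.ι k _).1 c) = σ.1 c := fun c => descFun_ι _ _ _ _ _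
  have e2 : e.1 (X.new k _) = d := desc_new _ _ _ _
  obtain ⟨τ, h1, h2⟩ : ∃ τ : Y ⟶ X.insert k (Y.ticks d), e ≫ τ = 𝟙 _ ∧ τ ≫ e = 𝟙 Y := by
    refine exists_inverse e ⟨?_, ?_⟩ ?_
    · refine insert_cases (fun c => insert_cases (fun c' hc => ?_) fun hc => ?_)
        (insert_cases (fun c' hc => ?_) fun hc => rfl)
      · rw [e1, e1] at hc
        rw [hσ.inj hc]
      · rw [e1, e2] at hc
        exact absurd hc (hd c)
      · rw [e1, e2] at hc
        exact absurd hc.symm (hd c')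
    · intro y
      by_cases hy : y = d
      · exact ⟨X.new k _, e2.trans hy.symm⟩
      · obtain ⟨c, hc⟩ := hd' y hy
        exact ⟨(X.ι k _).1 c, (e1 c).trans hc⟩
    · exact insert_cases (fun c => by rw [e1, ticks_ι, hσ.ticks]) (by rw [e2, ticks_new hk])
  have hι : X.ι k _ ≫ e = σ := ι_desc hk σ d le_rfl
  clear_value e
  subst hι
  have h3 : G.map e (G.map (X.ι k _) γ) = γ' := by rw [← map_comp_elt, h]
  have : A.map (X.ι k _ ≫ e) h = A.map e h3 ∘ A.map (X.ι k _) rfl :=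
    funext fun a => A.map_comp _ _ _ _ _ a
  rw [this]
  exact (A.map_bijective_of_inverse h1 h2 h3).comp (hA X k _ hk rfl)

theorem SemTy.Inv.ident {G : Psh.{u}} {A : SemTy G} (hA : A.Inv) (t s : SemTm A) :
    (SemTy.ident t s).Inv := by
  intro X k n hk γ γ' h
  constructor
  · intro _ _ _
    exact Subsingleton.elim (α := Truth _) _ _
  · intro e
    refine ⟨⟨⟨(hA X k n hk h).1 ?_⟩⟩, Subsingleton.elim (α := Truth _) _ _⟩
    rw [t.nat, s.nat]
    exact e.down.down

theorem SemTy.Inv.sig {G : Psh.{u}} {A : SemTy G} {B : SemTy (comp G A)} (hA : A.Inv)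
    (hB : B.Inv) : (A.sig B).Inv := by
  intro X k n hk γ γ' h
  constructor
  · rintro ⟨a, b⟩ ⟨a', b'⟩ e
    obtain ⟨e1, e2⟩ := Sigma.mk.inj_iff.1 e
    obtain rfl : a = a' := (hA X k n hk h).1 e1
    obtain rfl : b = b' := (hB X k n hk (comp_map_elt A (X.ι k n) h a rfl)).1 (eq_of_heq e2)
    rfl
  · rintro ⟨a', b'⟩
    obtain ⟨a, rfl⟩ := (hA X k n hk h).2 a'
    obtain ⟨b, rfl⟩ := (hB X k n hk (comp_map_elt A (X.ι k n) h a rfl)).2 b'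
    exact ⟨⟨a, b⟩, rfl⟩

theorem SemTy.Inv.later {G H : Psh.{u}} {A : SemTy H} (hA : A.Inv) (κ : ClkSec G)
    (D : Delayed κ H) : (A.later κ D).Inv := by
  intro X k n hk γ γ' h
  have hι := ι_isIntro X n hk
  have hpos : 0 < X.ticks (κ.val X γ) ↔ 0 < (X.insert k n).ticks (κ.val _ γ') := by
    rw [← κ.nat _ h, TimeObj.ticks_ι]
  have bij := fun h0 h1 => hA.bijective (hι.tickMap (κ.nat _ h)) (D.fam_nat (X.ι k n) h h0 h1)
  constructor
  · intro a b e
    refine IfSet.ext fun h0 => (bij h0 (hpos.1 h0)).1 ?_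
    rw [← SemTy.later_map_get κ D A (X.ι k n) h a h0 (hpos.1 h0),
      ← SemTy.later_map_get κ D A (X.ι k n) h b h0 (hpos.1 h0), e]
  · intro b
    choose v hv using fun h0 => (bij h0 (hpos.1 h0)).2 (IfSet.get b (hpos.1 h0))
    refine ⟨IfSet.mk v, IfSet.ext fun h1 => ?_⟩
    refine (SemTy.later_map_get κ D A (X.ι k n) h _ (hpos.2 h1) h1).trans ?_
    rw [IfSet.get_mk, hv]

theorem SmallFam.precomp_bijective {Z Z' : TimeObj} {f : Z ⟶ Z'} {g : Z' ⟶ Z}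
    (h₁ : f ≫ g = 𝟙 Z) (h₂ : g ≫ f = 𝟙 Z') :
    Function.Bijective fun F : SmallFam.{u} Z => F.precomp f := by
  refine Function.bijective_iff_has_inverse.2 ⟨fun F => F.precomp g, fun F => ?_, fun F => ?_⟩
  · change F.precomp (f ≫ g) = F
    rw [h₁]; rfl
  · change F.precomp (g ≫ f) = F
    rw [h₂]; rfl

theorem SemTy.inv_univ {G : Psh.{u}} (K : ClkSet G) : (SemTy.univ K).Inv := by
  intro X k n hk γ γ' h
  have hι := ι_isIntro X n hk
  have hinj : Function.Injective (TimeObj.cores (X.ι k n) (K.mem (X.ι k n) h)).1 := fun _ _ e =>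
    Subtype.ext (congrArg (fun d : ((X.insert k n).restrict (K.val _ γ')).clocks => d.1) e)
  have hsurj : Function.Surjective (TimeObj.cores (X.ι k n) (K.mem (X.ι k n) h)).1 := by
    rintro ⟨d, hd⟩
    obtain ⟨d, hd', rfl⟩ := Finset.mem_map.1 hd
    rw [← K.nat (X.ι k n) h] at hd'
    obtain ⟨c, hc, rfl⟩ := Finset.mem_image.1 hd'
    exact ⟨⟨c.1, Finset.mem_map_of_mem (Function.Embedding.subtype _) hc⟩, rfl⟩
  obtain ⟨τ, h1, h2⟩ := TimeObj.exists_inverse _ ⟨hinj, hsurj⟩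
    fun c => hι.ticks (((X.restrictι (K.val X γ)).1 c))
  exact SmallFam.precomp_bijective h1 h2

theorem SemTy.inv_elts {G : Psh.{u}} (K : ClkSet G) : (SemTy.elts K).Inv := by
  intro X k n hk p p' h
  subst h
  have := (fib p).inv (X.restrictι (K.val X (base p))) k n hk
  constructor
  · rintro ⟨a⟩ ⟨b⟩ e
    exact congrArg ULift.up (this.1 (ULift.up_injective e))
  · rintro ⟨b⟩
    obtain ⟨a, rfl⟩ := this.2 b
    exact ⟨⟨a⟩, rfl⟩

theorem SemTy.Inv.subst {G H : Psh.{u}} {A : SemTy G} (hA : A.Inv) (f : H ⟶ G) :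
    (A.subst f).Inv := fun X k n hk _ _ h => hA X k n hk (app_map_elt f _ h)

/-- The extension of `σ : X ⟶ Y` by a fresh clock on both sides. -/
def TimeObj.insertMap {X Y : TimeObj} {k m : ℕ} (n : ℕ) (hk : k ∉ X.clocks) (hm : m ∉ Y.clocks)
    (σ : X ⟶ Y) : X.insert k n ⟶ Y.insert m n :=
  desc hk (σ ≫ Y.ι m n) (Y.new m n) (ticks_new hm n).le

theorem TimeObj.insertMap_desc {X Y Z : TimeObj} {k m n : ℕ} (hk : k ∉ X.clocks)
    (hm : m ∉ Y.clocks) {σ : X ⟶ Y} {τ : Y ⟶ Z} {ρ : X.insert k n ⟶ Z}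
    (e : X.ι k n ≫ ρ = σ ≫ τ) (hc : Z.ticks (ρ.1 (X.new k n)) ≤ n) :
    insertMap n hk hm σ ≫ desc hm τ (ρ.1 (X.new k n)) hc = ρ := by
  refine insert_hom_ext ?_ ?_
  · rw [e, ← Category.assoc, insertMap, ι_desc, Category.assoc, ι_desc]
  · have h1 : (insertMap n hk hm σ).1 (X.new k n) = Y.new m n := desc_new _ _ _ _
    exact (congrArg (desc hm τ (ρ.1 (X.new k n)) hc).1 h1).trans (desc_new hm τ _ hc)

/-- Only the codomain matters: the value at `σ : X ⟶ Y` of the extension of an element over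
`X.insert k n` is determined by the value at the morphism `σ` extended by a fresh clock, because
the restriction along `Y.ι` is bijective. -/
theorem SemTy.Inv.pi {G : Psh.{u}} (A : SemTy G) {B : SemTy (comp G A)} (hB : B.Inv) :
    (A.pi B).Inv := by
  intro X k n hk γ γ' h
  have hgood : ∀ (F : PiElt A B (X.insert k n) γ') (Y : TimeObj) (σ : X ⟶ Y) (δ : G.obj Y)
      (_ : G.map σ γ = δ) (a : A.obj Y δ), ∃! v : B.obj Y (pt δ a),
      ∀ (Z : TimeObj) (τ : Y ⟶ Z) (ρ : X.insert k n ⟶ Z) (_ : X.ι k n ≫ ρ = σ ≫ τ)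
        (ε : G.obj Z) (hτ : G.map τ δ = ε) (hρ : G.map ρ γ' = ε) (b : A.obj Z ε)
        (hb : A.map τ hτ a = b), B.map τ (comp_map_elt A τ hτ a hb) v = F.fn' ρ hρ b := by
    intro F Y σ δ hδ a
    obtain ⟨m, hm⟩ := Y.exists_fresh
    let s := TimeObj.insertMap n hk hm σ
    have hs : X.ι k n ≫ s = σ ≫ Y.ι m n := TimeObj.ι_desc _ _ _ _
    have hsγ : G.map s γ' = G.map (Y.ι m n) δ := by
      rw [← h, ← map_comp_elt, hs, map_comp_elt, hδ]
    have bij := hB Y m n hm (comp_map_elt A (Y.ι m n) rfl a rfl)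
    obtain ⟨v, hv⟩ := bij.2 (F.fn' s hsγ (A.map (Y.ι m n) rfl a))
    refine ⟨v, ?_, fun w hw => bij.1 ((hw _ _ s hs _ rfl hsγ _ rfl).trans hv.symm)⟩
    intro Z τ ρ e ε hτ hρ b hb
    have hc : Z.ticks (ρ.1 (X.new k n)) ≤ n := (ρ.2 _).trans (TimeObj.ticks_new hk n).le
    let r := TimeObj.desc hm τ (ρ.1 (X.new k n)) hc
    have hr : Y.ι m n ≫ r = τ := TimeObj.ι_desc _ _ _ _
    have hsr : s ≫ r = ρ := TimeObj.insertMap_desc hk hm e hc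
    clear_value r s
    subst hr hsr
    have h1 : G.map r (G.map (Y.ι m n) δ) = ε := by rw [← map_comp_elt, hτ]
    have h2 : A.map r h1 (A.map (Y.ι m n) rfl a) = b := by rw [← A.map_comp _ _ _ _ hτ, hb]
    rw [B.map_comp (Y.ι m n) r (comp_map_elt A (Y.ι m n) rfl a rfl) (comp_map_elt A r h1 _ h2),
      hv]
    exact F.nat' s r hsγ h1 hρ _ h2
  have hrestr : ∀ (f : PiElt A B X γ) (Y : TimeObj) (σ : X ⟶ Y) (δ : G.obj Y)
      (hδ : G.map σ γ = δ) (a : A.obj Y δ) (Z : TimeObj) (τ : Y ⟶ Z) (ρ : X.insert k n ⟶ Z)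
      (_ : X.ι k n ≫ ρ = σ ≫ τ) (ε : G.obj Z) (hτ : G.map τ δ = ε) (hρ : G.map ρ γ' = ε)
      (b : A.obj Z ε) (hb : A.map τ hτ a = b),
      B.map τ (comp_map_elt A τ hτ a hb) (f.fn' σ hδ a) = (f.restr (X.ι k n) h).fn' ρ hρ b := by
    intro f Y σ δ hδ a Z τ ρ e ε hτ hρ b hb
    have h2 : G.map (σ ≫ τ) γ = ε := by rw [map_comp_elt, hδ, hτ]
    rw [f.nat' σ τ hδ hτ h2 a hb, f.restr_fn' _ h ρ hρ (e ▸ h2)]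
    congr 1
    exact e.symm
  constructor
  · intro f f' e
    refine Subtype.ext ?_
    funext Y σ a
    obtain ⟨v, -, hv⟩ := hgood (f.restr (X.ι k n) h) Y σ _ rfl a
    refine (hv _ (hrestr f Y σ _ rfl a)).trans (hv _ ?_).symm
    change f.restr (X.ι k n) h = f'.restr (X.ι k n) h at e
    rw [e]
    exact hrestr f' Y σ _ rfl a
  · intro F
    choose v hv hu using hgood F
    refine ⟨⟨fun Y σ a => v Y σ _ rfl a, ?_⟩, Subtype.ext ?_⟩
    · intro Y Z σ τ a
      refine hu Z (σ ≫ τ) _ rfl _ _ ?_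
      intro W υ ρ e ε hτ hρ b hb
      have h1 : G.map τ (G.map σ γ) = G.map (σ ≫ τ) γ := (map_comp_elt G σ τ γ).symm
      have h2 : G.map (τ ≫ υ) (G.map σ γ) = ε := by rw [map_comp_elt, h1, hτ]
      have h3 : A.map (τ ≫ υ) h2 a = b := by rw [A.map_comp τ υ h1 hτ h2, hb]
      rw [← B.map_comp τ υ (comp_map_elt A τ h1 a rfl) (comp_map_elt A υ hτ _ hb)
        (comp_map_elt A (τ ≫ υ) h2 a h3)]
      exact hv Y σ _ rfl a W (τ ≫ υ) ρ (e.trans (Category.assoc σ τ υ)) ε h2 hρ b h3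
    · funext Y σ a
      have key : ∀ (f : PiElt A B X γ) (_ : f.1 = fun Y σ a => v Y σ _ rfl a) (Y : TimeObj)
          (σ : X ⟶ Y) (δ : G.obj Y) (hδ : G.map σ γ = δ) (a : A.obj Y δ),
          f.fn' σ hδ a = v Y σ δ hδ a := by
        rintro ⟨f, hf⟩ rfl Y σ δ rfl a
        rfl
      refine (key _ rfl Y (X.ι k n ≫ σ) _ (map_comp_elt' G _ σ h) a).trans ?_
      have h1 := hv Y (X.ι k n ≫ σ) _ (map_comp_elt' G _ σ h) a Y (𝟙 Y) σ
        (Category.comp_id _).symm _ (map_id_elt G _) rfl a (A.map_id _ a)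
      rw [B.map_id] at h1
      exact h1

/-- As for dependent products. -/
theorem SemTy.Inv.all {G : Psh.{u}} {A : SemTy (compClk G)} (hA : A.Inv) : A.all.Inv := by
  intro X k n hk γ γ' h
  have hgood : ∀ (F : AllElt A (X.insert k n) γ') (Y : TimeObj) (σ : X ⟶ Y) (δ : G.obj Y)
      (_ : G.map σ γ = δ) (a : Y.clocks), ∃! v : A.obj Y (ptClk δ a),
      ∀ (Z : TimeObj) (τ : Y ⟶ Z) (ρ : X.insert k n ⟶ Z) (_ : X.ι k n ≫ ρ = σ ≫ τ)
        (ε : G.obj Z) (hτ : G.map τ δ = ε) (hρ : G.map ρ γ' = ε) (b : Z.clocks)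
        (hb : τ.1 a = b), A.map τ (compClk_map_elt G τ hτ hb) v = F.fn' ρ hρ b := by
    intro F Y σ δ hδ a
    obtain ⟨m, hm⟩ := Y.exists_fresh
    let s := TimeObj.insertMap n hk hm σ
    have hs : X.ι k n ≫ s = σ ≫ Y.ι m n := TimeObj.ι_desc _ _ _ _
    have hsγ : G.map s γ' = G.map (Y.ι m n) δ := by
      rw [← h, ← map_comp_elt, hs, map_comp_elt, hδ]
    have bij := hA Y m n hm (compClk_map_elt G (Y.ι m n) (γ := δ) rfl (c := a) rfl)
    obtain ⟨v, hv⟩ := bij.2 (F.fn' s hsγ ((Y.ι m n).1 a))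
    refine ⟨v, ?_, fun w hw => bij.1 ((hw _ _ s hs _ rfl hsγ _ rfl).trans hv.symm)⟩
    intro Z τ ρ e ε hτ hρ b hb
    have hc : Z.ticks (ρ.1 (X.new k n)) ≤ n := (ρ.2 _).trans (TimeObj.ticks_new hk n).le
    let r := TimeObj.desc hm τ (ρ.1 (X.new k n)) hc
    have hr : Y.ι m n ≫ r = τ := TimeObj.ι_desc _ _ _ _
    have hsr : s ≫ r = ρ := TimeObj.insertMap_desc hk hm e hc
    clear_value r s
    subst hr hsr
    have h1 : G.map r (G.map (Y.ι m n) δ) = ε := by rw [← map_comp_elt, hτ]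
    rw [A.map_comp (Y.ι m n) r (compClk_map_elt G (Y.ι m n) rfl rfl)
      (compClk_map_elt G r h1 hb), hv]
    exact F.nat' s r hsγ h1 hρ _ hb
  have hrestr : ∀ (f : AllElt A X γ) (Y : TimeObj) (σ : X ⟶ Y) (δ : G.obj Y)
      (hδ : G.map σ γ = δ) (a : Y.clocks) (Z : TimeObj) (τ : Y ⟶ Z) (ρ : X.insert k n ⟶ Z)
      (_ : X.ι k n ≫ ρ = σ ≫ τ) (ε : G.obj Z) (hτ : G.map τ δ = ε) (hρ : G.map ρ γ' = ε)
      (b : Z.clocks) (hb : τ.1 a = b),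
      A.map τ (compClk_map_elt G τ hτ hb) (f.fn' σ hδ a) = (f.restr (X.ι k n) h).fn' ρ hρ b := by
    intro f Y σ δ hδ a Z τ ρ e ε hτ hρ b hb
    have h2 : G.map (σ ≫ τ) γ = ε := by rw [map_comp_elt, hδ, hτ]
    rw [f.nat' σ τ hδ hτ h2 a hb, f.restr_fn' _ h ρ hρ (e ▸ h2)]
    congr 1
    exact e.symm
  constructor
  · intro f f' e
    refine Subtype.ext ?_
    funext Y σ a
    obtain ⟨v, -, hv⟩ := hgood (f.restr (X.ι k n) h) Y σ _ rfl a
    refine (hv _ (hrestr f Y σ _ rfl a)).trans (hv _ ?_).symm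
    change f.restr (X.ι k n) h = f'.restr (X.ι k n) h at e
    rw [e]
    exact hrestr f' Y σ _ rfl a
  · intro F
    choose v hv hu using hgood F
    refine ⟨⟨fun Y σ a => v Y σ _ rfl a, ?_⟩, Subtype.ext ?_⟩
    · intro Y Z σ τ a
      refine hu Z (σ ≫ τ) _ rfl _ _ ?_
      intro W υ ρ e ε hτ hρ b hb
      have h1 : G.map τ (G.map σ γ) = G.map (σ ≫ τ) γ := (map_comp_elt G σ τ γ).symm
      have h2 : G.map (τ ≫ υ) (G.map σ γ) = ε := by rw [map_comp_elt, h1, hτ]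
      rw [← A.map_comp τ υ (compClk_map_elt G τ h1 rfl) (compClk_map_elt G υ hτ hb)
        (compClk_map_elt G (τ ≫ υ) h2 hb)]
      exact hv Y σ _ rfl a W (τ ≫ υ) ρ (e.trans (Category.assoc σ τ υ)) ε h2 hρ b hb
    · funext Y σ a
      have key : ∀ (f : AllElt A X γ) (_ : f.1 = fun Y σ a => v Y σ _ rfl a) (Y : TimeObj)
          (σ : X ⟶ Y) (δ : G.obj Y) (hδ : G.map σ γ = δ) (a : Y.clocks),
          f.fn' σ hδ a = v Y σ δ hδ a := by
        rintro ⟨f, hf⟩ rfl Y σ δ rfl a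
        rfl
      refine (key _ rfl Y (X.ι k n ≫ σ) _ (map_comp_elt' G _ σ h) a).trans ?_
      have h1 := hv Y (X.ι k n ≫ σ) _ (map_comp_elt' G _ σ h) a Y (𝟙 Y) σ
        (Category.comp_id _).symm _ (map_id_elt G _) rfl a rfl
      rw [A.map_id] at h1
      exact h1

/-- Every type that has an interpretation is invariant under clock introduction. -/
theorem Ty.inv_of_den {G : Psh.{u}} {η : Env G} :
    ∀ (A : Ty) {T : SemTy G}, A.den G η = some T → T.Inv
  | .pi A B, T, h => by
    simp only [Ty.den, Option.bind_eq_some_iff, Option.some.injEq] at h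
    obtain ⟨A', hA, B', hB, rfl⟩ := h
    exact .pi A' (B.inv_of_den hB)
  | .sig A B, T, h => by
    simp only [Ty.den, Option.bind_eq_some_iff, Option.some.injEq] at h
    obtain ⟨A', hA, B', hB, rfl⟩ := h
    exact (A.inv_of_den hA).sig (B.inv_of_den hB)
  | .later κ ξ A, T, h => by
    simp only [Ty.den, Option.bind_eq_some_iff, Option.some.injEq] at h
    obtain ⟨c, hc, D, hD, A', hA, rfl⟩ := h
    exact (A.inv_of_den hA).later c D.fam
  | .all A, T, h => by
    simp only [Ty.den, Option.bind_eq_some_iff, Option.some.injEq] at h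
    obtain ⟨A', hA, rfl⟩ := h
    exact (A.inv_of_den hA).all
  | .ident A t s, T, h => by
    simp only [Ty.den, Option.bind_eq_some_iff, Option.some.injEq] at h
    obtain ⟨A', hA, _, -, t', -, _, -, s', -, rfl⟩ := h
    exact (A.inv_of_den hA).ident t' s'
  | .univ Δ, T, h => by
    simp only [Ty.den, Option.bind_eq_some_iff, Option.some.injEq] at h
    obtain ⟨K, -, rfl⟩ := h
    exact SemTy.inv_univ K
  | .el Δ t, T, h => by
    simp only [Ty.den, Option.bind_eq_some_iff, Option.some.injEq] at h
    obtain ⟨K, -, _, -, t', -, rfl⟩ := h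
    exact (SemTy.inv_elts K).subst _

/-- Clock irrelevance: an element of `∀ κ. A`, where `κ` does not occur in `A`, has the same value
at all clocks, because it is determined by its value at a fresh clock. -/
theorem AllElt.irrel {G : Psh.{u}} {A : SemTy G} (hA : A.Inv) {X : TimeObj} {γ : G.obj X}
    (f : AllElt (A.subst (projClk G)) X γ) (h : G.map (𝟙 X) γ = γ) (c c' : X.clocks) :
    (f.fn' (𝟙 X) h c : A.obj X γ) = f.fn' (𝟙 X) h c' := by
  obtain ⟨k, hk⟩ := X.exists_fresh
  set n := max (X.ticks c) (X.ticks c')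
  obtain ⟨a, ha⟩ := (hA X k n hk (γ := γ) rfl).2 (f.fn' (X.ι k n) rfl (X.new k n))
  have key : ∀ d : X.clocks, X.ticks d ≤ n → f.fn' (𝟙 X) h d = a := by
    intro d hd
    let r := TimeObj.desc hk (𝟙 X) d hd
    have hr : X.ι k n ≫ r = 𝟙 X := TimeObj.ι_desc _ _ _ _
    have hrγ : G.map r (G.map (X.ι k n) γ) = γ := by rw [← map_comp_elt, hr, map_id_elt]
    have h1 := f.nat' (X.ι k n) r rfl hrγ (hr ▸ h) (X.new k n) (d := d)
      (TimeObj.desc_new hk (𝟙 X) d hd)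
    have h2 : A.map r hrγ (A.map (X.ι k n) rfl a) = a := by
      rw [← A.map_comp (X.ι k n) r rfl hrγ (hr ▸ h)]
      have aux : ∀ (s : X ⟶ X) (hs : G.map s γ = γ) (_ : s = 𝟙 X), A.map s hs a = a := by
        rintro s hs rfl
        exact A.map_id _ a
      exact aux _ _ hr
    rw [ha] at h2
    have h3 : f.fn' (X.ι k n ≫ r) (hr ▸ h) d = a := h1.symm.trans h2
    have aux : ∀ (s : X ⟶ X) (hs : G.map s γ = γ) (_ : s = 𝟙 X),
        f.fn' s hs d = f.fn' (𝟙 X) h d := by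
      rintro s hs rfl
      rfl
    exact (aux _ _ hr).symm.trans h3
  exact (key c (le_max_left _ _)).trans (key c' (le_max_right _ _)).symm

/-! ### Orthogonality -/

theorem SemTy.Inv.existsUnique_comp {G : Psh.{u}} {T : SemTy G} (hT : T.Inv) {X : TimeObj}
    {k : ℕ} (n : ℕ) (hk : k ∉ X.clocks) (γ : G.obj X) (q : (comp G T).obj (X.insert k n))
    (hq : base q = G.map (X.ι k n) γ) :
    ∃! l : (comp G T).obj X, base l = γ ∧ (comp G T).map (X.ι k n) l = q := by
  obtain ⟨δ, b⟩ := q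
  change δ = _ at hq
  subst hq
  obtain ⟨a, ha, hu⟩ := (hT X k n hk (γ := γ) rfl).existsUnique b
  refine ⟨pt γ a, ⟨rfl, comp_map_elt T (X.ι k n) rfl a ha⟩, ?_⟩
  rintro ⟨γ', a'⟩ ⟨h1, h2⟩
  change γ' = γ at h1
  subst h1
  refine congrArg (pt γ') (hu a' ?_)
  exact eq_of_heq (Sigma.mk.inj_iff.1 h2).2

/-- The element `(y, s)` of a product with a representable presheaf. -/
def pairYo {Y : Psh.{u}} {S X : TimeObj} (y : Y.obj X) (s : S ⟶ X) :
    (Y ⊗ yo.{u} S).obj X :=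
  ((y, ULift.up s) : Y.obj X × ULift.{u + 1} (S ⟶ X))

theorem map_pairYo {Y : Psh.{u}} {S X X' : TimeObj} (σ : X ⟶ X') (y : Y.obj X) (s : S ⟶ X) :
    (Y ⊗ yo.{u} S).map σ (pairYo y s) = pairYo (Y.map σ y) (s ≫ σ) := rfl

theorem exists_pairYo {Y : Psh.{u}} {S X : TimeObj} (p : (Y ⊗ yo.{u} S).obj X) :
    ∃ (y : Y.obj X) (s : S ⟶ X), p = pairYo y s :=
  ⟨Prod.fst (α := Y.obj X) (β := ULift.{u + 1} (S ⟶ X)) p,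
    (Prod.snd (α := Y.obj X) (β := ULift.{u + 1} (S ⟶ X)) p).down, rfl⟩

theorem psh_hom_ext {Y A : Psh.{u}} {f g : Y ⟶ A} (h : ∀ X y, f.app X y = g.app X y) : f = g :=
  NatTrans.ext (funext fun X => fun_ext_elt (h X))

/-- The clock of `({k}, n)`. -/
def TimeObj.pt (k n : ℕ) : (TimeObj.single k n).clocks := ⟨k, Finset.mem_singleton_self k⟩

theorem TimeObj.single_hom_ext {k n : ℕ} {X : TimeObj} {s t : TimeObj.single k n ⟶ X}
    (h : s.1 (TimeObj.pt k n) = t.1 (TimeObj.pt k n)) : s = t := by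
  refine hom_ext ?_
  rintro ⟨c, hc⟩
  obtain rfl := Finset.mem_singleton.1 hc
  exact h

/-- The coproduct of `X` and `({k}, n)` is `X.insert m n` for any fresh clock `m`, so fibrewise
bijectivity of the restriction maps along these inclusions gives orthogonality. -/
theorem SemTy.Inv.invariantUnderClockIntro {G : Psh.{u}} {T : SemTy G} (hT : T.Inv) :
    InvariantUnderClockIntro (proj T) := by
  intro k n Y f g hfg
  have hbase : ∀ (X : TimeObj) (y : Y.obj X) (s : TimeObj.single k n ⟶ X),
      base (f.app X (pairYo y s)) = g.app X y := fun X y s =>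
    congrArg (fun φ : Y ⊗ yo.{u} (TimeObj.single k n) ⟶ G => φ.app X (pairYo y s)) hfg
  have key : ∀ (X : TimeObj) (y : Y.obj X), ∃! l : (comp G T).obj X, base l = g.app X y ∧
      ∀ (Z : TimeObj) (τ : X ⟶ Z) (s : TimeObj.single k n ⟶ Z),
        (comp G T).map τ l = f.app Z (pairYo (Y.map τ y) s) := by
    intro X y
    obtain ⟨m, hm⟩ := X.exists_fresh
    let s₀ : TimeObj.single k n ⟶ X.insert m n :=
      ⟨fun _ => X.new m n, fun _ => (TimeObj.ticks_new hm n).le⟩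
    obtain ⟨l, ⟨h1, h2⟩, hu⟩ := hT.existsUnique_comp n hm (g.app X y)
      (f.app _ (pairYo (Y.map (X.ι m n) y) s₀))
      ((hbase _ _ _).trans (app_map_elt g (X.ι m n) rfl).symm)
    refine ⟨l, ⟨h1, ?_⟩, fun l' hl' => hu l' ⟨hl'.1, hl'.2 _ _ _⟩⟩
    intro Z τ s
    have hc : Z.ticks (s.1 (TimeObj.pt k n)) ≤ n := s.2 _
    let r := TimeObj.desc hm τ (s.1 (TimeObj.pt k n)) hc
    have hr : X.ι m n ≫ r = τ := TimeObj.ι_desc _ _ _ _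
    have hs : s₀ ≫ r = s := TimeObj.single_hom_ext (TimeObj.desc_new hm τ _ hc)
    rw [← hr, map_comp_elt, h2, map_comp_elt, ← hs]
    exact app_map_elt f r (map_pairYo _ _ _)
  choose l hl hu using key
  refine ⟨{ app := fun X => TypeCat.ofHom (l X), naturality := ?_ }, ⟨?_, ?_⟩, ?_⟩
  · intro X X' σ
    refine fun_ext_elt fun y => (hu X' (Y.map σ y) _ ⟨?_, ?_⟩).symm
    · have := (hl X y).1
      exact (congrArg (G.map σ) this).trans (app_map_elt g σ rfl)
    · intro Z τ s
      refine (map_comp_elt (comp G T) σ τ _).symm.trans (((hl X y).2 Z (σ ≫ τ) s).trans ?_)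
      rw [map_comp_elt]
  · refine psh_hom_ext fun X p => ?_
    obtain ⟨y, s, rfl⟩ := exists_pairYo p
    have := (hl X y).2 X (𝟙 X) s
    rw [map_id_elt, map_id_elt] at this
    exact this
  · exact psh_hom_ext fun X y => (hl X y).1
  · rintro h ⟨h1, h2⟩
    refine psh_hom_ext fun X y => hu X y _ ⟨?_, ?_⟩
    · exact congrArg (fun φ : Y ⟶ G => φ.app X y) h2
    · intro Z τ s
      rw [app_map_elt h τ rfl]
      exact congrArg (fun φ : Y ⊗ yo.{u} (TimeObj.single k n) ⟶ comp G T =>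
        φ.app Z (pairYo (Y.map τ y) s)) h1

/-! ### Unfolding the interpretation -/

section

variable {G : Psh.{u}} {η : Env G}

theorem Ty.den_pi {A B : Ty} {T : SemTy G} : (Ty.pi A B).den G η = some T ↔
    ∃ A', A.den G η = some A' ∧ ∃ B', B.den _ (η.ext A') = some B' ∧ A'.pi B' = T := by
  simp only [Ty.den, Option.bind_eq_some_iff, Option.some.injEq]

theorem Ty.den_sig {A B : Ty} {T : SemTy G} : (Ty.sig A B).den G η = some T ↔
    ∃ A', A.den G η = some A' ∧ ∃ B', B.den _ (η.ext A') = some B' ∧ A'.sig B' = T := by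
  simp only [Ty.den, Option.bind_eq_some_iff, Option.some.injEq]

theorem Ty.den_later {κ : ℕ} {ξ : DSub} {A : Ty} {T : SemTy G} :
    (Ty.later κ ξ A).den G η = some T ↔ ∃ c, η.clk κ = some c ∧ ∃ D, ξ.den G η c = some D ∧
      ∃ A', A.den D.tot D.env = some A' ∧ A'.later c D.fam = T := by
  simp only [Ty.den, Option.bind_eq_some_iff, Option.some.injEq]

theorem Ty.den_later_nil {κ : ℕ} {A : Ty} {T : SemTy G} :
    (Ty.later κ .nil A).den G η = some T ↔ ∃ c, η.clk κ = some c ∧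
      ∃ A', A.den G η = some A' ∧ A'.later c (.nil c) = T := by
  simp [Ty.den, DSub.den, Option.bind_eq_some_iff]

theorem Ty.den_all {A : Ty} {T : SemTy G} : (Ty.all A).den G η = some T ↔
    ∃ A', A.den _ η.extClk = some A' ∧ A'.all = T := by
  simp only [Ty.den, Option.bind_eq_some_iff, Option.some.injEq]

theorem Ty.den_ident {A : Ty} {t s : Tm} {T : SemTy G} : (Ty.ident A t s).den G η = some T ↔
    ∃ A', A.den G η = some A' ∧ ∃ t', t.den G η = some ⟨A', t'⟩ ∧
      ∃ s', s.den G η = some ⟨A', s'⟩ ∧ SemTy.ident t' s' = T := by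
  simp only [Ty.den, Option.bind_eq_some_iff, Option.some.injEq, Elem.check_eq_some]
  constructor
  · rintro ⟨A', hA, _, ht, t', rfl, _, hs, s', rfl, h⟩
    exact ⟨A', hA, t', ht, s', hs, h⟩
  · rintro ⟨A', hA, t', ht, s', hs, h⟩
    exact ⟨A', hA, _, ht, t', rfl, _, hs, s', rfl, h⟩

theorem Ty.den_univ {Δ : Finset ℕ} {T : SemTy G} : (Ty.univ Δ).den G η = some T ↔
    ∃ K, η.clks Δ = some K ∧ SemTy.univ K = T := by
  simp only [Ty.den, Option.bind_eq_some_iff, Option.some.injEq]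

theorem DSub.den_snoc {ξ : DSub} {A : Ty} {t : Tm} {c : ClkSec G} {E : DInterp c} :
    (DSub.snoc ξ A t).den G η c = some E ↔ ∃ D, ξ.den G η c = some D ∧
      ∃ A', A.den D.tot D.env = some A' ∧ ∃ t', t.den G η = some ⟨A'.later c D.fam, t'⟩ ∧
        ⟨comp D.tot A', D.env.ext A', D.fam.snoc t'⟩ = E := by
  simp only [DSub.den, Option.bind_eq_some_iff, Option.some.injEq, Elem.check_eq_some]
  constructor
  · rintro ⟨D, hD, A', hA, _, ht, t', rfl, h⟩
    exact ⟨D, hD, A', hA, t', ht, h⟩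
  · rintro ⟨D, hD, A', hA, t', ht, h⟩
    exact ⟨D, hD, A', hA, _, ht, t', rfl, h⟩

theorem Tm.den_lam {A : Ty} {t : Tm} {A' : SemTy G} (hA : A.den G η = some A')
    {B' : SemTy (comp G A')} {b : SemTm B'} (ht : t.den _ (η.ext A') = some ⟨B', b⟩) :
    (Tm.lam A t).den G η = some ⟨A'.pi B', semLam b⟩ := by
  simp only [Tm.den, hA, ht, Option.bind_some]

theorem Tm.den_app {A B : Ty} {t u : Tm} {A' : SemTy G} (hA : A.den G η = some A')
    {B' : SemTy (comp G A')} (hB : B.den _ (η.ext A') = some B') {t' : SemTm (A'.pi B')}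
    (ht : t.den G η = some ⟨_, t'⟩) {u' : SemTm A'} (hu : u.den G η = some ⟨_, u'⟩) :
    (Tm.app A B t u).den G η = some ⟨B'.subst (sect u'), semApp t' u'⟩ := by
  simp only [Tm.den, hA, hB, ht, hu, Option.bind_some, Elem.check_mk]

theorem Tm.den_pair {A B : Ty} {t u : Tm} {A' : SemTy G} (hA : A.den G η = some A')
    {B' : SemTy (comp G A')} (hB : B.den _ (η.ext A') = some B') {t' : SemTm A'}
    (ht : t.den G η = some ⟨_, t'⟩) {u' : SemTm (B'.subst (sect t'))}
    (hu : u.den G η = some ⟨_, u'⟩) :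
    (Tm.pair A B t u).den G η = some ⟨A'.sig B', semPair t' u'⟩ := by
  simp only [Tm.den, hA, hB, ht, hu, Option.bind_some, Elem.check_mk]

theorem Tm.den_fst {A B : Ty} {t : Tm} {A' : SemTy G} (hA : A.den G η = some A')
    {B' : SemTy (comp G A')} (hB : B.den _ (η.ext A') = some B') {t' : SemTm (A'.sig B')}
    (ht : t.den G η = some ⟨_, t'⟩) : (Tm.fst A B t).den G η = some ⟨A', semFst t'⟩ := by
  simp only [Tm.den, hA, hB, ht, Option.bind_some, Elem.check_mk]

theorem Tm.den_snd {A B : Ty} {t : Tm} {A' : SemTy G} (hA : A.den G η = some A')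
    {B' : SemTy (comp G A')} (hB : B.den _ (η.ext A') = some B') {t' : SemTm (A'.sig B')}
    (ht : t.den G η = some ⟨_, t'⟩) :
    (Tm.snd A B t).den G η = some ⟨B'.subst (sect (semFst t')), semSnd t'⟩ := by
  simp only [Tm.den, hA, hB, ht, Option.bind_some, Elem.check_mk]

theorem Tm.den_next {κ : ℕ} {ξ : DSub} {t : Tm} {c : ClkSec G} (hc : η.clk κ = some c)
    {D : DInterp c} (hD : ξ.den G η c = some D) {A' : SemTy D.tot} {t' : SemTm A'}
    (ht : t.den D.tot D.env = some ⟨_, t'⟩) :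
    (Tm.next κ ξ t).den G η = some ⟨A'.later c D.fam, semNext c D.fam t'⟩ := by
  simp only [Tm.den, hc, hD, ht, Option.bind_some]

theorem Tm.den_next_nil {κ : ℕ} {t : Tm} {c : ClkSec G} (hc : η.clk κ = some c)
    {A' : SemTy G} {t' : SemTm A'} (ht : t.den G η = some ⟨_, t'⟩) :
    (Tm.next κ .nil t).den G η = some ⟨A'.later c (.nil c), semNext c (.nil c) t'⟩ :=
  Tm.den_next hc (D := ⟨G, η, .nil c⟩) (by simp only [DSub.den]) ht

theorem Tm.den_prev {A : Ty} {t : Tm} {A' : SemTy (compClk G)}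
    (hA : A.den _ η.extClk = some A') {a : SemTm A'}
    (ht : t.den _ η.extClk = some ⟨_, semNext (lastClk G) (.nil _) a⟩) :
    (Tm.prev A t).den G η = some ⟨A'.all, semClam a⟩ := by
  simp only [Tm.den, hA, ht, Option.bind_some, Elem.check_mk,
    semPrev_eq_some.2 ⟨a, rfl, rfl⟩]

theorem Tm.den_fix {κ : ℕ} {A : Ty} {t : Tm} {c : ClkSec G} (hc : η.clk κ = some c)
    {A' : SemTy G} (hA : A.den G η = some A')
    {t' : SemTm (A'.subst (proj (A'.later c (.nil c))))}
    (ht : t.den _ (η.ext (A'.later c (.nil c))) = some ⟨_, t'⟩) {a : SemTm A'}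
    (ha : a = t'.subst (sect (semNext c (.nil c) a))) :
    (Tm.fix κ A t).den G η = some ⟨A', a⟩ := by
  simp only [Tm.den, hc, hA, ht, Option.bind_some, Elem.check_mk, semFix_eq_some.2 ha]

theorem Tm.den_clam {t : Tm} {A' : SemTy (compClk G)} {t' : SemTm A'}
    (ht : t.den _ η.extClk = some ⟨_, t'⟩) :
    (Tm.clam t).den G η = some ⟨A'.all, semClam t'⟩ := by
  simp only [Tm.den, ht, Option.bind_some]

theorem Tm.den_capp {A : Ty} {t : Tm} {κ : ℕ} {A' : SemTy (compClk G)}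
    (hA : A.den _ η.extClk = some A') {t' : SemTm A'.all} (ht : t.den G η = some ⟨_, t'⟩)
    {c : ClkSec G} (hc : η.clk κ = some c) :
    (Tm.capp A t κ).den G η = some ⟨A'.subst (sectClk c), semCapp t' c⟩ := by
  simp only [Tm.den, hA, ht, hc, Option.bind_some, Elem.check_mk]

theorem Tm.den_refl {A : Ty} {t : Tm} {A' : SemTy G} (hA : A.den G η = some A')
    {t' : SemTm A'} (ht : t.den G η = some ⟨_, t'⟩) :
    (Tm.refl A t).den G η = some ⟨SemTy.ident t' t', semRefl t'⟩ := by
  simp only [Tm.den, hA, ht, Option.bind_some, Elem.check_mk]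

theorem Tm.den_incl {Δ Δ' : Finset ℕ} {t : Tm} {K K' : ClkSet G} (hK : η.clks Δ = some K)
    (hK' : η.clks Δ' = some K') (hKK : ∀ X γ, K.val X γ ⊆ K'.val X γ)
    {t' : SemTm (SemTy.univ K)} (ht : t.den G η = some ⟨_, t'⟩) :
    (Tm.incl Δ Δ' t).den G η = some ⟨SemTy.univ K', semIncl hKK t'⟩ := by
  simp only [Tm.den, hK, hK', ht, Option.bind_some, Elem.check_mk]
  exact dif_pos hKK

theorem Ty.den_el {Δ : Finset ℕ} {t : Tm} {K : ClkSet G} (hK : η.clks Δ = some K)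
    {t' : SemTm (SemTy.univ K)} (ht : t.den G η = some ⟨_, t'⟩) :
    (Ty.el Δ t).den G η = some (SemTy.el K t') := by
  simp only [Ty.den, hK, ht, Option.bind_some, Elem.check_mk]

end

/-! ### Interpretation of contexts -/

theorem Ctx.den_ty {Γ : Ctx} {A : Ty} {J : CtxInterp.{u}} : Ctx.den (.ty A :: Γ) = some J ↔
    ∃ I, Ctx.den Γ = some I ∧ ∃ T, A.den I.psh I.env = some T ∧
      ⟨comp I.psh T, I.env.ext T⟩ = J := by
  simp only [Ctx.den, Option.bind_eq_some_iff, Option.some.injEq]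

theorem Ctx.den_clk {Γ : Ctx} {J : CtxInterp.{u}} : Ctx.den (.clk :: Γ) = some J ↔
    ∃ I, Ctx.den Γ = some I ∧ ⟨compClk I.psh, I.env.extClk⟩ = J := by
  simp only [Ctx.den, Option.bind_eq_some_iff, Option.some.injEq]

/-- A declared clock has an interpretation. -/
theorem IsClk.den {κ : ℕ} : ∀ {Γ : Ctx} {I : CtxInterp.{u}}, IsClk Γ κ → Ctx.den Γ = some I →
    ∃ c, I.env.clk κ = some c := by
  induction κ with
  | zero =>
    rintro (_ | ⟨_ | A, Γ⟩) I h hI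
    · cases h
    · obtain ⟨I', hI', rfl⟩ := Ctx.den_clk.1 hI
      exact ⟨_, rfl⟩
    · cases h
  | succ κ ih =>
    rintro (_ | ⟨_ | A, Γ⟩) I h hI
    · cases h
    · obtain ⟨I', hI', rfl⟩ := Ctx.den_clk.1 hI
      obtain ⟨c, hc⟩ := ih h hI'
      exact ⟨_, (RenRel.projClk I'.env).clk κ c hc⟩
    · obtain ⟨I', hI', T, hT, rfl⟩ := Ctx.den_ty.1 hI
      obtain ⟨c, hc⟩ := ih h hI'
      exact ⟨_, (RenRel.proj I'.env T).clk κ c hc⟩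

theorem Env.clks_of_isClk {Γ : Ctx} {I : CtxInterp.{u}} {Δ : Finset ℕ}
    (h : ∀ κ ∈ Δ, IsClk Γ κ) (hI : Ctx.den Γ = some I) : ∃ K, I.env.clks Δ = some K := by
  have : ∀ κ ∈ Δ, (I.env.clk κ).isSome := fun κ hκ =>
    Option.isSome_iff_exists.2 ((h κ hκ).den hI)
  unfold Env.clks
  rw [if_pos this]
  exact ⟨_, rfl⟩

/-- The interpretation of a variable declared in the context: the type lives over an initial
segment of the context, to which the context projects by a morphism `f`. -/
theorem Ctx.den_var {A : Ty} {n : ℕ} : ∀ {Γ : Ctx} {I : CtxInterp.{u}},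
    Γ[n]? = some (.ty A) → Ctx.den Γ = some I →
    ∃ (J : CtxInterp.{u}) (f : I.psh ⟶ J.psh) (T : SemTy J.psh) (a : SemTm (T.subst f)),
      A.den J.psh J.env = some T ∧ RenRel J.env I.env f (· + (n + 1)) ∧
      I.env n = some (.tm (T.subst f) a) := by
  induction n with
  | zero =>
    rintro (_ | ⟨_ | B, Γ⟩) I h hI
    · cases h
    · cases h
    · cases h
      obtain ⟨I', hI', T, hT, rfl⟩ := Ctx.den_ty.1 hI
      exact ⟨I', proj T, T, lastVar T, hT, RenRel.proj I'.env T, rfl⟩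
  | succ n ih =>
    rintro (_ | ⟨_ | B, Γ⟩) I h hI
    · cases h
    · obtain ⟨I', hI', rfl⟩ := Ctx.den_clk.1 hI
      obtain ⟨J, f, T, a, hT, hr, ha⟩ := ih h hI'
      exact ⟨J, projClk I'.psh ≫ f, T, a.subst (projClk I'.psh), hT,
        hr.comp (RenRel.projClk I'.env), RenRel.projClk I'.env n _ ha⟩
    · obtain ⟨I', hI', S, hS, rfl⟩ := Ctx.den_ty.1 hI
      obtain ⟨J, f, T, a, hT, hr, ha⟩ := ih h hI'
      exact ⟨J, proj S ≫ f, T, a.subst (proj S), hT, hr.comp (RenRel.proj I'.env S),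
        RenRel.proj I'.env S n _ ha⟩

/-- If it is defined, the interpretation of the context `Γ, Γ'` of a delayed substitution
`ξ : Γ ⇀ Γ'` is the one that is part of the interpretation of `ξ`. -/
theorem Ctx.den_ext {Γ : Ctx} {I : CtxInterp.{u}} (hI : Ctx.den Γ = some I) {c : ClkSec I.psh} :
    ∀ (ξ : DSub) {D : DInterp c} {J : CtxInterp.{u}}, ξ.den I.psh I.env c = some D →
      Ctx.den (ξ.ext Γ) = some J → J = ⟨D.tot, D.env⟩
  | .nil, D, J, hD, hJ => by
    simp only [DSub.den, Option.some.injEq] at hD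
    subst hD
    exact Option.some_inj.1 (hJ.symm.trans hI)
  | .snoc ξ A t, D, J, hD, hJ => by
    obtain ⟨D', hD', A', hA, t', ht, rfl⟩ := DSub.den_snoc.1 hD
    obtain ⟨J', hJ', T, hT, rfl⟩ := Ctx.den_ty.1 hJ
    obtain rfl := Ctx.den_ext hI ξ hD' hJ'
    obtain rfl : A' = T := Option.some_inj.1 (hA.symm.trans hT)
    rfl

/-! ### Equations between semantic terms -/

section

variable {G : Psh.{u}}

theorem semApp_semLam {A : SemTy G} {B : SemTy (comp G A)} (b : SemTm B) (a : SemTm A) :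
    semApp (semLam b) a = b.subst (sect a) :=
  SemTm.ext (funext fun X => funext fun γ => semLam_fn' b γ (𝟙 X) (map_id_elt G γ) (a.val X γ))

theorem semCapp_semClam {A : SemTy (compClk G)} (b : SemTm A) (c : ClkSec G) :
    semCapp (semClam b) c = b.subst (sectClk c) :=
  SemTm.ext (funext fun X => funext fun γ => semClam_fn' b γ (𝟙 X) (map_id_elt G γ) (c.val X γ))

/-- The `η`-rule; the type of the weakened function is cast to a dependent product. -/
theorem semLam_eta {A : SemTy G} {B : SemTy (comp G A)} (t : SemTm (A.pi B)) :
    semLam (B := B) (semApp (A := A.subst (proj A)) (B := B.subst (lift (proj A) A))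
      ((t.subst (proj A)).cast (SemTy.pi_subst (proj A) A B)) (lastVar A)) = t := by
  refine SemTm.ext (funext fun X => funext fun γ => Subtype.ext ?_)
  funext Y σ a
  have h := (PiElt.heq_iff (proj A) _ _).1
    (SemTm.cast_val (SemTy.pi_subst (proj A) A B) (t.subst (proj A)) Y
      (pt (G.map σ γ) a)).symm Y (𝟙 Y) _ (map_id_elt _ _) a
  refine h.symm.trans ?_
  have h' : (t.val Y (G.map σ γ)) = (t.val X γ).restr σ rfl := (t.nat σ rfl).symm
  refine (congrArg (fun f : PiElt A B Y (G.map σ γ) =>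
    f.fn' (𝟙 Y) (map_id_elt G _) a) h').trans ?_
  exact (t.val X γ).restr_fn' σ rfl (𝟙 Y) (map_id_elt G _) rfl a

/-- The `η`-rule for clock abstraction. -/
theorem semClam_eta {A : SemTy (compClk G)} (t : SemTm A.all) :
    semClam (A := A) (semCapp (A := A.subst (liftClk (projClk G)))
      ((t.subst (projClk G)).cast (SemTy.all_subst (projClk G) A)) (lastClk G)) = t := by
  refine SemTm.ext (funext fun X => funext fun γ => Subtype.ext ?_)
  funext Y σ c
  have h := (AllElt.heq_iff (projClk G) _ _).1
    (SemTm.cast_val (SemTy.all_subst (projClk G) A) (t.subst (projClk G)) Y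
      (ptClk (G.map σ γ) c)).symm Y (𝟙 Y) _ (map_id_elt _ _) c
  refine h.symm.trans ?_
  have h' : (t.val Y (G.map σ γ)) = (t.val X γ).restr σ rfl := (t.nat σ rfl).symm
  refine (congrArg (fun f : AllElt A Y (G.map σ γ) =>
    f.fn' (𝟙 Y) (map_id_elt G _) c) h').trans ?_
  exact (t.val X γ).restr_fn' σ rfl (𝟙 Y) (map_id_elt G _) rfl c

/-- Clock irrelevance holds for types that are invariant under clock introduction. -/
theorem semCapp_irrel {A : SemTy G} (hA : A.Inv) (t : SemTm (A.subst (projClk G)).all)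
    (c c' : ClkSec G) :
    (semCapp t c : SemTm A) = semCapp t c' :=
  SemTm.ext (funext fun X => funext fun γ =>
    AllElt.irrel hA (t.val X γ) (map_id_elt G γ) (c.val X γ) (c'.val X γ))

theorem Truth.congr {p q : Prop} (h : p ↔ q) : Truth.{u} p = Truth q := by
  rw [propext h]

theorem IfSet.truth {p q : Prop} [Decidable p] {r : p → Prop} (h : q ↔ ∀ h, r h) :
    Truth.{u} q = IfSet p fun h => Truth (r h) := by
  unfold IfSet
  split_ifs with hp
  · exact Truth.congr (h.trans ⟨fun h' => h' hp, fun h' _ => h'⟩)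
  · exact Truth.congr (h.trans ⟨fun _ => trivial, fun _ h' => absurd h' hp⟩)

/-- Identity types commute with later types. -/
theorem SemTy.ident_later {H : Psh.{u}} (κ : ClkSec G) (D : Delayed κ H) {A : SemTy H}
    (t s : SemTm A) :
    SemTy.ident (semNext κ D t) (semNext κ D s) = (SemTy.ident t s).later κ D := by
  have ho : ∀ X γ, (SemTy.ident (semNext κ D t) (semNext κ D s)).obj X γ
      = ((SemTy.ident t s).later κ D).obj X γ := by
    intro X γ
    refine IfSet.truth ⟨fun e h => ?_, fun e => IfSet.ext fun h => ?_⟩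
    · have := congrArg (fun x => IfSet.get x h) e
      simpa only [semNext_get] using this
    · simpa only [semNext_get] using e h
  have hsub : ∀ X γ (x y : ((SemTy.ident t s).later κ D).obj X γ), x = y := by
    intro X γ
    rw [← ho]
    intro x y
    exact Subsingleton.elim (α := Truth _) x y
  refine SemTy.ext_heq ho ?_
  intro X Y σ γ γ' e a b _
  obtain ⟨x, hx⟩ : ∃ x, HEq ((SemTy.ident (semNext κ D t) (semNext κ D s)).map σ e a)
      (x : ((SemTy.ident t s).later κ D).obj Y γ') :=
    ⟨cast (ho Y γ') _, (cast_heq _ _).symm⟩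
  exact hx.trans (heq_of_eq (hsub _ _ _ _))

end

/-! ### Equations of delayed substitutions -/

theorem upRN_of_lt (r : ℕ → ℕ) {l n : ℕ} (h : n < l) : upRN r l n = n := by
  induction l generalizing n with
  | zero => omega
  | succ l ih =>
    cases n with
    | zero => rfl
    | succ n => exact congrArg (· + 1) (ih (by omega))

theorem DSub.len_ren (r : ℕ → ℕ) (ξ : DSub) : (ξ.ren r).len = ξ.len := by
  rw [DSub.ren_eq_sub, DSub.len_sub]

section

variable {G : Psh.{u}} {η : Env G} {c : ClkSec G}

/-- The environment of a delayed substitution extends that of its base context. -/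
theorem DSub.env_add : ∀ (ξ : DSub) {D : DInterp c}, ξ.den G η c = some D →
    ∀ n, D.env (n + ξ.len) = (η n).map (Entry.subst D.fam.proj)
  | .nil, D, h, n => by
    simp only [DSub.den, Option.some.injEq] at h
    subst h
    change η n = (η n).map (Entry.subst (𝟙 G))
    cases η n with
    | none => rfl
    | some e => exact congrArg some (Entry.subst_id e).symm
  | .snoc ξ A t, D, h, n => by
    obtain ⟨E, hE, A', hA, t', ht, rfl⟩ := DSub.den_snoc.1 h
    change (E.env (n + ξ.len)).map (Entry.subst (proj A')) = _
    rw [ξ.env_add hE]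
    cases η n with
    | none => rfl
    | some e => exact congrArg some (Entry.subst_comp e E.fam.proj (proj A')).symm

theorem DSub.env_lt : ∀ (ξ : DSub) {D : DInterp c}, ξ.den G η c = some D →
    ∀ n < ξ.len, ∃ e, D.env n = some e
  | .nil, _, _, _, hn => absurd hn (Nat.not_lt_zero _)
  | .snoc ξ A t, D, h, n, hn => by
    obtain ⟨E, hE, A', hA, t', ht, rfl⟩ := DSub.den_snoc.1 h
    cases n with
    | zero => exact ⟨_, rfl⟩
    | succ n =>
      obtain ⟨e, he⟩ := ξ.env_lt hE n (Nat.lt_of_succ_lt_succ hn)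
      exact ⟨_, congrArg (Option.map (Entry.subst (proj A'))) he⟩

theorem DSub.renRel_proj (ξ : DSub) {D : DInterp c} (h : ξ.den G η c = some D) :
    RenRel η D.env D.fam.proj (· + ξ.len) := fun n e he => by
  rw [ξ.env_add h, he]
  rfl

/-- A component of a delayed substitution that the type does not depend on can be dropped. -/
theorem SemTy.later_wk {H : Psh.{u}} (D : Delayed c H) {B : SemTy H} (b : SemTm (B.later c D))
    (A : SemTy H) : (A.subst (proj B)).later c (D.snoc b) = A.later c D :=
  (SemTy.later_subst (f := 𝟙 G) (D := D) (D' := D.snoc b) (g := proj B) (fun _ _ _ => rfl) A).symm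

theorem semNext_wk {H : Psh.{u}} (D : Delayed c H) {B : SemTy H} (b : SemTm (B.later c D))
    {A : SemTy H} (a : SemTm A) :
    (⟨_, semNext c (D.snoc b) (a.subst (proj B))⟩ : Elem G) = ⟨_, semNext c D a⟩ :=
  (semNext_subst (f := 𝟙 G) (D := D) (D' := D.snoc b) (g := proj B) (fun _ _ _ => rfl) a).symm

/-- The delayed substitution `ξ⟨x ← next ξ. t⟩` factors through the section given by `t`. -/
theorem Delayed.snoc_next_over {H : Psh.{u}} (D : Delayed c H) {B : SemTy H} (b : SemTm B) :
    (D.snoc (semNext c D b)).Over (𝟙 G) D (sect b) := fun X γ h =>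
  pt_ext rfl (heq_of_eq (semNext_get c D b X γ h).symm)

theorem SemTy.later_next {H : Psh.{u}} (D : Delayed c H) {B : SemTy H} (b : SemTm B)
    (A : SemTy (comp H B)) :
    A.later c (D.snoc (semNext c D b)) = (A.subst (sect b)).later c D :=
  SemTy.later_subst (D.snoc_next_over b) A

theorem semNext_next {H : Psh.{u}} (D : Delayed c H) {B : SemTy H} (b : SemTm B)
    {A : SemTy (comp H B)} (a : SemTm A) :
    (⟨_, semNext c (D.snoc (semNext c D b)) a⟩ : Elem G) = ⟨_, semNext c D (a.subst (sect b))⟩ :=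
  semNext_subst (D.snoc_next_over b) a

/-- The equation `next^κ ξ⟨x ← t⟩. x = t`. -/
theorem semNext_lastVar {H : Psh.{u}} (D : Delayed c H) {A : SemTy H}
    (a : SemTm (A.later c D)) :
    (⟨_, semNext c (D.snoc a) (lastVar A)⟩ : Elem G) = ⟨_, a⟩ := by
  refine Elem.ext_heq (SemTy.later_wk D a A) fun X γ => HEq.symm ?_
  refine (SemTy.later_heq_iff (f := 𝟙 G) (D := D) (D' := D.snoc a) (g := proj A)
    (fun _ _ _ => rfl) (A := A) _ _).2 fun h => ?_
  exact heq_of_eq (semNext_get c (D.snoc a) (lastVar A) X γ h).symm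

theorem DSub.den_of_append : ∀ (ζ : DSub) {ξ : DSub} {E : DInterp c},
    (ξ.append ζ).den G η c = some E → ∃ D, ξ.den G η c = some D
  | .nil, _, E, h => ⟨E, h⟩
  | .snoc ζ A t, _, E, h => by
    obtain ⟨D, hD, -⟩ := DSub.den_snoc.1 h
    exact ζ.den_of_append hD

/-- A morphism between the interpretations of two delayed substitutions extends along a common
tail. -/
theorem DSub.den_append_renTel {ξ₁ ξ₂ : DSub} {D₁ D₂ : DInterp c} (h₁ : ξ₁.den G η c = some D₁)
    (h₂ : ξ₂.den G η c = some D₂) {g : D₂.tot ⟶ D₁.tot} {r : ℕ → ℕ}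
    (hr : RenRel D₁.env D₂.env g r) (ho : D₁.fam.Over (𝟙 G) D₂.fam g) :
    ∀ (ζ : DSub) {E₁ : DInterp c}, (ξ₁.append ζ).den G η c = some E₁ →
      ∃ (E₂ : DInterp c) (g' : E₂.tot ⟶ E₁.tot),
        (ξ₂.append (ζ.renTel r)).den G η c = some E₂ ∧
        RenRel E₁.env E₂.env g' (upRN r ζ.len) ∧ E₁.fam.Over (𝟙 G) E₂.fam g'
  | .nil, E₁, h => by
    obtain rfl : D₁ = E₁ := Option.some_inj.1 (h₁.symm.trans h)
    exact ⟨D₂, g, h₂, hr, ho⟩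
  | .snoc ζ A t, E, h => by
    obtain ⟨E₁, hE, A', hA, t', ht, rfl⟩ := DSub.den_snoc.1 h
    obtain ⟨E₂, g', hE₂, hr', ho'⟩ := den_append_renTel h₁ h₂ hr ho ζ hE
    have e : A'.later c E₁.fam = (A'.subst g').later c E₂.fam := SemTy.later_subst ho' A'
    rw [← Elem.mk_cast e] at ht
    refine ⟨⟨_, E₂.env.ext (A'.subst g'), E₂.fam.snoc (t'.cast e)⟩, lift g' A',
      DSub.den_snoc.2 ⟨E₂, hE₂, _, Ty.den_ren hr' hA, _, ht, rfl⟩, hr'.ext A', ?_⟩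
    exact Delayed.Over.snoc (f := 𝟙 G) ho' t'

/-- The morphism that exchanges the last two variables. -/
def swapHom {H : Psh.{u}} (B C : SemTy H) :
    comp (comp H C) (B.subst (proj C)) ⟶ comp (comp H B) (C.subst (proj B)) where
  app _ := TypeCat.ofHom fun p =>
    pt (A := C.subst (proj B)) (pt (A := B) (base (base p)) (fib p)) (fib (base p))
  naturality _ _ _ := rfl

theorem renRel_swap {H : Psh.{u}} (η : Env H) (B C : SemTy H) :
    RenRel ((η.ext B).ext (C.subst (proj B))) ((η.ext C).ext (B.subst (proj C))) (swapHom B C)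
      swapLast
  | 0, e, he => by
    cases he
    rfl
  | 1, e, he => by
    cases he
    rfl
  | n + 2, e, he => by
    obtain ⟨e₁, he₁, rfl⟩ := Option.map_eq_some_iff.1 he
    obtain ⟨e₀, he₀, rfl⟩ := Option.map_eq_some_iff.1 he₁
    refine (congrArg (fun x => (x.map (Entry.subst (proj C))).map
      (Entry.subst (proj (B.subst (proj C))))) (show η n = some e₀ from he₀)).trans ?_
    cases e₀ <;> rfl

/-- Two components of a delayed substitution that do not depend on each other can be exchanged. -/
theorem DSub.den_swap {ξ : DSub} {B C : Ty} {t u : Tm} {D₁ : DInterp c}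
    (h : (DSub.snoc (.snoc ξ B t) C.wk u).den G η c = some D₁)
    (hC : ∀ D : DInterp c, ξ.den G η c = some D → ∃ C', C.den D.tot D.env = some C') :
    ∃ (D₂ : DInterp c) (g : D₂.tot ⟶ D₁.tot),
      (DSub.snoc (.snoc ξ C u) B.wk t).den G η c = some D₂ ∧
      RenRel D₁.env D₂.env g swapLast ∧ D₁.fam.Over (𝟙 G) D₂.fam g := by
  obtain ⟨E, hE, C₁, hC₁, u', hu, rfl⟩ := DSub.den_snoc.1 h
  obtain ⟨D, hD, B', hB, t', ht, rfl⟩ := DSub.den_snoc.1 hE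
  obtain ⟨C', hC'⟩ := hC D hD
  obtain rfl : C'.subst (proj B') = C₁ :=
    Option.some_inj.1 ((Ty.den_wk hC' B').symm.trans hC₁)
  have hu' := hu
  rw [← Elem.mk_cast (SemTy.later_wk D.fam t' C')] at hu'
  set v := u'.cast (SemTy.later_wk D.fam t' C')
  have ht' := ht
  rw [← Elem.mk_cast (SemTy.later_wk D.fam v B').symm] at ht'
  refine ⟨_, swapHom B' C', DSub.den_snoc.2 ⟨_, DSub.den_snoc.2 ⟨D, hD, C', hC', v, hu', rfl⟩, _,
    Ty.den_wk hB C', _, ht', rfl⟩, renRel_swap D.env B' C', ?_⟩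
  intro X γ h
  refine pt_ext (A := C'.subst (proj B')) (γ := pt (A := B') (D.fam.fam X γ h) _)
    (γ' := pt (A := B') (D.fam.fam X γ h) _) (pt_ext rfl ?_) ?_
  · exact ((SemTy.later_heq_iff (f := 𝟙 G) (D := D.fam) (D' := D.fam.snoc v) (g := proj C')
      (fun _ _ _ => rfl) (A := B') _ _).1 (SemTm.cast_val _ t' X γ).symm h).symm
  · exact (SemTy.later_heq_iff (f := 𝟙 G) (D := D.fam) (D' := D.fam.snoc t') (g := proj B')
      (fun _ _ _ => rfl) (A := C') _ _).1 (SemTm.cast_val _ u' X γ) h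

end

/-! ### Commutation of `next` with itself -/

theorem IfSet.congr {p p' : Prop} [Decidable p] [Decidable p'] {B : p → Type (u + 1)}
    {B' : p' → Type (u + 1)} (e : p ↔ p') (eB : ∀ h h', B h = B' h') :
    IfSet p B = IfSet p' B' := by
  unfold IfSet
  by_cases h : p
  · rw [dif_pos h, dif_pos (e.1 h)]
    exact eB _ _
  · rw [dif_neg h, dif_neg (mt e.2 h)]

theorem IfSet.heq_of {p p' : Prop} [i : Decidable p] [i' : Decidable p'] {B : p → Type (u + 1)}
    {B' : p' → Type (u + 1)} (e : p ↔ p') (eB : ∀ h h', B h = B' h') {x : IfSet p B}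
    {y : IfSet p' B'} (h : ∀ h h', HEq (x.get h) (y.get h')) : HEq x y := by
  obtain rfl : p = p' := propext e
  obtain rfl : i = i' := Subsingleton.elim i i'
  exact (IfSet.heq_iff (fun h => eB h h) x y).2 fun k => h k k

section

variable {G : Psh.{u}} {c : ClkSec G}

/-- After a tick, a delayed substitution can be evaluated once more; this restricts its value. -/
theorem Delayed.fam_tick {H : Psh.{u}} (D : Delayed c H) {X : TimeObj} {γ : G.obj X}
    (h : 0 < X.ticks (c.val X γ)) {δ : G.obj (X.tick (c.val X γ))}
    (e : G.map (X.tickHom (c.val X γ)) γ = δ)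
    (h' : 0 < (X.tick (c.val X γ)).ticks (c.val _ δ)) :
    D.fam _ δ h' = H.map ((X.tick (c.val X γ)).tickHom (c.val _ δ)) (D.fam X γ h) := by
  rw [← D.fam_nat (X.tickHom (c.val X γ)) e h h']
  congr 2

/-- If the delayed substitutions `P` and `P₂` are the reindexings of `D'` and `D` along the
projections of `D` and `D'`, then their total presheaves are the same, and evaluating `D` and `P`
in a row gives the same element as evaluating `D'` and `P₂` in a row. -/
theorem Delayed.fam_comm {H H' L L₂ : Psh.{u}} {D : Delayed c H} {D' : Delayed c H'}
    {P : Delayed (c.subst D.proj) L} {P₂ : Delayed (c.subst D'.proj) L₂}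
    {g₁ : L ⟶ H'} {g₂ : L₂ ⟶ H} (hP : D'.Over D.proj P g₁) (hP₂ : D.Over D'.proj P₂ g₂)
    (sq : IsPbSq g₁ P.proj D'.proj D.proj) {s : L₂ ⟶ L} (hs₁ : ∀ X x, g₁.app X (s.app X x) =
      P₂.proj.app X x) (hs₂ : ∀ X x, P.proj.app X (s.app X x) = g₂.app X x)
    {X : TimeObj} {γ : G.obj X} (h : 0 < X.ticks (c.val X γ))
    (h₁ : 0 < (X.tick (c.val X γ)).ticks (c.val _ (D.proj.app _ (D.fam X γ h))))
    (h₂ : 0 < (X.tick (c.val X γ)).ticks (c.val _ (D'.proj.app _ (D'.fam X γ h)))) :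
    HEq (P.fam _ (D.fam X γ h) h₁) (s.app _ (P₂.fam _ (D'.fam X γ h) h₂)) := by
  -- the clock `κ` has the same value at the end of both delayed substitutions, but not by
  -- definition; after identifying the two values, both sides are determined by their projections
  -- to the pullback
  have key : ∀ (a b : (X.tick (c.val X γ)).clocks), a = b →
      ∀ (x : L.obj ((X.tick (c.val X γ)).tick a)) (y : L.obj ((X.tick (c.val X γ)).tick b)),
      g₁.app _ x = H'.map ((X.tick (c.val X γ)).tickHom a) (D'.fam X γ h) →
      P.proj.app _ x = H.map ((X.tick (c.val X γ)).tickHom a) (D.fam X γ h) →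
      g₁.app _ y = H'.map ((X.tick (c.val X γ)).tickHom b) (D'.fam X γ h) →
      P.proj.app _ y = H.map ((X.tick (c.val X γ)).tickHom b) (D.fam X γ h) → HEq x y := by
    rintro a _ rfl x y hx hx' hy hy'
    exact heq_of_eq ((sq.lift _ _ _ (hx ▸ hx' ▸ sq.comm _ x)).unique ⟨hx, hx'⟩ ⟨hy, hy'⟩)
  refine key _ _ ?_ _ _ ?_ ?_ ?_ ?_
  · exact congrArg (c.val _) ((D.fam_proj X γ h).trans (D'.fam_proj X γ h).symm)
  · exact (hP _ _ h₁).trans (D'.fam_tick h (D.fam_proj X γ h).symm h₁)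
  · exact P.fam_proj _ _ h₁
  · exact (hs₁ _ _).trans (P₂.fam_proj _ _ h₂)
  · exact (hs₂ _ _).trans ((hP₂ _ _ h₂).trans (D.fam_tick h (D'.fam_proj X γ h).symm h₂))

/-- A type from the base context, delayed twice along delayed substitutions, is the plain
`▷^κ ▷^κ A`. -/
theorem SemTy.later_later {H L : Psh.{u}} (D : Delayed c H) (P : Delayed (c.subst D.proj) L)
    (T : SemTy G) : ((T.subst (P.proj ≫ D.proj)).later (c.subst D.proj) P).later c D
      = (T.later c (.nil c)).later c (.nil c) := by
  have h : (Delayed.nil c).Over D.proj P (P.proj ≫ D.proj) := fun X γ h =>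
    (congrArg (D.proj.app _) (P.fam_proj X γ h)).trans (app_map_elt D.proj _ rfl).symm
  rw [← SemTy.later_subst h T]
  exact (SemTy.later_subst D.nil_over_proj (T.later c (.nil c))).symm

theorem SemTm.val_heq_tick {H : Psh.{u}} {A : SemTy H} (a : SemTm A) {X : TimeObj}
    {c c' : X.clocks} (e : c = c') {x : H.obj (X.tick c)} {y : H.obj (X.tick c')} (h : HEq x y) :
    HEq (a.val _ x) (a.val _ y) := by
  subst e
  rw [eq_of_heq h]

theorem SemTy.obj_eq_tick {H : Psh.{u}} (A : SemTy H) {X : TimeObj}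
    {c c' : X.clocks} (e : c = c') {x : H.obj (X.tick c)} {y : H.obj (X.tick c')} (h : HEq x y) :
    A.obj _ x = A.obj _ y := by
  subst e
  rw [eq_of_heq h]

/-- The semantic form of `next^κ ξ. next^κ ξ'. u = next^κ ξ'. next^κ ξ. u`. -/
theorem semNext_comm {H H' L L₂ : Psh.{u}} {D : Delayed c H} {D' : Delayed c H'}
    {P : Delayed (c.subst D.proj) L} {P₂ : Delayed (c.subst D'.proj) L₂}
    {g₁ : L ⟶ H'} {g₂ : L₂ ⟶ H} (hP : D'.Over D.proj P g₁) (hP₂ : D.Over D'.proj P₂ g₂)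
    (sq : IsPbSq g₁ P.proj D'.proj D.proj) {s : L₂ ⟶ L} (hs₁ : ∀ X x, g₁.app X (s.app X x) =
      P₂.proj.app X x) (hs₂ : ∀ X x, P.proj.app X (s.app X x) = g₂.app X x)
    {A : SemTy L} (e : (A.later (c.subst D.proj) P).later c D
      = ((A.subst s).later (c.subst D'.proj) P₂).later c D') (a : SemTm A) :
    (⟨_, semNext c D (semNext (c.subst D.proj) P a)⟩ : Elem G)
      = ⟨_, semNext c D' (semNext (c.subst D'.proj) P₂ (a.subst s))⟩ := by
  refine Elem.ext_heq e fun X γ => ?_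
  have hc : ∀ h : 0 < X.ticks (c.val X γ), c.val _ (D.proj.app _ (D.fam X γ h))
      = c.val _ (D'.proj.app _ (D'.fam X γ h)) := fun h =>
    congrArg (c.val _) ((D.fam_proj X γ h).trans (D'.fam_proj X γ h).symm)
  have hp : ∀ h : 0 < X.ticks (c.val X γ),
      0 < (X.tick (c.val X γ)).ticks (c.val _ (D.proj.app _ (D.fam X γ h))) ↔
      0 < (X.tick (c.val X γ)).ticks (c.val _ (D'.proj.app _ (D'.fam X γ h))) := fun h => by
    rw [hc h]
  have hB : ∀ h : 0 < X.ticks (c.val X γ), ∀ h₁ h₂,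
      A.obj _ (P.fam _ (D.fam X γ h) h₁) = A.obj _ (s.app _ (P₂.fam _ (D'.fam X γ h) h₂)) :=
    fun h h₁ h₂ => A.obj_eq_tick (hc h) (Delayed.fam_comm hP hP₂ sq hs₁ hs₂ h h₁ h₂)
  refine IfSet.heq_of Iff.rfl (fun h _ => IfSet.congr (hp h) (hB h)) fun h _ => ?_
  refine (heq_of_eq (semNext_get c D (semNext _ P a) X γ h)).trans (HEq.trans ?_
    (heq_of_eq (semNext_get c D' (semNext _ P₂ (a.subst s)) X γ h)).symm)
  refine IfSet.heq_of (hp h) (hB h) fun h₁ h₂ => ?_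
  refine (heq_of_eq (semNext_get (c.subst D.proj) P a _ _ h₁)).trans (HEq.trans ?_
    (heq_of_eq (semNext_get (c.subst D'.proj) P₂ (a.subst s) _ _ h₂)).symm)
  exact a.val_heq_tick (hc h) (Delayed.fam_comm hP hP₂ sq hs₁ hs₂ h h₁ h₂)

/-- The comparison map into a pullback. -/
theorem IsPbSq.exists_lift {H H' L L₂ : Psh.{u}} {g : L ⟶ H'} {p' : L ⟶ H} {p : H' ⟶ G}
    {f : H ⟶ G} (sq : IsPbSq g p' p f) (k : L₂ ⟶ H') (h : L₂ ⟶ H)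
    (e : ∀ X x, p.app X (k.app X x) = f.app X (h.app X x)) :
    ∃ s : L₂ ⟶ L, s ≫ g = k ∧ s ≫ p' = h := by
  choose s hs hu using fun X x => sq.lift X (k.app X x) (h.app X x) (e X x)
  refine ⟨{ app := fun X => TypeCat.ofHom (s X), naturality := fun X Y σ => ?_ }, ?_, ?_⟩
  · refine fun_ext_elt fun x => ?_
    refine (hu Y (L₂.map σ x) (L.map σ (s X x)) ⟨?_, ?_⟩).symm
    · exact (app_map_elt g σ rfl).symm.trans ((congrArg _ (hs X x).1).trans
        (app_map_elt k σ rfl))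
    · exact (app_map_elt p' σ rfl).symm.trans ((congrArg _ (hs X x).2).trans
        (app_map_elt h σ rfl))
  · exact psh_hom_ext fun X x => (hs X x).1
  · exact psh_hom_ext fun X x => (hs X x).2

variable {η : Env G}

/-- The interpretations of `next^κ ξ. next^κ ξ'. u` and `next^κ ξ'. next^κ ξ. u`. -/
theorem Tm.den_next_comm {κ : ℕ} (hc : η.clk κ = some c) {A : Ty} {T : SemTy G}
    (hA : A.den G η = some T) {ξ ξ' : DSub} {D D' : DInterp c} (hD : ξ.den G η c = some D)
    (hD' : ξ'.den G η c = some D') {u : Tm}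
    (hu : ∀ P : DInterp (c.subst D.fam.proj),
      (ξ'.ren (· + ξ.len)).den D.tot D.env (c.subst D.fam.proj) = some P →
      ∃ S v, (A.ren (· + (ξ.len + ξ'.len))).den P.tot P.env = some S ∧
        u.den P.tot P.env = some ⟨S, v⟩) :
    ∃ a : SemTm ((T.later c (.nil c)).later c (.nil c)),
      (Tm.next κ ξ (.next (κ + ξ.len) (ξ'.ren (· + ξ.len)) u)).den G η = some ⟨_, a⟩ ∧
      (Tm.next κ ξ' (.next (κ + ξ'.len) (ξ.ren (· + ξ'.len))
        (u.ren (swapBlocks ξ.len ξ'.len)))).den G η = some ⟨_, a⟩ := by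
  have hr := ξ.renRel_proj hD
  have hr' := ξ'.renRel_proj hD'
  obtain ⟨P, g₁, hP, hr₁, ho₁, sq₁⟩ := DSub.den_ren hr hD'
  obtain ⟨P₂, g₂, hP₂, hr₂, ho₂, sq₂⟩ := DSub.den_ren hr' hD
  obtain ⟨s, hs₁, hs₂⟩ := sq₁.exists_lift P₂.fam.proj g₂ fun X x => (sq₂.comm X x).symm
  obtain ⟨S, v, hS, hv⟩ := hu P hP
  have hrP : RenRel η P.env (P.fam.proj ≫ D.fam.proj) (· + (ξ.len + ξ'.len)) := by
    have := hr.comp ((ξ'.ren (· + ξ.len)).renRel_proj hP)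
    simpa only [DSub.len_ren, Nat.add_assoc] using this
  obtain rfl : T.subst (P.fam.proj ≫ D.fam.proj) = S :=
    Option.some_inj.1 ((Ty.den_ren hrP hA).symm.trans hS)
  have hP_add := (ξ'.ren (· + ξ.len)).env_add hP
  have hP₂_add := (ξ.ren (· + ξ'.len)).env_add hP₂
  rw [DSub.len_ren] at hP_add hP₂_add
  -- the three blocks of variables: those of `ξ'`, those of `ξ`, and those of the base context
  have hs : RenRel P.env P₂.env s (swapBlocks ξ.len ξ'.len) := by
    intro n e he
    unfold swapBlocks
    split_ifs with h₁ h₂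
    · obtain ⟨e', he'⟩ := ξ'.env_lt hD' n h₁
      have h₃ := hr₁ n e' he'
      rw [upRN_of_lt _ h₁, he, Option.some_inj] at h₃
      rw [hP₂_add, he', h₃, ← Entry.subst_comp, hs₁]
      rfl
    · obtain ⟨m, rfl⟩ := Nat.exists_eq_add_of_le' (Nat.le_of_not_lt h₁)
      have hm : m < ξ.len := by omega
      obtain ⟨e', he'⟩ := ξ.env_lt hD m hm
      rw [hP_add, he'] at he
      have h₃ := hr₂ m e' he'
      rw [upRN_of_lt _ hm] at h₃
      rw [Nat.add_sub_cancel, h₃, ← Option.some_inj.1 he, ← Entry.subst_comp, hs₂]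
    · obtain ⟨m, rfl⟩ := Nat.exists_eq_add_of_le' (Nat.le_of_not_lt h₂)
      have h₃ : m + (ξ'.len + ξ.len) = (m + ξ.len) + ξ'.len := by omega
      rw [h₃, hP_add, ξ.env_add hD] at he
      rw [← Nat.add_assoc, hP₂_add, ξ'.env_add hD']
      cases hm : η m with
      | none => rw [hm] at he; cases he
      | some e' =>
        rw [hm] at he
        cases he
        have h₄ : P₂.fam.proj ≫ D'.fam.proj = s ≫ P.fam.proj ≫ D.fam.proj := by
          rw [← Category.assoc, hs₂]
          exact psh_hom_ext fun X x => (sq₂.comm X x).symm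
        refine congrArg some ?_
        rw [← Entry.subst_comp, ← Entry.subst_comp, ← Entry.subst_comp, Category.assoc, h₄]
  have eT : (T.subst (P.fam.proj ≫ D.fam.proj)).subst s = T.subst (P₂.fam.proj ≫ D'.fam.proj) := by
    have h₄ : s ≫ P.fam.proj ≫ D.fam.proj = P₂.fam.proj ≫ D'.fam.proj := by
      rw [← Category.assoc, hs₂]
      exact psh_hom_ext fun X x => sq₂.comm X x
    exact congrArg T.subst h₄
  have e₁ := SemTy.later_later D.fam P.fam T
  have e₂ := SemTy.later_later D'.fam P₂.fam T
  rw [← eT] at e₂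
  refine ⟨(semNext c D.fam (semNext _ P.fam v)).cast e₁, ?_, ?_⟩
  · rw [Elem.mk_cast]
    exact Tm.den_next hc hD (Tm.den_next (hr.clk κ c hc) hP hv)
  · rw [Elem.mk_cast, semNext_comm ho₁ ho₂ sq₁ (fun X x => by rw [← hs₁]; rfl)
      (fun X x => by rw [← hs₂]; rfl) (e₁.trans e₂.symm) v]
    exact Tm.den_next hc hD' (Tm.den_next (hr'.clk κ c hc) hP₂ (Tm.den_ren hs hv))

end

/-! ### Semantic validity of judgements -/

/-- The semantic counterpart of `Γ ⊢ A ≡ B`: the types have the same interpretation. -/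
def TyEqSem (Γ : Ctx) (A B : Ty) : Prop :=
  ∃ (I : CtxInterp.{u}) (T : SemTy I.psh), Ctx.den Γ = some I ∧
    A.den I.psh I.env = some T ∧ B.den I.psh I.env = some T

/-- The semantic counterpart of `Γ ⊢ t ≡ s : A`: the terms have the same interpretation, whose type
is that of `A`. -/
def TmEqSem (Γ : Ctx) (t s : Tm) (A : Ty) : Prop :=
  ∃ (I : CtxInterp.{u}) (T : SemTy I.psh) (a : SemTm T), Ctx.den Γ = some I ∧
    A.den I.psh I.env = some T ∧ t.den I.psh I.env = some ⟨T, a⟩ ∧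
    s.den I.psh I.env = some ⟨T, a⟩

/-- The semantic counterpart of `ξ ≡ ξ' : Γ ⇀ Γ'`: the delayed substitutions have the same
interpretation, which contains that of the context `Γ, Γ'`. -/
def DSubEqSem (Γ : Ctx) (κ : ℕ) (ξ ξ' : DSub) : Prop :=
  ∃ (I : CtxInterp.{u}) (c : ClkSec I.psh) (D : DInterp c), Ctx.den Γ = some I ∧
    I.env.clk κ = some c ∧ ξ.den I.psh I.env c = some D ∧ ξ'.den I.psh I.env c = some D ∧
    Ctx.den (ξ.ext Γ) = some ⟨D.tot, D.env⟩

section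

variable {Γ : Ctx} {I : CtxInterp.{u}}

theorem Ctx.den_cons_ty (hI : Ctx.den Γ = some I) {A : Ty} {T : SemTy I.psh}
    (hA : A.den I.psh I.env = some T) :
    Ctx.den (.ty A :: Γ) = some ⟨comp I.psh T, I.env.ext T⟩ :=
  Ctx.den_ty.2 ⟨I, hI, T, hA, rfl⟩

theorem Ctx.den_cons_clk (hI : Ctx.den Γ = some I) :
    Ctx.den (.clk :: Γ) = some ⟨compClk I.psh, I.env.extClk⟩ :=
  Ctx.den_clk.2 ⟨I, hI, rfl⟩

theorem TyEqSem.interp {A B : Ty} (h : TyEqSem.{u} Γ A B) (hI : Ctx.den Γ = some I) :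
    ∃ T, A.den I.psh I.env = some T ∧ B.den I.psh I.env = some T := by
  obtain ⟨J, T, hJ, h⟩ := h
  obtain rfl := Option.some_inj.1 (hJ.symm.trans hI)
  exact ⟨T, h⟩

theorem TyEqSem.right {A B : Ty} (h : TyEqSem.{u} Γ A B) (hI : Ctx.den Γ = some I)
    {T : SemTy I.psh} (hA : A.den I.psh I.env = some T) : B.den I.psh I.env = some T := by
  obtain ⟨S, hS, hB⟩ := h.interp hI
  obtain rfl := Option.some_inj.1 (hS.symm.trans hA)
  exact hB

theorem TmEqSem.interp {t s : Tm} {A : Ty} (h : TmEqSem.{u} Γ t s A) (hI : Ctx.den Γ = some I)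
    {T : SemTy I.psh} (hA : A.den I.psh I.env = some T) :
    ∃ a, t.den I.psh I.env = some ⟨T, a⟩ ∧ s.den I.psh I.env = some ⟨T, a⟩ := by
  obtain ⟨J, S, a, hJ, hS, h⟩ := h
  obtain rfl := Option.some_inj.1 (hJ.symm.trans hI)
  obtain rfl := Option.some_inj.1 (hS.symm.trans hA)
  exact ⟨a, h⟩

theorem DSubEqSem.interp {κ : ℕ} {ξ ξ' : DSub} (h : DSubEqSem.{u} Γ κ ξ ξ')
    (hI : Ctx.den Γ = some I) : ∃ (c : ClkSec I.psh) (D : DInterp c),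
    I.env.clk κ = some c ∧ ξ.den I.psh I.env c = some D ∧ ξ'.den I.psh I.env c = some D ∧
    Ctx.den (ξ.ext Γ) = some ⟨D.tot, D.env⟩ := by
  obtain ⟨J, c, D, hJ, h⟩ := h
  obtain rfl := Option.some_inj.1 (hJ.symm.trans hI)
  exact ⟨c, D, h⟩

end

section

variable {Γ : Ctx}

/-! ### Presuppositions of valid judgements -/

theorem TyEqSem.ctx {A B : Ty} (h : TyEqSem.{u} Γ A B) : ∃ I : CtxInterp.{u}, Ctx.den Γ = some I :=
  h.imp fun _ h => h.choose_spec.1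

theorem TmEqSem.ty {t s : Tm} {A : Ty} : TmEqSem.{u} Γ t s A → TyEqSem.{u} Γ A A :=
  fun ⟨I, T, _, hI, hA, _⟩ => ⟨I, T, hI, hA, hA⟩

theorem TyEqSem.dom {A B B' : Ty} (h : TyEqSem.{u} (.ty A :: Γ) B B') : TyEqSem.{u} Γ A A := by
  obtain ⟨J, hJ⟩ := h.ctx
  obtain ⟨I, hI, T, hT, -⟩ := Ctx.den_ty.1 hJ
  exact ⟨I, T, hI, hT, hT⟩

theorem TmEqSem.dom {A B : Ty} {t s : Tm} (h : TmEqSem.{u} (.ty A :: Γ) t s B) :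
    TyEqSem.{u} Γ A A := h.ty.dom

theorem TyEqSem.pi_inv {A B : Ty} (h : TyEqSem.{u} Γ (.pi A B) (.pi A B)) :
    TyEqSem.{u} (.ty A :: Γ) B B := by
  obtain ⟨I, T, hI, hT, -⟩ := h
  obtain ⟨A', hA, B', hB, -⟩ := Ty.den_pi.1 hT
  exact ⟨_, B', Ctx.den_cons_ty hI hA, hB, hB⟩

theorem TyEqSem.sig_inv {A B : Ty} (h : TyEqSem.{u} Γ (.sig A B) (.sig A B)) :
    TyEqSem.{u} (.ty A :: Γ) B B := by
  obtain ⟨I, T, hI, hT, -⟩ := h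
  obtain ⟨A', hA, B', hB, -⟩ := Ty.den_sig.1 hT
  exact ⟨_, B', Ctx.den_cons_ty hI hA, hB, hB⟩

theorem TyEqSem.all_inv {A : Ty} (h : TyEqSem.{u} Γ (.all A) (.all A)) :
    TyEqSem.{u} (.clk :: Γ) A A := by
  obtain ⟨I, T, hI, hT, -⟩ := h
  obtain ⟨A', hA, -⟩ := Ty.den_all.1 hT
  exact ⟨_, A', Ctx.den_cons_clk hI, hA, hA⟩

theorem TyEqSem.later_nil_inv {κ : ℕ} {A : Ty}
    (h : TyEqSem.{u} Γ (.later κ .nil A) (.later κ .nil A)) : TyEqSem.{u} Γ A A := by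
  obtain ⟨I, T, hI, hT, -⟩ := h
  obtain ⟨c, -, A', hA, -⟩ := Ty.den_later_nil.1 hT
  exact ⟨_, A', hI, hA, hA⟩

theorem DSubEqSem.ctx {κ : ℕ} {ξ ξ' : DSub} (h : DSubEqSem.{u} Γ κ ξ ξ') :
    ∃ I : CtxInterp.{u}, Ctx.den Γ = some I := h.imp fun _ h => h.choose_spec.choose_spec.1

/-! ### Soundness of the rules for types -/

theorem TyEqSem.symm {A B : Ty} : TyEqSem.{u} Γ A B → TyEqSem.{u} Γ B A :=
  fun ⟨I, T, hI, hA, hB⟩ => ⟨I, T, hI, hB, hA⟩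

theorem TyEqSem.trans {A B C : Ty} (h : TyEqSem.{u} Γ A B) (h' : TyEqSem.{u} Γ B C) :
    TyEqSem.{u} Γ A C := by
  obtain ⟨I, T, hI, hA, hB⟩ := h
  exact ⟨I, T, hI, hA, h'.right hI hB⟩

theorem TyEqSem.pi {A A' B B' : Ty} (hA : TyEqSem.{u} Γ A A')
    (hB : TyEqSem.{u} (.ty A :: Γ) B B') : TyEqSem.{u} Γ (.pi A B) (.pi A' B') := by
  obtain ⟨I, T, hI, hA, hA'⟩ := hA
  obtain ⟨S, hB, hB'⟩ := hB.interp (Ctx.den_cons_ty hI hA)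
  exact ⟨I, T.pi S, hI, Ty.den_pi.2 ⟨T, hA, S, hB, rfl⟩, Ty.den_pi.2 ⟨T, hA', S, hB', rfl⟩⟩

theorem TyEqSem.sig {A A' B B' : Ty} (hA : TyEqSem.{u} Γ A A')
    (hB : TyEqSem.{u} (.ty A :: Γ) B B') : TyEqSem.{u} Γ (.sig A B) (.sig A' B') := by
  obtain ⟨I, T, hI, hA, hA'⟩ := hA
  obtain ⟨S, hB, hB'⟩ := hB.interp (Ctx.den_cons_ty hI hA)
  exact ⟨I, T.sig S, hI, Ty.den_sig.2 ⟨T, hA, S, hB, rfl⟩, Ty.den_sig.2 ⟨T, hA', S, hB', rfl⟩⟩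

theorem TyEqSem.later {κ : ℕ} {ξ ξ' : DSub} {A A' : Ty} (hξ : DSubEqSem.{u} Γ κ ξ ξ')
    (hA : TyEqSem.{u} (ξ.ext Γ) A A') : TyEqSem.{u} Γ (.later κ ξ A) (.later κ ξ' A') := by
  obtain ⟨I, c, D, hI, hc, hD, hD', hJ⟩ := hξ
  obtain ⟨T, hA, hA'⟩ := hA.interp hJ
  exact ⟨I, T.later c D.fam, hI, Ty.den_later.2 ⟨c, hc, D, hD, T, hA, rfl⟩,
    Ty.den_later.2 ⟨c, hc, D, hD', T, hA', rfl⟩⟩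

theorem TyEqSem.all {A A' : Ty} (hA : TyEqSem.{u} (.clk :: Γ) A A') :
    TyEqSem.{u} Γ (.all A) (.all A') := by
  obtain ⟨J, T, hJ, hA, hA'⟩ := hA
  obtain ⟨I, hI, rfl⟩ := Ctx.den_clk.1 hJ
  exact ⟨I, T.all, hI, Ty.den_all.2 ⟨T, hA, rfl⟩, Ty.den_all.2 ⟨T, hA', rfl⟩⟩

theorem TyEqSem.ident {A A' : Ty} {t t' s s' : Tm} (hA : TyEqSem.{u} Γ A A')
    (ht : TmEqSem.{u} Γ t t' A) (hs : TmEqSem.{u} Γ s s' A) :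
    TyEqSem.{u} Γ (.ident A t s) (.ident A' t' s') := by
  obtain ⟨I, T, hI, hA, hA'⟩ := hA
  obtain ⟨a, ht, ht'⟩ := ht.interp hI hA
  obtain ⟨b, hs, hs'⟩ := hs.interp hI hA
  exact ⟨I, _, hI, Ty.den_ident.2 ⟨T, hA, a, ht, b, hs, rfl⟩,
    Ty.den_ident.2 ⟨T, hA', a, ht', b, hs', rfl⟩⟩

theorem TyEqSem.univ {Δ : Finset ℕ} (hΓ : ∃ I : CtxInterp.{u}, Ctx.den Γ = some I)
    (hΔ : ∀ κ ∈ Δ, IsClk Γ κ) : TyEqSem.{u} Γ (.univ Δ) (.univ Δ) := by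
  obtain ⟨I, hI⟩ := hΓ
  obtain ⟨K, hK⟩ := Env.clks_of_isClk hΔ hI
  have h := Ty.den_univ.2 ⟨K, hK, rfl⟩
  exact ⟨I, _, hI, h, h⟩

theorem TyEqSem.el {Δ : Finset ℕ} {t t' : Tm} (ht : TmEqSem.{u} Γ t t' (.univ Δ)) :
    TyEqSem.{u} Γ (.el Δ t) (.el Δ t') := by
  obtain ⟨I, T, a, hI, hT, ht, ht'⟩ := ht
  obtain ⟨K, hK, rfl⟩ := Ty.den_univ.1 hT
  exact ⟨I, _, hI, Ty.den_el hK ht, Ty.den_el hK ht'⟩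

theorem TyEqSem.el_incl {Δ Δ' : Finset ℕ} {t : Tm} (ht : TmEqSem.{u} Γ t t (.univ Δ))
    (hΔ' : TyEqSem.{u} Γ (.univ Δ') (.univ Δ')) (hΔ : Δ ⊆ Δ') :
    TyEqSem.{u} Γ (.el Δ' (.incl Δ Δ' t)) (.el Δ t) := by
  obtain ⟨I, T, a, hI, hT, ht, -⟩ := ht
  obtain ⟨K, hK, rfl⟩ := Ty.den_univ.1 hT
  obtain ⟨T', hT', -⟩ := hΔ'.interp hI
  obtain ⟨K', hK', rfl⟩ := Ty.den_univ.1 hT'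
  exact ⟨I, SemTy.el K a, hI,
    Ty.den_el hK' (Tm.den_incl hK hK' (Env.clks_mono hK hK' hΔ) ht), Ty.den_el hK ht⟩

theorem TyEqSem.later_wk {κ : ℕ} {ξ : DSub} {B A : Ty} {t : Tm}
    (hξ : DSubEqSem.{u} Γ κ (.snoc ξ B t) (.snoc ξ B t)) (hA : TyEqSem.{u} (ξ.ext Γ) A A) :
    TyEqSem.{u} Γ (.later κ (.snoc ξ B t) A.wk) (.later κ ξ A) := by
  obtain ⟨I, c, E, hI, hc, hE, -, hJ⟩ := hξ
  obtain ⟨D, hD, B', hB, t', ht, rfl⟩ := DSub.den_snoc.1 hE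
  obtain ⟨J, hJ, -⟩ := Ctx.den_ty.1 hJ
  obtain rfl := Ctx.den_ext hI ξ hD hJ
  obtain ⟨T, hA, -⟩ := hA.interp hJ
  exact ⟨I, _, hI, Ty.den_later.2 ⟨c, hc, _, hE, _, Ty.den_wk hA B', SemTy.later_wk D.fam t' T⟩,
    Ty.den_later.2 ⟨c, hc, D, hD, T, hA, rfl⟩⟩

/-- The interpretations of a delayed substitution before and after an exchange, and the comparison
between them. -/
theorem DSubEqSem.swap {κ : ℕ} {ξ ζ : DSub} {B C : Ty} {t u : Tm}
    (hξ : DSubEqSem.{u} Γ κ ((DSub.snoc (.snoc ξ B t) C.wk u).append ζ)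
      ((DSub.snoc (.snoc ξ B t) C.wk u).append ζ)) (hC : TyEqSem.{u} (ξ.ext Γ) C C)
    {I : CtxInterp.{u}} (hI : Ctx.den Γ = some I) :
    ∃ (c : ClkSec I.psh) (E₁ E₂ : DInterp c) (g : E₂.tot ⟶ E₁.tot), I.env.clk κ = some c ∧
      ((DSub.snoc (.snoc ξ B t) C.wk u).append ζ).den I.psh I.env c = some E₁ ∧
      ((DSub.snoc (.snoc ξ C u) B.wk t).append (ζ.renTel swapLast)).den I.psh I.env c = some E₂ ∧
      RenRel E₁.env E₂.env g (upRN swapLast ζ.len) ∧ E₁.fam.Over (𝟙 I.psh) E₂.fam g ∧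
      Ctx.den (((DSub.snoc (.snoc ξ B t) C.wk u).append ζ).ext Γ) = some ⟨E₁.tot, E₁.env⟩ := by
  obtain ⟨c, E₁, hc, hE₁, -, hJ⟩ := hξ.interp hI
  obtain ⟨D₁, hD₁⟩ := ζ.den_of_append hE₁
  obtain ⟨D₂, g, hD₂, hr, ho⟩ := DSub.den_swap hD₁ fun D hD => by
    obtain ⟨J, C', hJ, hC', -⟩ := hC
    obtain rfl := Ctx.den_ext hI ξ hD hJ
    exact ⟨C', hC'⟩
  obtain ⟨E₂, g', hE₂, hr', ho'⟩ := DSub.den_append_renTel hD₁ hD₂ hr ho ζ hE₁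
  exact ⟨c, E₁, E₂, g', hc, hE₁, hE₂, hr', ho', hJ⟩

theorem TyEqSem.later_swap {κ : ℕ} {ξ ζ : DSub} {A B C : Ty} {t u : Tm}
    (hξ : DSubEqSem.{u} Γ κ ((DSub.snoc (.snoc ξ B t) C.wk u).append ζ)
      ((DSub.snoc (.snoc ξ B t) C.wk u).append ζ)) (hC : TyEqSem.{u} (ξ.ext Γ) C C)
    (hA : TyEqSem.{u} (((DSub.snoc (.snoc ξ B t) C.wk u).append ζ).ext Γ) A A) :
    TyEqSem.{u} Γ (.later κ ((DSub.snoc (.snoc ξ B t) C.wk u).append ζ) A)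
      (.later κ ((DSub.snoc (.snoc ξ C u) B.wk t).append (ζ.renTel swapLast))
        (A.ren (upRN swapLast ζ.len))) := by
  obtain ⟨I, hI⟩ := hξ.ctx
  obtain ⟨c, E₁, E₂, g, hc, hE₁, hE₂, hr, ho, hJ⟩ := hξ.swap hC hI
  obtain ⟨T, hA, -⟩ := hA.interp hJ
  exact ⟨I, _, hI, Ty.den_later.2 ⟨c, hc, E₁, hE₁, T, hA, SemTy.later_subst ho T⟩,
    Ty.den_later.2 ⟨c, hc, E₂, hE₂, _, Ty.den_ren hr hA, rfl⟩⟩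

theorem TyEqSem.later_next {κ : ℕ} {ξ : DSub} {A B : Ty} {t : Tm} (hξ : DSubEqSem.{u} Γ κ ξ ξ)
    (hA : TyEqSem.{u} (.ty B :: ξ.ext Γ) A A) (ht : TmEqSem.{u} (ξ.ext Γ) t t B) :
    TyEqSem.{u} Γ (.later κ (.snoc ξ B (.next κ ξ t)) A) (.later κ ξ (A.inst t)) := by
  obtain ⟨I, c, D, hI, hc, hD, -, hJ⟩ := hξ
  obtain ⟨B', hB, -⟩ := ht.ty.interp hJ
  obtain ⟨b, ht, -⟩ := ht.interp hJ hB
  obtain ⟨T, hA, -⟩ := hA.interp (Ctx.den_cons_ty hJ hB)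
  exact ⟨I, _, hI, Ty.den_later.2 ⟨c, hc, _, DSub.den_snoc.2 ⟨D, hD, B', hB, _,
      Tm.den_next hc hD ht, rfl⟩, T, hA, SemTy.later_next D.fam b T⟩,
    Ty.den_later.2 ⟨c, hc, D, hD, _, Ty.den_inst ht hA, rfl⟩⟩

theorem TyEqSem.ident_later {κ : ℕ} {ξ : DSub} {A : Ty} {t s : Tm}
    (hξ : DSubEqSem.{u} Γ κ ξ ξ) (ht : TmEqSem.{u} (ξ.ext Γ) t t A)
    (hs : TmEqSem.{u} (ξ.ext Γ) s s A) :
    TyEqSem.{u} Γ (.ident (.later κ ξ A) (.next κ ξ t) (.next κ ξ s))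
      (.later κ ξ (.ident A t s)) := by
  obtain ⟨I, c, D, hI, hc, hD, -, hJ⟩ := hξ
  obtain ⟨T, hA, -⟩ := ht.ty.interp hJ
  obtain ⟨a, ht, -⟩ := ht.interp hJ hA
  obtain ⟨b, hs, -⟩ := hs.interp hJ hA
  exact ⟨I, _, hI, Ty.den_ident.2 ⟨_, Ty.den_later.2 ⟨c, hc, D, hD, T, hA, rfl⟩, _,
      Tm.den_next hc hD ht, _, Tm.den_next hc hD hs, SemTy.ident_later c D.fam a b⟩,
    Ty.den_later.2 ⟨c, hc, D, hD, _, Ty.den_ident.2 ⟨T, hA, a, ht, b, hs, rfl⟩, rfl⟩⟩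

/-! ### Soundness of the rules for delayed substitutions -/

theorem DSubEqSem.nil {κ : ℕ} (hΓ : ∃ I : CtxInterp.{u}, Ctx.den Γ = some I) (hκ : IsClk Γ κ) :
    DSubEqSem.{u} Γ κ .nil .nil := by
  obtain ⟨I, hI⟩ := hΓ
  obtain ⟨c, hc⟩ := hκ.den hI
  have h : DSub.nil.den I.psh I.env c = some ⟨I.psh, I.env, .nil c⟩ := by simp only [DSub.den]
  exact ⟨I, c, _, hI, hc, h, h, hI⟩

theorem DSubEqSem.snoc {κ : ℕ} {ξ ξ' : DSub} {A A' : Ty} {t t' : Tm}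
    (hξ : DSubEqSem.{u} Γ κ ξ ξ') (hA : TyEqSem.{u} (ξ.ext Γ) A A')
    (ht : TmEqSem.{u} Γ t t' (.later κ ξ A)) :
    DSubEqSem.{u} Γ κ (.snoc ξ A t) (.snoc ξ' A' t') := by
  obtain ⟨I, c, D, hI, hc, hD, hD', hJ⟩ := hξ
  obtain ⟨T, hA, hA'⟩ := hA.interp hJ
  obtain ⟨a, ht, ht'⟩ := ht.interp hI (Ty.den_later.2 ⟨c, hc, D, hD, T, hA, rfl⟩)
  exact ⟨I, c, _, hI, hc, DSub.den_snoc.2 ⟨D, hD, T, hA, a, ht, rfl⟩,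
    DSub.den_snoc.2 ⟨D, hD', T, hA', a, ht', rfl⟩, Ctx.den_cons_ty hJ hA⟩

/-- In a valid later type, the type under the delayed substitution is valid. -/
theorem TyEqSem.later_inv {κ : ℕ} {ξ : DSub} {A : Ty} (hξ : DSubEqSem.{u} Γ κ ξ ξ)
    (h : TyEqSem.{u} Γ (.later κ ξ A) (.later κ ξ A)) : TyEqSem.{u} (ξ.ext Γ) A A := by
  obtain ⟨I, c, D, hI, hc, hD, -, hJ⟩ := hξ
  obtain ⟨T, hT, -⟩ := h.interp hI
  obtain ⟨c', hc', D', hD', A', hA, -⟩ := Ty.den_later.1 hT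
  obtain rfl := Option.some_inj.1 (hc.symm.trans hc')
  obtain rfl := Option.some_inj.1 (hD.symm.trans hD')
  exact ⟨_, A', hJ, hA, hA⟩

end

section

variable {Γ : Ctx}

/-! ### Soundness of the rules for terms -/

theorem TmEqSem.symm {t s : Tm} {A : Ty} : TmEqSem.{u} Γ t s A → TmEqSem.{u} Γ s t A :=
  fun ⟨I, T, a, hI, hA, ht, hs⟩ => ⟨I, T, a, hI, hA, hs, ht⟩

theorem TmEqSem.trans {t s r : Tm} {A : Ty} (h : TmEqSem.{u} Γ t s A)
    (h' : TmEqSem.{u} Γ s r A) : TmEqSem.{u} Γ t r A := by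
  obtain ⟨I, T, a, hI, hA, ht, hs⟩ := h
  obtain ⟨b, hs', hr⟩ := h'.interp hI hA
  obtain rfl := Elem.mk_inj (Option.some_inj.1 (hs.symm.trans hs'))
  exact ⟨I, T, a, hI, hA, ht, hr⟩

theorem TmEqSem.conv {t s : Tm} {A B : Ty} (h : TmEqSem.{u} Γ t s A) (h' : TyEqSem.{u} Γ A B) :
    TmEqSem.{u} Γ t s B := by
  obtain ⟨I, T, a, hI, hA, ht, hs⟩ := h
  exact ⟨I, T, a, hI, h'.right hI hA, ht, hs⟩

theorem TmEqSem.var {n : ℕ} {A : Ty} (hΓ : ∃ I : CtxInterp.{u}, Ctx.den Γ = some I)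
    (hn : Γ[n]? = some (.ty A)) : TmEqSem.{u} Γ (.var n) (.var n) (A.ren (· + (n + 1))) := by
  obtain ⟨I, hI⟩ := hΓ
  obtain ⟨J, f, T, a, hT, hr, ha⟩ := Ctx.den_var hn hI
  have h : (Tm.var n).den I.psh I.env = some ⟨T.subst f, a⟩ := Tm.den_var.2 ha
  exact ⟨I, _, a, hI, Ty.den_ren hr hT, h, h⟩

theorem TmEqSem.lam {A A' B : Ty} {t t' : Tm} (hA : TyEqSem.{u} Γ A A')
    (ht : TmEqSem.{u} (.ty A :: Γ) t t' B) : TmEqSem.{u} Γ (.lam A t) (.lam A' t') (.pi A B) := by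
  obtain ⟨I, T, hI, hA, hA'⟩ := hA
  obtain ⟨S, hB, -⟩ := ht.ty.interp (Ctx.den_cons_ty hI hA)
  obtain ⟨b, ht, ht'⟩ := ht.interp (Ctx.den_cons_ty hI hA) hB
  exact ⟨I, T.pi S, semLam b, hI, Ty.den_pi.2 ⟨T, hA, S, hB, rfl⟩, Tm.den_lam hA ht,
    Tm.den_lam hA' ht'⟩

theorem TmEqSem.app {A A' B B' : Ty} {t t' u u' : Tm} (hA : TyEqSem.{u} Γ A A')
    (hB : TyEqSem.{u} (.ty A :: Γ) B B') (ht : TmEqSem.{u} Γ t t' (.pi A B))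
    (hu : TmEqSem.{u} Γ u u' A) :
    TmEqSem.{u} Γ (.app A B t u) (.app A' B' t' u') (B.inst u) := by
  obtain ⟨I, T, hI, hA, hA'⟩ := hA
  obtain ⟨S, hB, hB'⟩ := hB.interp (Ctx.den_cons_ty hI hA)
  obtain ⟨f, ht, ht'⟩ := ht.interp hI (Ty.den_pi.2 ⟨T, hA, S, hB, rfl⟩)
  obtain ⟨a, hu, hu'⟩ := hu.interp hI hA
  exact ⟨I, _, semApp f a, hI, Ty.den_inst hu hB, Tm.den_app hA hB ht hu,
    Tm.den_app hA' hB' ht' hu'⟩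

theorem TmEqSem.pair {A A' B B' : Ty} {t t' u u' : Tm} (hA : TyEqSem.{u} Γ A A')
    (hB : TyEqSem.{u} (.ty A :: Γ) B B') (ht : TmEqSem.{u} Γ t t' A)
    (hu : TmEqSem.{u} Γ u u' (B.inst t)) :
    TmEqSem.{u} Γ (.pair A B t u) (.pair A' B' t' u') (.sig A B) := by
  obtain ⟨I, T, hI, hA, hA'⟩ := hA
  obtain ⟨S, hB, hB'⟩ := hB.interp (Ctx.den_cons_ty hI hA)
  obtain ⟨a, ht, ht'⟩ := ht.interp hI hA
  obtain ⟨b, hu, hu'⟩ := hu.interp hI (Ty.den_inst ht hB)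
  exact ⟨I, _, semPair a b, hI, Ty.den_sig.2 ⟨T, hA, S, hB, rfl⟩, Tm.den_pair hA hB ht hu,
    Tm.den_pair hA' hB' ht' hu'⟩

theorem TmEqSem.fst {A A' B B' : Ty} {t t' : Tm} (hA : TyEqSem.{u} Γ A A')
    (hB : TyEqSem.{u} (.ty A :: Γ) B B') (ht : TmEqSem.{u} Γ t t' (.sig A B)) :
    TmEqSem.{u} Γ (.fst A B t) (.fst A' B' t') A := by
  obtain ⟨I, T, hI, hA, hA'⟩ := hA
  obtain ⟨S, hB, hB'⟩ := hB.interp (Ctx.den_cons_ty hI hA)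
  obtain ⟨p, ht, ht'⟩ := ht.interp hI (Ty.den_sig.2 ⟨T, hA, S, hB, rfl⟩)
  exact ⟨I, _, semFst p, hI, hA, Tm.den_fst hA hB ht, Tm.den_fst hA' hB' ht'⟩

theorem TmEqSem.snd {A A' B B' : Ty} {t t' : Tm} (hA : TyEqSem.{u} Γ A A')
    (hB : TyEqSem.{u} (.ty A :: Γ) B B') (ht : TmEqSem.{u} Γ t t' (.sig A B)) :
    TmEqSem.{u} Γ (.snd A B t) (.snd A' B' t') (B.inst (.fst A B t)) := by
  obtain ⟨I, T, hI, hA, hA'⟩ := hA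
  obtain ⟨S, hB, hB'⟩ := hB.interp (Ctx.den_cons_ty hI hA)
  obtain ⟨p, ht, ht'⟩ := ht.interp hI (Ty.den_sig.2 ⟨T, hA, S, hB, rfl⟩)
  exact ⟨I, _, semSnd p, hI, Ty.den_inst (Tm.den_fst hA hB ht) hB, Tm.den_snd hA hB ht,
    Tm.den_snd hA' hB' ht'⟩

theorem TmEqSem.next {κ : ℕ} {ξ ξ' : DSub} {A : Ty} {t t' : Tm} (hξ : DSubEqSem.{u} Γ κ ξ ξ')
    (ht : TmEqSem.{u} (ξ.ext Γ) t t' A) :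
    TmEqSem.{u} Γ (.next κ ξ t) (.next κ ξ' t') (.later κ ξ A) := by
  obtain ⟨I, c, D, hI, hc, hD, hD', hJ⟩ := hξ
  obtain ⟨T, hA, -⟩ := ht.ty.interp hJ
  obtain ⟨a, ht, ht'⟩ := ht.interp hJ hA
  exact ⟨I, _, _, hI, Ty.den_later.2 ⟨c, hc, D, hD, T, hA, rfl⟩, Tm.den_next hc hD ht,
    Tm.den_next hc hD' ht'⟩

theorem TmEqSem.prev {A A' : Ty} {t t' : Tm} (hA : TyEqSem.{u} (.clk :: Γ) A A')
    (ht : TmEqSem.{u} (.clk :: Γ) t t' (.later 0 .nil A)) :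
    TmEqSem.{u} Γ (.prev A t) (.prev A' t') (.all A) := by
  obtain ⟨J, T, hJ, hA, hA'⟩ := hA
  obtain ⟨I, hI, rfl⟩ := Ctx.den_clk.1 hJ
  obtain ⟨b, ht, ht'⟩ := ht.interp hJ (Ty.den_later_nil.2 ⟨lastClk I.psh, rfl, T, hA, rfl⟩)
  obtain ⟨a, rfl, -⟩ := existsUnique_prev b
  exact ⟨I, _, semClam a, hI, Ty.den_all.2 ⟨T, hA, rfl⟩, Tm.den_prev hA ht, Tm.den_prev hA' ht'⟩

theorem TmEqSem.fix {κ : ℕ} {A A' : Ty} {t t' : Tm} (hA : TyEqSem.{u} Γ A A')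
    (ht : TmEqSem.{u} (.ty (.later κ .nil A) :: Γ) t t' A.wk) :
    TmEqSem.{u} Γ (.fix κ A t) (.fix κ A' t') A := by
  obtain ⟨I, T, hI, hA, hA'⟩ := hA
  obtain ⟨L, hL, -⟩ := ht.dom.interp hI
  obtain ⟨c, hc, T', hT', rfl⟩ := Ty.den_later_nil.1 hL
  obtain rfl := Option.some_inj.1 (hA.symm.trans hT')
  obtain ⟨b, ht, ht'⟩ := ht.interp (Ctx.den_cons_ty hI hL) (Ty.den_wk hA _)
  obtain ⟨a, ha, -⟩ := existsUnique_fix b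
  exact ⟨I, T, a, hI, hA, Tm.den_fix hc hA ht ha, Tm.den_fix hc hA' ht' ha⟩

theorem TmEqSem.clam {A : Ty} {t t' : Tm} (ht : TmEqSem.{u} (.clk :: Γ) t t' A) :
    TmEqSem.{u} Γ (.clam t) (.clam t') (.all A) := by
  obtain ⟨J, T, a, hJ, hA, ht, ht'⟩ := ht
  obtain ⟨I, hI, rfl⟩ := Ctx.den_clk.1 hJ
  exact ⟨I, _, semClam a, hI, Ty.den_all.2 ⟨T, hA, rfl⟩, Tm.den_clam ht, Tm.den_clam ht'⟩

theorem TmEqSem.capp {A A' : Ty} {t t' : Tm} {κ : ℕ} (hA : TyEqSem.{u} (.clk :: Γ) A A')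
    (ht : TmEqSem.{u} Γ t t' (.all A)) (hκ : IsClk Γ κ) :
    TmEqSem.{u} Γ (.capp A t κ) (.capp A' t' κ) (A.instClk κ) := by
  obtain ⟨J, T, hJ, hA, hA'⟩ := hA
  obtain ⟨I, hI, rfl⟩ := Ctx.den_clk.1 hJ
  obtain ⟨f, ht, ht'⟩ := ht.interp hI (Ty.den_all.2 ⟨T, hA, rfl⟩)
  obtain ⟨c, hc⟩ := hκ.den hI
  exact ⟨I, _, semCapp f c, hI, Ty.den_instClk hc hA, Tm.den_capp hA ht hc,
    Tm.den_capp hA' ht' hc⟩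

theorem TmEqSem.refl_congr {A A' : Ty} {t t' : Tm} (hA : TyEqSem.{u} Γ A A')
    (ht : TmEqSem.{u} Γ t t' A) : TmEqSem.{u} Γ (.refl A t) (.refl A' t') (.ident A t t) := by
  obtain ⟨I, T, hI, hA, hA'⟩ := hA
  obtain ⟨a, ht, ht'⟩ := ht.interp hI hA
  exact ⟨I, _, semRefl a, hI, Ty.den_ident.2 ⟨T, hA, a, ht, a, ht, rfl⟩, Tm.den_refl hA ht,
    Tm.den_refl hA' ht'⟩

theorem TmEqSem.incl {Δ Δ' : Finset ℕ} {t t' : Tm} (ht : TmEqSem.{u} Γ t t' (.univ Δ))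
    (hΔ' : TyEqSem.{u} Γ (.univ Δ') (.univ Δ')) (hΔ : Δ ⊆ Δ') :
    TmEqSem.{u} Γ (.incl Δ Δ' t) (.incl Δ Δ' t') (.univ Δ') := by
  obtain ⟨I, T, a, hI, hT, ht, ht'⟩ := ht
  obtain ⟨K, hK, rfl⟩ := Ty.den_univ.1 hT
  obtain ⟨T', hT', -⟩ := hΔ'.interp hI
  obtain ⟨K', hK', rfl⟩ := Ty.den_univ.1 hT'
  have hKK := Env.clks_mono hK hK' hΔ
  exact ⟨I, _, semIncl hKK a, hI, hT', Tm.den_incl hK hK' hKK ht, Tm.den_incl hK hK' hKK ht'⟩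

theorem TmEqSem.pi_beta {A B : Ty} {t u : Tm} (ht : TmEqSem.{u} (.ty A :: Γ) t t B)
    (hu : TmEqSem.{u} Γ u u A) :
    TmEqSem.{u} Γ (.app A B (.lam A t) u) (t.inst u) (B.inst u) := by
  obtain ⟨I, T, a, hI, hA, hu, -⟩ := hu
  obtain ⟨S, hB, -⟩ := ht.ty.interp (Ctx.den_cons_ty hI hA)
  obtain ⟨b, ht, -⟩ := ht.interp (Ctx.den_cons_ty hI hA) hB
  refine ⟨I, _, b.subst (sect a), hI, Ty.den_inst hu hB, ?_, Tm.den_inst hu ht⟩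
  rw [← semApp_semLam b a]
  exact Tm.den_app hA hB (Tm.den_lam hA ht) hu

theorem TmEqSem.pi_eta {A B : Ty} {t : Tm} (ht : TmEqSem.{u} Γ t t (.pi A B)) :
    TmEqSem.{u} Γ (.lam A (.app A.wk (B.ren (upR (· + 1))) t.wk (.var 0))) t (.pi A B) := by
  obtain ⟨I, P, f, hI, hP, ht, -⟩ := ht
  obtain ⟨T, hA, S, hB, rfl⟩ := Ty.den_pi.1 hP
  refine ⟨I, _, f, hI, hP, ?_, ht⟩
  have hB' := Ty.den_ren ((RenRel.proj I.env T).ext T) hB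
  have ht' := Tm.den_wk ht T
  rw [Elem.subst, ← Elem.mk_cast (SemTy.pi_subst (proj T) T S)] at ht'
  have hv : (Tm.var 0).den _ (I.env.ext T) = some ⟨_, lastVar T⟩ :=
    Tm.den_var.2 rfl
  have h := Tm.den_lam (B' := S) hA (Tm.den_app (Ty.den_wk hA T) hB' ht' hv)
  rw [semLam_eta f] at h
  exact h

theorem TmEqSem.fst_pair {A B : Ty} {t u : Tm} (hB : TyEqSem.{u} (.ty A :: Γ) B B)
    (ht : TmEqSem.{u} Γ t t A) (hu : TmEqSem.{u} Γ u u (B.inst t)) :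
    TmEqSem.{u} Γ (.fst A B (.pair A B t u)) t A := by
  obtain ⟨I, T, a, hI, hA, ht, -⟩ := ht
  obtain ⟨S, hB, -⟩ := hB.interp (Ctx.den_cons_ty hI hA)
  obtain ⟨b, hu, -⟩ := hu.interp hI (Ty.den_inst ht hB)
  exact ⟨I, T, a, hI, hA, Tm.den_fst hA hB (Tm.den_pair hA hB ht hu), ht⟩

theorem TmEqSem.snd_pair {A B : Ty} {t u : Tm} (hB : TyEqSem.{u} (.ty A :: Γ) B B)
    (ht : TmEqSem.{u} Γ t t A) (hu : TmEqSem.{u} Γ u u (B.inst t)) :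
    TmEqSem.{u} Γ (.snd A B (.pair A B t u)) u (B.inst t) := by
  obtain ⟨I, T, a, hI, hA, ht, -⟩ := ht
  obtain ⟨S, hB, -⟩ := hB.interp (Ctx.den_cons_ty hI hA)
  obtain ⟨b, hu, -⟩ := hu.interp hI (Ty.den_inst ht hB)
  exact ⟨I, _, b, hI, Ty.den_inst ht hB, Tm.den_snd hA hB (Tm.den_pair hA hB ht hu), hu⟩

theorem TmEqSem.sig_eta {A B : Ty} {t : Tm} (ht : TmEqSem.{u} Γ t t (.sig A B)) :
    TmEqSem.{u} Γ (.pair A B (.fst A B t) (.snd A B t)) t (.sig A B) := by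
  obtain ⟨I, P, p, hI, hP, ht, -⟩ := ht
  obtain ⟨T, hA, S, hB, rfl⟩ := Ty.den_sig.1 hP
  exact ⟨I, _, p, hI, hP, Tm.den_pair hA hB (Tm.den_fst hA hB ht) (Tm.den_snd hA hB ht), ht⟩

theorem TmEqSem.all_beta {A : Ty} {t : Tm} {κ : ℕ} (ht : TmEqSem.{u} (.clk :: Γ) t t A)
    (hκ : IsClk Γ κ) :
    TmEqSem.{u} Γ (.capp A (.clam t) κ) (t.instClk κ) (A.instClk κ) := by
  obtain ⟨J, T, a, hJ, hA, ht, -⟩ := ht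
  obtain ⟨I, hI, rfl⟩ := Ctx.den_clk.1 hJ
  obtain ⟨c, hc⟩ := hκ.den hI
  refine ⟨I, _, a.subst (sectClk c), hI, Ty.den_instClk hc hA, ?_, Tm.den_instClk hc ht⟩
  rw [← semCapp_semClam a c]
  exact Tm.den_capp hA (Tm.den_clam ht) hc

/-- The interpretation of `t[κ]` for the last variable `κ` and a term `t` weakened by it. -/
theorem Tm.den_capp_wk {I : CtxInterp.{u}} {A : Ty} {T : SemTy (compClk I.psh)} {t : Tm}
    {f : SemTm T.all} (hA : A.den _ I.env.extClk = some T)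
    (ht : t.den I.psh I.env = some ⟨_, f⟩) :
    (Tm.capp (A.ren (upR (· + 1))) t.wk 0).den _ I.env.extClk = some ⟨T,
      semCapp (A := T.subst (liftClk (projClk I.psh)))
        ((f.subst (projClk I.psh)).cast (SemTy.all_subst (projClk I.psh) T))
        (lastClk I.psh)⟩ := by
  have ht' := Tm.den_wkClk ht
  rw [Elem.subst, ← Elem.mk_cast (SemTy.all_subst (projClk I.psh) T)] at ht'
  exact Tm.den_capp (κ := 0) (c := lastClk I.psh)
    (Ty.den_ren (RenRel.projClk I.env).extClk hA) ht' rfl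

theorem TmEqSem.all_eta {A : Ty} {t : Tm} (ht : TmEqSem.{u} Γ t t (.all A)) :
    TmEqSem.{u} Γ (.clam (.capp (A.ren (upR (· + 1))) t.wk 0)) t (.all A) := by
  obtain ⟨I, P, f, hI, hP, ht, -⟩ := ht
  obtain ⟨T, hA, rfl⟩ := Ty.den_all.1 hP
  refine ⟨I, _, f, hI, hP, ?_, ht⟩
  have h := Tm.den_clam (Tm.den_capp_wk hA ht)
  rw [semClam_eta f] at h
  exact h

theorem TmEqSem.prev_next {A : Ty} {t : Tm} (ht : TmEqSem.{u} (.clk :: Γ) t t A) :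
    TmEqSem.{u} Γ (.prev A (.next 0 .nil t)) (.clam t) (.all A) := by
  obtain ⟨J, T, a, hJ, hA, ht, -⟩ := ht
  obtain ⟨I, hI, rfl⟩ := Ctx.den_clk.1 hJ
  exact ⟨I, _, semClam a, hI, Ty.den_all.2 ⟨T, hA, rfl⟩,
    Tm.den_prev hA (Tm.den_next_nil (c := lastClk I.psh) rfl ht), Tm.den_clam ht⟩

/-- Here `prev κ. t` is weakened and applied to `κ` again, which gives back the unique `a` with
`next^κ a = t`. -/
theorem TmEqSem.next_prev {A : Ty} {t : Tm} (ht : TmEqSem.{u} (.clk :: Γ) t t (.later 0 .nil A)) :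
    TmEqSem.{u} (.clk :: Γ) (.next 0 .nil (.capp (A.ren (upR (· + 1))) (Tm.prev A t).wk 0)) t
      (.later 0 .nil A) := by
  obtain ⟨J, P, b, hJ, hP, ht, -⟩ := ht
  obtain ⟨I, hI, rfl⟩ := Ctx.den_clk.1 hJ
  obtain ⟨c, hc, T, hA, rfl⟩ := Ty.den_later_nil.1 hP
  obtain rfl : lastClk I.psh = c := Option.some_inj.1 hc
  obtain ⟨a, rfl, -⟩ := existsUnique_prev b
  refine ⟨_, _, _, hJ, hP, ?_, ht⟩
  have h := Tm.den_capp_wk hA (Tm.den_prev hA ht)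
  have e : semCapp (A := T.subst (liftClk (projClk I.psh)))
      (((semClam a).subst (projClk I.psh)).cast (SemTy.all_subst (projClk I.psh) T))
      (lastClk I.psh) = a := by
    have h₁ : ((semClam a).subst (projClk I.psh)).cast (SemTy.all_subst (projClk I.psh) T)
        = semClam (a.subst (liftClk (projClk I.psh))) :=
      Elem.mk_inj ((Elem.mk_cast _ _).trans (semClam_subst (projClk I.psh) a))
    rw [h₁]
    exact semCapp_semClam _ _
  rw [e] at h
  exact Tm.den_next_nil rfl h

theorem TmEqSem.fix_unfold {κ : ℕ} {A : Ty} {t : Tm}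
    (ht : TmEqSem.{u} (.ty (.later κ .nil A) :: Γ) t t A.wk) :
    TmEqSem.{u} Γ (.fix κ A t) (t.inst (.next κ .nil (.fix κ A t))) A := by
  obtain ⟨I, L, hI, hL, -⟩ := ht.dom
  obtain ⟨c, hc, T, hA, rfl⟩ := Ty.den_later_nil.1 hL
  obtain ⟨b, ht, -⟩ := ht.interp (Ctx.den_cons_ty hI hL) (Ty.den_wk hA _)
  obtain ⟨a, ha, -⟩ := existsUnique_fix b
  have h := Tm.den_fix hc hA ht ha
  refine ⟨I, T, a, hI, hA, h, ?_⟩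
  refine (Tm.den_inst (Tm.den_next_nil hc h) ht).trans ?_
  exact congrArg (fun x : SemTm T => some (⟨T, x⟩ : Elem I.psh)) ha.symm

theorem TmEqSem.clock_irrel {A : Ty} {t : Tm} {κ κ' : ℕ} (hA : TyEqSem.{u} Γ A A)
    (ht : TmEqSem.{u} Γ t t (.all A.wk)) (hκ : IsClk Γ κ) (hκ' : IsClk Γ κ') :
    TmEqSem.{u} Γ (.capp A.wk t κ) (.capp A.wk t κ') A := by
  obtain ⟨I, T, hI, hA, -⟩ := hA
  have hA' := Ty.den_wkClk hA
  obtain ⟨f, ht, -⟩ := ht.interp hI (Ty.den_all.2 ⟨_, hA', rfl⟩)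
  obtain ⟨c, hc⟩ := hκ.den hI
  obtain ⟨c', hc'⟩ := hκ'.den hI
  refine ⟨I, T, semCapp f c, hI, hA, Tm.den_capp hA' ht hc, ?_⟩
  rw [semCapp_irrel (A.inv_of_den hA) f c c']
  exact Tm.den_capp hA' ht hc'

theorem TmEqSem.reflection {A : Ty} {t s p : Tm} (hp : TmEqSem.{u} Γ p p (.ident A t s)) :
    TmEqSem.{u} Γ t s A := by
  obtain ⟨I, P, q, hI, hP, -⟩ := hp
  obtain ⟨T, hA, a, ht, b, hs, rfl⟩ := Ty.den_ident.1 hP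
  obtain rfl : a = b := SemTm.ext (funext fun X => funext fun γ => (q.val X γ).down.down)
  exact ⟨I, T, a, hI, hA, ht, hs⟩

theorem TmEqSem.ident_eta {A : Ty} {t p : Tm} (hp : TmEqSem.{u} Γ p p (.ident A t t)) :
    TmEqSem.{u} Γ p (.refl A t) (.ident A t t) := by
  obtain ⟨I, P, q, hI, hP, hp, -⟩ := hp
  obtain ⟨T, hA, a, ht, b, hs, rfl⟩ := Ty.den_ident.1 hP
  obtain rfl := Elem.mk_inj (Option.some_inj.1 (ht.symm.trans hs))
  obtain rfl : q = semRefl a := SemTm.ext (funext fun X => funext fun γ => rfl)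
  exact ⟨I, _, _, hI, hP, hp, Tm.den_refl hA ht⟩

theorem TmEqSem.next_wk {κ : ℕ} {ξ : DSub} {A B : Ty} {t u : Tm}
    (hξ : DSubEqSem.{u} Γ κ (.snoc ξ B t) (.snoc ξ B t)) (hu : TmEqSem.{u} (ξ.ext Γ) u u A) :
    TmEqSem.{u} Γ (.next κ (.snoc ξ B t) u.wk) (.next κ ξ u) (.later κ ξ A) := by
  obtain ⟨I, c, E, hI, hc, hE, -, hJ⟩ := hξ
  obtain ⟨D, hD, B', hB, t', ht, rfl⟩ := DSub.den_snoc.1 hE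
  obtain ⟨J, hJ, -⟩ := Ctx.den_ty.1 hJ
  obtain rfl := Ctx.den_ext hI ξ hD hJ
  obtain ⟨T, hA, -⟩ := hu.ty.interp hJ
  obtain ⟨a, hu, -⟩ := hu.interp hJ hA
  refine ⟨I, _, _, hI, Ty.den_later.2 ⟨c, hc, D, hD, T, hA, rfl⟩, ?_, Tm.den_next hc hD hu⟩
  rw [← semNext_wk D.fam t' a]
  exact Tm.den_next hc hE (Tm.den_wk hu B')

theorem TmEqSem.next_swap {κ : ℕ} {ξ ζ : DSub} {A B C : Ty} {t u v : Tm}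
    (hξ : DSubEqSem.{u} Γ κ ((DSub.snoc (.snoc ξ B t) C.wk u).append ζ)
      ((DSub.snoc (.snoc ξ B t) C.wk u).append ζ)) (hC : TyEqSem.{u} (ξ.ext Γ) C C)
    (hv : TmEqSem.{u} (((DSub.snoc (.snoc ξ B t) C.wk u).append ζ).ext Γ) v v A) :
    TmEqSem.{u} Γ (.next κ ((DSub.snoc (.snoc ξ B t) C.wk u).append ζ) v)
      (.next κ ((DSub.snoc (.snoc ξ C u) B.wk t).append (ζ.renTel swapLast))
        (v.ren (upRN swapLast ζ.len)))
      (.later κ ((DSub.snoc (.snoc ξ B t) C.wk u).append ζ) A) := by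
  obtain ⟨I, hI⟩ := hξ.ctx
  obtain ⟨c, E₁, E₂, g, hc, hE₁, hE₂, hr, ho, hJ⟩ := hξ.swap hC hI
  obtain ⟨T, hA, -⟩ := hv.ty.interp hJ
  obtain ⟨a, hv, -⟩ := hv.interp hJ hA
  refine ⟨I, _, _, hI, Ty.den_later.2 ⟨c, hc, E₁, hE₁, T, hA, rfl⟩, Tm.den_next hc hE₁ hv, ?_⟩
  refine (Tm.den_next hc hE₂ (Tm.den_ren hr hv)).trans ?_
  exact congrArg some (semNext_subst ho a).symm

theorem TmEqSem.next_next {κ : ℕ} {ξ : DSub} {A B : Ty} {t u : Tm}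
    (hξ : DSubEqSem.{u} Γ κ ξ ξ) (hu : TmEqSem.{u} (.ty B :: ξ.ext Γ) u u A)
    (ht : TmEqSem.{u} (ξ.ext Γ) t t B) :
    TmEqSem.{u} Γ (.next κ (.snoc ξ B (.next κ ξ t)) u) (.next κ ξ (u.inst t))
      (.later κ ξ (A.inst t)) := by
  obtain ⟨I, c, D, hI, hc, hD, -, hJ⟩ := hξ
  obtain ⟨B', hB, -⟩ := ht.ty.interp hJ
  obtain ⟨b, ht, -⟩ := ht.interp hJ hB
  obtain ⟨T, hA, -⟩ := hu.ty.interp (Ctx.den_cons_ty hJ hB)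
  obtain ⟨a, hu, -⟩ := hu.interp (Ctx.den_cons_ty hJ hB) hA
  refine ⟨I, _, _, hI, Ty.den_later.2 ⟨c, hc, D, hD, _, Ty.den_inst ht hA, rfl⟩, ?_,
    Tm.den_next hc hD (Tm.den_inst ht hu)⟩
  rw [← semNext_next D.fam b a]
  exact Tm.den_next hc (DSub.den_snoc.2 ⟨D, hD, B', hB, _, Tm.den_next hc hD ht, rfl⟩) hu

theorem TmEqSem.next_var {κ : ℕ} {ξ : DSub} {A : Ty} {t : Tm} (hξ : DSubEqSem.{u} Γ κ ξ ξ)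
    (ht : TmEqSem.{u} Γ t t (.later κ ξ A)) :
    TmEqSem.{u} Γ (.next κ (.snoc ξ A t) (.var 0)) t (.later κ ξ A) := by
  have hA := TyEqSem.later_inv hξ ht.ty
  obtain ⟨I, c, D, hI, hc, hD, -, hJ⟩ := hξ
  obtain ⟨T, hA, -⟩ := hA.interp hJ
  have hL := Ty.den_later.2 ⟨c, hc, D, hD, T, hA, rfl⟩
  obtain ⟨a, ht, -⟩ := ht.interp hI hL
  refine ⟨I, _, a, hI, hL, ?_, ht⟩
  rw [← semNext_lastVar D.fam a]
  exact Tm.den_next hc (DSub.den_snoc.2 ⟨D, hD, T, hA, a, ht, rfl⟩) (Tm.den_var.2 rfl)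

theorem TmEqSem.next_comm {κ : ℕ} {ξ ξ' : DSub} {A : Ty} {u : Tm} (hA : TyEqSem.{u} Γ A A)
    (hξ : DSubEqSem.{u} Γ κ ξ ξ) (hξ' : DSubEqSem.{u} Γ κ ξ' ξ')
    (hu : TmEqSem.{u} ((ξ'.ren (· + ξ.len)).ext (ξ.ext Γ)) u u
      (A.ren (· + (ξ.len + ξ'.len)))) :
    TmEqSem.{u} Γ (.next κ ξ (.next (κ + ξ.len) (ξ'.ren (· + ξ.len)) u))
      (.next κ ξ' (.next (κ + ξ'.len) (ξ.ren (· + ξ'.len)) (u.ren (swapBlocks ξ.len ξ'.len))))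
      (.later κ .nil (.later κ .nil A)) := by
  obtain ⟨I, T, hI, hA, -⟩ := hA
  obtain ⟨c, D, hc, hD, -, hJ⟩ := hξ.interp hI
  obtain ⟨c', D', hc', hD', -⟩ := hξ'.interp hI
  obtain rfl := Option.some_inj.1 (hc.symm.trans hc')
  obtain ⟨a, h, h'⟩ := Tm.den_next_comm hc hA hD hD' fun P hP => by
    obtain ⟨K, S, v, hK, hS, hv, -⟩ := hu
    obtain rfl := Ctx.den_ext hJ (ξ'.ren (· + ξ.len)) hP hK
    exact ⟨S, v, hS, hv⟩
  exact ⟨I, _, a, hI, Ty.den_later_nil.2 ⟨c, hc, _, Ty.den_later_nil.2 ⟨c, hc, T, hA, rfl⟩, rfl⟩,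
    h, h'⟩

end

/-! ### Soundness of the interpretation -/

mutual

/-- Derivable judgements are valid.  An `Ok` judgement is treated as the equality of its subject
with itself, so that the congruence rules also cover the formation and typing rules. -/
theorem CtxOk.sound : ∀ {Γ : Ctx}, CtxOk Γ → ∃ I : CtxInterp.{u}, Ctx.den Γ = some I
  | _, .nil => ⟨_, rfl⟩
  | _, .ty h => by
    obtain ⟨I, T, hI, hA, -⟩ := h.sound
    exact ⟨_, Ctx.den_cons_ty hI hA⟩
  | _, .clk h => by
    obtain ⟨I, hI⟩ := h.sound
    exact ⟨_, Ctx.den_cons_clk hI⟩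

theorem TyOk.sound : ∀ {Γ : Ctx} {A : Ty}, TyOk Γ A → TyEqSem.{u} Γ A A
  | _, _, .pi hB => .pi hB.sound.dom hB.sound
  | _, _, .sig hB => .sig hB.sound.dom hB.sound
  | _, _, .later hξ hA => .later hξ.sound hA.sound
  | _, _, .all hA => .all hA.sound
  | _, _, .ident ht hs => .ident ht.sound.ty ht.sound hs.sound
  | _, _, .univ hΓ hΔ => .univ hΓ.sound hΔ
  | _, _, .el ht => .el ht.sound

theorem DSubOk.sound : ∀ {Γ : Ctx} {κ : ℕ} {ξ : DSub}, DSubOk Γ κ ξ → DSubEqSem.{u} Γ κ ξ ξ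
  | _, _, _, .nil hΓ hκ => .nil hΓ.sound hκ
  | _, _, _, .snoc hξ ht => .snoc hξ.sound (.later_inv hξ.sound ht.sound.ty) ht.sound

theorem TmOk.sound : ∀ {Γ : Ctx} {t : Tm} {A : Ty}, TmOk Γ t A → TmEqSem.{u} Γ t t A
  | _, _, _, .var hΓ hn => .var hΓ.sound hn
  | _, _, _, .lam ht => .lam ht.sound.dom ht.sound
  | _, _, _, .app ht hu => .app hu.sound.ty ht.sound.ty.pi_inv ht.sound hu.sound
  | _, _, _, .pair hB ht hu => .pair ht.sound.ty hB.sound ht.sound hu.sound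
  | _, _, _, .fst ht => .fst ht.sound.ty.sig_inv.dom ht.sound.ty.sig_inv ht.sound
  | _, _, _, .snd ht => .snd ht.sound.ty.sig_inv.dom ht.sound.ty.sig_inv ht.sound
  | _, _, _, .next hξ ht => .next hξ.sound ht.sound
  | _, _, _, .prev ht => .prev ht.sound.ty.later_nil_inv ht.sound
  | _, _, _, .fix ht => .fix ht.sound.dom.later_nil_inv ht.sound
  | _, _, _, .clam ht => .clam ht.sound
  | _, _, _, .capp ht hκ => .capp ht.sound.ty.all_inv ht.sound hκ
  | _, _, _, .refl ht => .refl_congr ht.sound.ty ht.sound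
  | _, _, _, .incl ht hΔ' hΔ => .incl ht.sound hΔ'.sound hΔ
  | _, _, _, .conv ht h => ht.sound.conv h.sound

theorem TyEq.sound : ∀ {Γ : Ctx} {A B : Ty}, TyEq Γ A B → TyEqSem.{u} Γ A B
  | _, _, _, .refl hA => hA.sound
  | _, _, _, .symm h => h.sound.symm
  | _, _, _, .trans h h' => h.sound.trans h'.sound
  | _, _, _, .pi hA hB => .pi hA.sound hB.sound
  | _, _, _, .sig hA hB => .sig hA.sound hB.sound
  | _, _, _, .later hξ hA => .later hξ.sound hA.sound
  | _, _, _, .all hA => .all hA.sound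
  | _, _, _, .ident hA ht hs => .ident hA.sound ht.sound hs.sound
  | _, _, _, .el ht => .el ht.sound
  | _, _, _, .el_incl ht hΔ' hΔ => .el_incl ht.sound hΔ'.sound hΔ
  | _, _, _, .later_wk hξ hA => .later_wk hξ.sound hA.sound
  | _, _, _, .later_swap hξ hC hA => .later_swap hξ.sound hC.sound hA.sound
  | _, _, _, .later_next hξ hA ht => .later_next hξ.sound hA.sound ht.sound
  | _, _, _, .ident_later hξ ht hs => .ident_later hξ.sound ht.sound hs.sound

theorem DSubEq.sound : ∀ {Γ : Ctx} {κ : ℕ} {ξ ξ' : DSub}, DSubEq Γ κ ξ ξ' →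
    DSubEqSem.{u} Γ κ ξ ξ'
  | _, _, _, _, .nil hΓ hκ => .nil hΓ.sound hκ
  | _, _, _, _, .snoc hξ hA ht => .snoc hξ.sound hA.sound ht.sound

theorem TmEq.sound : ∀ {Γ : Ctx} {t s : Tm} {A : Ty}, TmEq Γ t s A → TmEqSem.{u} Γ t s A
  | _, _, _, _, .refl ht => ht.sound
  | _, _, _, _, .symm h => h.sound.symm
  | _, _, _, _, .trans h h' => h.sound.trans h'.sound
  | _, _, _, _, .conv h h' => h.sound.conv h'.sound
  | _, _, _, _, .lam hA ht => .lam hA.sound ht.sound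
  | _, _, _, _, .app hA hB ht hu => .app hA.sound hB.sound ht.sound hu.sound
  | _, _, _, _, .pair hA hB ht hu => .pair hA.sound hB.sound ht.sound hu.sound
  | _, _, _, _, .fst hA hB ht => .fst hA.sound hB.sound ht.sound
  | _, _, _, _, .snd hA hB ht => .snd hA.sound hB.sound ht.sound
  | _, _, _, _, .next hξ ht => .next hξ.sound ht.sound
  | _, _, _, _, .prev hA ht => .prev hA.sound ht.sound
  | _, _, _, _, .fix hA ht => .fix hA.sound ht.sound
  | _, _, _, _, .clam ht => .clam ht.sound
  | _, _, _, _, .capp hA ht hκ => .capp hA.sound ht.sound hκ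
  | _, _, _, _, .refl_congr hA ht => .refl_congr hA.sound ht.sound
  | _, _, _, _, .incl ht hΔ' hΔ => .incl ht.sound hΔ'.sound hΔ
  | _, _, _, _, .pi_beta ht hu => .pi_beta ht.sound hu.sound
  | _, _, _, _, .pi_eta ht => .pi_eta ht.sound
  | _, _, _, _, .fst_pair hB ht hu => .fst_pair hB.sound ht.sound hu.sound
  | _, _, _, _, .snd_pair hB ht hu => .snd_pair hB.sound ht.sound hu.sound
  | _, _, _, _, .sig_eta ht => .sig_eta ht.sound
  | _, _, _, _, .all_beta ht hκ => .all_beta ht.sound hκ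
  | _, _, _, _, .all_eta ht => .all_eta ht.sound
  | _, _, _, _, .prev_next ht => .prev_next ht.sound
  | _, _, _, _, .next_prev ht => .next_prev ht.sound
  | _, _, _, _, .fix_unfold ht => .fix_unfold ht.sound
  | _, _, _, _, .clock_irrel hA ht hκ hκ' => .clock_irrel hA.sound ht.sound hκ hκ'
  | _, _, _, _, .reflection _ _ hp => .reflection hp.sound
  | _, _, _, _, .ident_eta hp => .ident_eta hp.sound
  | _, _, _, _, .next_wk hξ hu => .next_wk hξ.sound hu.sound
  | _, _, _, _, .next_swap hξ hC hv => .next_swap hξ.sound hC.sound hv.sound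
  | _, _, _, _, .next_next hξ hu ht => .next_next hξ.sound hu.sound ht.sound
  | _, _, _, _, .next_var hξ ht => .next_var hξ.sound ht.sound
  | _, _, _, _, .next_comm hA hξ hξ' hu => .next_comm hA.sound hξ.sound hξ'.sound hu.sound

end

end GDTT

theorem mainTheorem2 (Γ : GDTT.Ctx) (A : GDTT.Ty) (hA : GDTT.TyOk Γ A) :
    ∃ (I : GDTT.CtxInterp.{u}) (T : GDTT.SemTy I.psh),
      GDTT.Ctx.den Γ = some I ∧ A.den I.psh I.env = some T ∧
      GDTT.Ctx.den (.ty A :: Γ) = some ⟨GDTT.comp I.psh T, I.env.ext T⟩ ∧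
      GDTT.InvariantUnderClockIntro (GDTT.proj T) := by
  obtain ⟨I, T, hI, hT, -⟩ := hA.sound
  exact ⟨I, T, hI, hT, GDTT.Ctx.den_cons_ty hI hT,
    (A.inv_of_den hT).invariantUnderClockIntro⟩
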